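/- Let $d\in\{2,3\}$, let $\Omega\subset\mathbb R^d$ be a bounded Lipschitz domain with outward unit normal $\nu$, and let $\Gamma=\partial\Omega=\Gamma_D\cup\Gamma_N$ with $\Gamma_D,\Gamma_N$ disjoint and measurable. Let $C=(c_{ijkl})\in L^\infty(\Omega)$ satisfy $c_{ijkl}=c_{klij}=c_{jikl}$ and $c_{ijkl}(x)\xi_{ij}\xi_{kl}\ge c_*|\xi|^2$ for all $x\in\Omega$ and all symmetric $\xi$, with some $c_*>0$. Let $\rho,\alpha,\epsilon>0$, and let $\gamma_*\in L^\infty(\Omega)$ with $\operatorname{ess\,inf}_\Omega\gamma_*>0$. For $u:\overline\Omega\to\mathbb R^d$ and $z:\overline\Omega\to\mathbb R$ put $$e_{ij}[u]=\tfrac12(\partial_ju_i+\partial_iu_j),\quad \sigma_{ij}[u]=c_{ijkl}e_{kl}[u],\quad \sigma[u,z]=(1-z)^2\sigma[u],\quad W(u)=\sigma[u]:e[u].$$ Let $T>0$, and let $f$ be a measurable volume force with $f(t)\in L^2(\Omega)$ for $t\in[0,T]$ that is Lipschitz in time: $|f(s,x)-f(t,x)|\le k(x)|s-t|$ for a.e.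 $x\in\Omega$ and all $s,t\in[0,T]$, with some $k\in L^2(\Omega)$. Let $q$ be a surface force on $\Gamma_N$ and $g$ a prescribed displacement on $\Gamma_D$. Let $(u,z)$ be a solution of $$\rho\,\ddot u=\operatorname{div}\sigma[u,z]+f\ \text{ and }\ \alpha\,\dot z=\Bigl(\epsilon\operatorname{div}(\gamma_*\nabla z)-\tfrac{\gamma_*}{\epsilon}z+(1-z)W(u)\Bigr)_+\quad\text{a.e. in }\Omega\times(0,T),$$ $$\sigma[u,z]\nu=q\ \text{on }\Gamma_N\times[0,T],\qquad u=g\ \text{on }\Gamma_D\times[0,T],\qquad \frac{\partial z}{\partial\nu}=0\ \text{on }\Gamma\times[0,T],$$ with initial values $u|_{t=0}=u_0$, $\dot u|_{t=0}=v_0$, $z|_{t=0}=z_0$ in $\Omega$ (the conditions that involve $\nu$ are imposed at the points of $\Gamma$ where $\nu$ exists). Assume that $(u,z)$ is sufficiently smooth in the following sense: $u$ and $z$ are of class $C^{1,1}$ on $\overline\Omega\times[0,T]$ (restrictions of $C^1$ functions on $\mathbb R\times\mathbb R^d$ with locally Lipschitz first derivatives), and for every $t\in[0,T]$ the field $\sigma[u,z](t)$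 is Lipschitz on $\overline\Omega$ and $\gamma_*\nabla z(t)$ is Lipschitz on $\Omega$. Define the total energy $$E(t,u,v,z)=\tfrac12\int_\Omega\sigma[u,z]:e[u]\,dx-\int_\Omega f(t)\cdot u\,dx-\int_{\Gamma_N}q(t)\cdot u\,ds+\tfrac\rho2\int_\Omega|v|^2dx+\tfrac12\int_\Omega\gamma_*\Bigl(\epsilon|\nabla z|^2+\tfrac{z^2}\epsilon\Bigr)dx$$ and the energy injection rate $$\dot F(t,u,z)=\int_{\Gamma_D}\dot g(t)\cdot(\sigma[u,z]\nu)\,ds-\int_\Omega\dot f(t)\cdot u\,dx-\int_{\Gamma_N}\dot q(t)\cdot u\,ds,$$ where $ds$ is the surface measure. Then for a.e. $t\in(0,T)$ the function $t\mapsto E(t,u(t),\dot u(t),z(t))$ is differentiable at $t$ and $$\frac{d}{dt}E(t,u(t),\dot u(t),z(t))=-\alpha\int_\Omega|\dot z(t)|^2\,dx+\dot F(t,u(t),z(t)).$$ -/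

import Mathlib

open MeasureTheory Set Filter Topology
open scoped NNReal ENNReal InnerProductSpace

namespace DynamicFracture

/-- The Euclidean space `ℝ^d`. -/
abbrev Pt (d : ℕ) : Type := EuclideanSpace ℝ (Fin d)

/-- Real `d × d` tensors. -/
abbrev Tensor (d : ℕ) : Type := Matrix (Fin d) (Fin d) ℝ

/-- Near each boundary point and after a choice of a vertical unit direction `e`, the set `Ω` is
the strict subgraph of a Lipschitz function of the horizontal component `y - ⟪e, y⟫ e`. -/
def HasLipschitzBoundary {d : ℕ} (Ω : Set (Pt d)) : Prop :=
  ∀ x ∈ frontier Ω, ∃ (e : Pt d) (φ : Pt d → ℝ) (K : ℝ≥0) (r : ℝ),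
    ‖e‖ = 1 ∧ LipschitzWith K φ ∧ 0 < r ∧
      ∀ y ∈ Metric.ball x r, y ∈ Ω ↔ ⟪e, y⟫_ℝ < φ (y - ⟪e, y⟫_ℝ • e)

/-- Bounded Lipschitz domains of `ℝ^d`. -/
structure IsBoundedLipschitzDomain {d : ℕ} (Ω : Set (Pt d)) : Prop where
  isOpen : IsOpen Ω
  isConnected : IsConnected Ω
  isBounded : Bornology.IsBounded Ω
  boundary : HasLipschitzBoundary Ω

/-- `n` is the outward unit normal of `Ω` at the boundary point `x`: up to an error `o(|y - x|)`,
`Ω` is, near `x`, the half-space `⟪y - x, n⟫ < 0`. There is at most one such `n`, and for a set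
with Lipschitz boundary it exists where the graph function is differentiable, that is, at almost
every boundary point. -/
def IsOutwardNormal {d : ℕ} (Ω : Set (Pt d)) (x n : Pt d) : Prop :=
  ‖n‖ = 1 ∧ ∀ δ : ℝ, 0 < δ → ∀ᶠ y in 𝓝 x,
    (y ∈ Ω → ⟪y - x, n⟫_ℝ ≤ δ * ‖y - x‖) ∧ (y ∉ Ω → -(δ * ‖y - x‖) ≤ ⟪y - x, n⟫_ℝ)

open Classical in
/-- The outward unit normal field `ν` (zero where no normal exists). -/
noncomputable def outwardNormal {d : ℕ} (Ω : Set (Pt d)) (x : Pt d) : Pt d :=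
  if h : ∃ n, IsOutwardNormal Ω x n then h.choose else 0

/-- The surface measure `ds` of `ℝ^d`: the normalized `(d-1)`-dimensional Hausdorff measure. -/
noncomputable def surface (d : ℕ) : Measure (Pt d) := μHE[d - 1]

/-- The partial derivative `∂f/∂x_j`. -/
noncomputable def pd {d : ℕ} (j : Fin d) (f : Pt d → ℝ) (x : Pt d) : ℝ :=
  fderiv ℝ f x (EuclideanSpace.single j 1)

/-- The divergence of a vector field. -/
noncomputable def vdiv {d : ℕ} (w : Pt d → Pt d) (x : Pt d) : ℝ :=
  ∑ j, pd j (fun y => w y j) x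

/-- The divergence of a tensor field, `(div S)_i = ∂_j S_ij`. -/
noncomputable def tdiv {d : ℕ} (S : Pt d → Tensor d) (x : Pt d) : Pt d :=
  WithLp.toLp 2 fun i => ∑ j, pd j (fun y => S y i j) x

/-- The inner product `ξ : η` of tensors. -/
def ddot {d : ℕ} (ξ η : Tensor d) : ℝ := ∑ i, ∑ j, ξ i j * η i j

/-- A tensor applied to a vector, `(S n)_i = S_ij n_j`. -/
noncomputable def tapply {d : ℕ} (S : Tensor d) (n : Pt d) : Pt d :=
  WithLp.toLp 2 fun i => ∑ j, S i j * n j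

/-- The strain tensor `e[v]`. -/
noncomputable def strain {d : ℕ} (v : Pt d → Pt d) (x : Pt d) : Tensor d :=
  Matrix.of fun i j => (1 / 2 : ℝ) * (pd j (fun y => v y i) x + pd i (fun y => v y j) x)

/-- The time derivative of a time-dependent field. -/
noncomputable def dt {d : ℕ} {V : Type*} [NormedAddCommGroup V] [NormedSpace ℝ V]
    (w : ℝ → Pt d → V) : ℝ → Pt d → V :=
  fun t x => deriv (fun s => w s x) t

/-- The data of the model: domain, boundary parts, final time, elasticity tensor, material
parameters, external forces and initial values. -/
structure Data (d : ℕ) where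
  Ω : Set (Pt d)
  ΓD : Set (Pt d)
  ΓN : Set (Pt d)
  T : ℝ
  C : Pt d → Fin d → Fin d → Fin d → Fin d → ℝ
  ρ : ℝ
  α : ℝ
  ε : ℝ
  γ : Pt d → ℝ
  f : ℝ → Pt d → Pt d
  q : ℝ → Pt d → Pt d
  g : ℝ → Pt d → Pt d
  u₀ : Pt d → Pt d
  v₀ : Pt d → Pt d
  z₀ : Pt d → ℝ

namespace Data

variable {d : ℕ} (P : Data d)

/-- The standing assumptions on the domain, the material and the loads. The volume force is
measurable, square integrable in space and Lipschitz in time. -/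
structure Admissible : Prop where
  domain : IsBoundedLipschitzDomain P.Ω
  measurable_ΓD : MeasurableSet P.ΓD
  measurable_ΓN : MeasurableSet P.ΓN
  disjoint : Disjoint P.ΓD P.ΓN
  union : P.ΓD ∪ P.ΓN = frontier P.Ω
  elasticity_bounded : ∀ i j k l, MemLp (fun x => P.C x i j k l) ∞ (volume.restrict P.Ω)
  elasticity_symm : ∀ x ∈ P.Ω, ∀ i j k l,
    P.C x i j k l = P.C x k l i j ∧ P.C x i j k l = P.C x j i k l
  elasticity_coercive : ∃ c : ℝ, 0 < c ∧ ∀ x ∈ P.Ω, ∀ ξ : Tensor d, ξ.IsSymm →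
    c * ddot ξ ξ ≤ ∑ i, ∑ j, ∑ k, ∑ l, P.C x i j k l * ξ i j * ξ k l
  density_pos : 0 < P.ρ
  viscosity_pos : 0 < P.α
  length_pos : 0 < P.ε
  toughness_bounded : MemLp P.γ ∞ (volume.restrict P.Ω)
  toughness_pos : 0 < essInf P.γ (volume.restrict P.Ω)
  force_measurable : Measurable (fun p : ℝ × Pt d => P.f p.1 p.2)
  force_memLp : ∀ t ∈ Icc 0 P.T, MemLp (P.f t) 2 (volume.restrict P.Ω)
  force_lipschitz : ∃ k : Pt d → ℝ, MemLp k 2 (volume.restrict P.Ω) ∧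
    ∀ᵐ x ∂volume.restrict P.Ω, ∀ s ∈ Icc 0 P.T, ∀ t ∈ Icc 0 P.T,
      ‖P.f s x - P.f t x‖ ≤ k x * |s - t|

/-- The stress tensor `σ[v] = C e[v]`. -/
noncomputable def stress (v : Pt d → Pt d) (x : Pt d) : Tensor d :=
  Matrix.of fun i j => ∑ k, ∑ l, P.C x i j k l * strain v x k l

/-- The damaged stress tensor `σ[v, ζ] = (1 - ζ)² σ[v]`. -/
noncomputable def damagedStress (v : Pt d → Pt d) (ζ : Pt d → ℝ) (x : Pt d) : Tensor d :=
  (1 - ζ x) ^ 2 • P.stress v x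

/-- The elastic energy density `W(v) = σ[v] : e[v]`. -/
noncomputable def W (v : Pt d → Pt d) (x : Pt d) : ℝ := ddot (P.stress v x) (strain v x)

/-- The flux `γ ∇ζ`. -/
noncomputable def flux (ζ : Pt d → ℝ) (x : Pt d) : Pt d := P.γ x • gradient ζ x

/-- The elastic energy including the external forces. -/
noncomputable def elasticEnergy (t : ℝ) (v : Pt d → Pt d) (ζ : Pt d → ℝ) : ℝ :=
  (1 / 2 : ℝ) * (∫ x in P.Ω, ddot (P.damagedStress v ζ x) (strain v x))
    - (∫ x in P.Ω, ⟪P.f t x, v x⟫_ℝ)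
    - ∫ x in P.ΓN, ⟪P.q t x, v x⟫_ℝ ∂surface d

/-- The kinetic energy of a velocity field. -/
noncomputable def kineticEnergy (w : Pt d → Pt d) : ℝ :=
  P.ρ / 2 * ∫ x in P.Ω, ‖w x‖ ^ 2

/-- The regularized surface energy of the crack. -/
noncomputable def surfaceEnergy (ζ : Pt d → ℝ) : ℝ :=
  (1 / 2 : ℝ) * ∫ x in P.Ω, P.γ x * (P.ε * ‖gradient ζ x‖ ^ 2 + ζ x ^ 2 / P.ε)

/-- The total energy `E(t, v, w, ζ)`. -/
noncomputable def energy (t : ℝ) (v w : Pt d → Pt d) (ζ : Pt d → ℝ) : ℝ :=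
  P.elasticEnergy t v ζ + P.kineticEnergy w + P.surfaceEnergy ζ

/-- The energy injection rate of the external forces. -/
noncomputable def injectionRate (t : ℝ) (v : Pt d → Pt d) (ζ : Pt d → ℝ) : ℝ :=
  (∫ x in P.ΓD, ⟪dt P.g t x, tapply (P.damagedStress v ζ x) (outwardNormal P.Ω x)⟫_ℝ ∂surface d)
    - (∫ x in P.Ω, ⟪dt P.f t x, v x⟫_ℝ)
    - ∫ x in P.ΓN, ⟪dt P.q t x, v x⟫_ℝ ∂surface d

/-- Sufficient smoothness of a pair `(u, z)`: both fields are, on `closure Ω × [0, T]`, of class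
`C^{1,1}` in space-time up to the boundary (given as restrictions of such functions on
`ℝ × ℝ^d`), and for each time the damaged stress (up to the boundary) and the flux `γ ∇z` are
Lipschitz in space. Second derivatives and the divergences thus exist almost everywhere. -/
structure Smooth (u : ℝ → Pt d → Pt d) (z : ℝ → Pt d → ℝ) : Prop where
  contDiff_u : ContDiff ℝ 1 (fun p : ℝ × Pt d => u p.1 p.2)
  lipschitz_u : LocallyLipschitz (fderiv ℝ (fun p : ℝ × Pt d => u p.1 p.2))
  contDiff_z : ContDiff ℝ 1 (fun p : ℝ × Pt d => z p.1 p.2)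
  lipschitz_z : LocallyLipschitz (fderiv ℝ (fun p : ℝ × Pt d => z p.1 p.2))
  stress : ∀ t ∈ Icc 0 P.T, ∀ i j, ∃ K : ℝ≥0,
    LipschitzOnWith K (fun x => P.damagedStress (u t) (z t) x i j) (closure P.Ω)
  flux : ∀ t ∈ Icc 0 P.T, ∃ K : ℝ≥0, LipschitzOnWith K (P.flux (z t)) P.Ω

/-- `(u, z)` solves the dynamic fracture phase field model: the two evolution equations hold
almost everywhere in `Ω × (0, T)`, the conditions that involve the normal hold at all boundary
points where the normal exists, the others hold everywhere. -/
structure IsSolution (u : ℝ → Pt d → Pt d) (z : ℝ → Pt d → ℝ) : Prop where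
  momentum : ∀ᵐ t ∂volume.restrict (Ioo 0 P.T), ∀ᵐ x ∂volume.restrict P.Ω,
    P.ρ • dt (dt u) t x = tdiv (P.damagedStress (u t) (z t)) x + P.f t x
  damage : ∀ᵐ t ∂volume.restrict (Ioo 0 P.T), ∀ᵐ x ∂volume.restrict P.Ω,
    P.α * dt z t x =
      max (P.ε * vdiv (P.flux (z t)) x - P.γ x / P.ε * z t x + (1 - z t x) * P.W (u t) x) 0
  neumann : ∀ t ∈ Icc 0 P.T, ∀ x ∈ P.ΓN, ∀ n, IsOutwardNormal P.Ω x n →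
    tapply (P.damagedStress (u t) (z t) x) n = P.q t x
  dirichlet : ∀ t ∈ Icc 0 P.T, ∀ x ∈ P.ΓD, u t x = P.g t x
  normalDerivative : ∀ t ∈ Icc 0 P.T, ∀ x ∈ frontier P.Ω, ∀ n, IsOutwardNormal P.Ω x n →
    ⟪gradient (z t) x, n⟫_ℝ = 0
  initial_u : ∀ x ∈ P.Ω, u 0 x = P.u₀ x
  initial_v : ∀ x ∈ P.Ω, dt u 0 x = P.v₀ x
  initial_z : ∀ x ∈ P.Ω, z 0 x = P.z₀ x

end Data

end DynamicFracture

/-!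
The energy balance is obtained by testing the two evolution equations with the rates `u̇` and `ż`.
Formally, differentiation under the integral sign gives, with `σ = σ[u, z]`,

  `dE/dt = ∫ σ : e[u̇] - ∫ (1 - z) ż W(u) - d/dt ∫ f ⬝ u - d/dt ∫_{Γ_N} q ⬝ u + ρ ∫ ü ⬝ u̇`
  `        + ∫ (ε γ ∇z ⬝ ∇ż + γ z ż / ε)`.

The momentum equation and the Gauss–Green formula turn `ρ ∫ ü ⬝ u̇ + ∫ σ : e[u̇] - ∫ f ⬝ u̇` into the
power of the traction `σ ν` on `∂Ω`, which is `∫_{Γ_D} ġ ⬝ σ ν + ∫_{Γ_N} q ⬝ u̇`. In the remaining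
terms `∫ γ ∇z ⬝ ∇ż = -∫ ż div (γ ∇z)` because `∂z/∂ν = 0`, so that they are `-∫ ż r`, where `r` is
the expression inside the positive part of the damage law. Since `α ż = max r 0`, one has
`ż r = α ż²`.

Three points carry the weight of the argument.

* Gauss–Green on a bounded Lipschitz domain for functions that are Lipschitz up to the boundary
  (`IsBoundedLipschitzDomain.setIntegral_pd`), with the normalized Hausdorff measure on `∂Ω`. In a
  chart, where `Ω` is the subgraph of `ψ`, both `∫_Ω ∂_v g` and the boundary integral are the
  derivative at `t = 0` of the integral of `g` over the subgraph translated by `t v`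
  (`setIntegral_subgraph_lineDeriv`); the boundary integral is recognized by the area formula for
  Lipschitz graphs (`comap_graphMap`), and the charts are joined by a smooth partition of unity.
* Regularity in time. The derivatives of `C^{1,1}` fields are differentiable almost everywhere in
  space-time by Rademacher's theorem, and there `∂_t` and `∂_j` commute (`IsC11.ae_hasDerivAt`). The
  force `f` and the traction `σ ν` are only Lipschitz in time at fixed points. Joint measurability
  of the set of points of differentiability, which Fubini's theorem needs, is obtained from rational
  difference quotients (`ae_ae_differentiableAt_of_lipschitzOnWith`).
* Passage to the boundary. The tensor `C` and the coefficient `γ` are only controlled almost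
  everywhere in `Ω`. Estimates for `σ` and `γ ∇z` are therefore proved in `Ω` and extended to the
  closure by continuity (`le_of_ae_le_of_mem_closure`): this yields the Lipschitz bound in time for
  the traction (`Data.Smooth.exists_abs_damagedStress_sub_le`) and the vanishing of the normal flux
  (`Data.Smooth.setIntegral_vdiv_flux`).

The spatial dimension is written `n + 1` throughout, `n` being the dimension of the boundary.
-/

namespace DynamicFracture

/-! ### Area formula for Lipschitz graphs -/

section AreaFormula

/-- If `f` moves points of `s` at most `K` times as far as `g` does, then `f '' s` has at most
`K ^ m` times the Hausdorff measure of `g '' s`. Neither map has to be injective. -/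
theorem euclideanHausdorffMeasure_image_le_of_dist_le {X Y Z : Type*} [MetricSpace Y]
    [MeasurableSpace Y] [BorelSpace Y] [MetricSpace Z] [MeasurableSpace Z] [BorelSpace Z]
    [Nonempty X] {f : X → Y} {g : X → Z} {s : Set X} {K : ℝ≥0} (m : ℕ)
    (h : ∀ x ∈ s, ∀ y ∈ s, dist (f x) (f y) ≤ K * dist (g x) (g y)) :
    μHE[m] (f '' s) ≤ (K : ℝ≥0∞) ^ m * μHE[m] (g '' s) := by
  classical
  set k : Z → Y := fun p => f (Function.invFunOn g s p) with hk
  have hinv : ∀ x ∈ s, Function.invFunOn g s (g x) ∈ s ∧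
      g (Function.invFunOn g s (g x)) = g x := fun x hx =>
    ⟨Function.invFunOn_mem ⟨x, hx, rfl⟩, Function.invFunOn_eq ⟨x, hx, rfl⟩⟩
  have hfk : f '' s = k '' (g '' s) := by
    rw [image_image]
    refine image_congr fun x hx => ?_
    have := h x hx _ (hinv x hx).1
    rw [(hinv x hx).2, dist_self, mul_zero] at this
    exact dist_le_zero.1 this
  have hlip : LipschitzOnWith K k (g '' s) := by
    refine LipschitzOnWith.of_dist_le_mul ?_
    rintro _ ⟨x, hx, rfl⟩ _ ⟨y, hy, rfl⟩
    have := h _ (hinv x hx).1 _ (hinv y hy).1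
    rwa [(hinv x hx).2, (hinv y hy).2] at this
  have := hlip.hausdorffMeasure_image_le (d := (m : ℝ)) (Nat.cast_nonneg m)
  rw [hfk, Measure.euclideanHausdorffMeasure_def, Measure.euclideanHausdorffMeasure_def]
  simp only [Measure.smul_apply, ENNReal.smul_def, smul_eq_mul]
  rw [ENNReal.rpow_natCast] at this
  calc _ ≤ _ * ((K : ℝ≥0∞) ^ m * μH[(m : ℝ)] (g '' s)) := by gcongr
    _ = _ := by ring

/-- A linear map that stretches volumes by the area factor of the graph of `A` and lengths as
`w ↦ (w, A w)` does. -/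
theorem exists_linearMap_det_eq_sqrt {E : Type*} [NormedAddCommGroup E] [InnerProductSpace ℝ E]
    [FiniteDimensional ℝ E] (A : E →L[ℝ] ℝ) :
    ∃ M : E →ₗ[ℝ] E, LinearMap.det M = √(1 + ‖A‖ ^ 2) ∧
      ∀ w, ‖M w‖ ^ 2 = ‖w‖ ^ 2 + A w ^ 2 := by
  obtain ⟨a, rfl⟩ := (InnerProductSpace.toDual ℝ E).surjective A
  simp only [LinearIsometryEquiv.norm_map, InnerProductSpace.toDual_apply_apply]
  have hs : √(1 + ‖a‖ ^ 2) ^ 2 = 1 + ‖a‖ ^ 2 := Real.sq_sqrt (by positivity)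
  -- `M = 1 + c a ⊗ a`, where `c` is chosen so that `M` is the square root of `1 + a ⊗ a`.
  set c : ℝ := (√(1 + ‖a‖ ^ 2) - 1) / ‖a‖ ^ 2 with hc
  have hca : c * ‖a‖ ^ 2 = √(1 + ‖a‖ ^ 2) - 1 := by
    rcases eq_or_ne a 0 with rfl | ha
    · simp
    · have : ‖a‖ ≠ 0 := norm_ne_zero_iff.2 ha
      rw [hc]; field_simp
  refine ⟨LinearMap.transvection (InnerProductSpace.toDual ℝ E a : E →ₗ[ℝ] ℝ) (c • a), ?_, ?_⟩
  · rw [LinearMap.transvection.det]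
    simp [hca]
  · intro w
    rcases eq_or_ne a 0 with rfl | ha
    · simp [LinearMap.transvection]
    have hna : ‖a‖ ^ 2 ≠ 0 := by positivity
    have h1 : 2 * c + c ^ 2 * ‖a‖ ^ 2 = 1 := by
      refine mul_right_cancel₀ hna ?_
      linear_combination (c * ‖a‖ ^ 2 + √(1 + ‖a‖ ^ 2) + 1) * hca + hs
    simp only [LinearMap.transvection.apply, ContinuousLinearMap.coe_coe,
      InnerProductSpace.toDual_apply_apply]
    rw [norm_add_sq_real, inner_smul_right, inner_smul_right, norm_smul, norm_smul,
      Real.norm_eq_abs, Real.norm_eq_abs, mul_pow, mul_pow, sq_abs, sq_abs,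
      real_inner_comm]
    linear_combination ⟪w, a⟫_ℝ ^ 2 * h1

theorem sqrt_one_add_sq_le_add {a b r : ℝ} (ha : 0 ≤ a) (hb : 0 ≤ b) (h : |a - b| ≤ r) :
    √(1 + a ^ 2) ≤ (1 + r) * √(1 + b ^ 2) := by
  have hr : 0 ≤ r := (abs_nonneg _).trans h
  have h1 : a ≤ b + r := by linarith [(abs_le.1 h).2]
  have hs : √(1 + b ^ 2) ^ 2 = 1 + b ^ 2 := Real.sq_sqrt (by positivity)
  have h2 : 1 ≤ √(1 + b ^ 2) := Real.one_le_sqrt.2 (by nlinarith)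
  have h3 : b ≤ √(1 + b ^ 2) := Real.le_sqrt_of_sq_le (by linarith)
  refine Real.sqrt_le_iff.2 ⟨by positivity, ?_⟩
  rw [mul_pow, hs]
  nlinarith [mul_nonneg hr hb, sq_nonneg (b - 1), mul_nonneg hr (sq_nonneg (b-1))]

variable {n : ℕ} {J : Pt n →ₗᵢ[ℝ] Pt (n + 1)} {e : Pt (n + 1)}

/-- The parametrization `w ↦ J w + ψ w e` of the graph of `ψ` over the hyperplane `range J`, in
the direction `e`. -/
noncomputable def graphMap (J : Pt n →ₗᵢ[ℝ] Pt (n + 1)) (e : Pt (n + 1)) (ψ : Pt n → ℝ) (w : Pt n) :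
    Pt (n + 1) :=
  J w + ψ w • e

theorem norm_add_smul_sq (he : ‖e‖ = 1) (hJ : ∀ w, ⟪e, J w⟫_ℝ = 0) (w : Pt n) (s : ℝ) :
    ‖J w + s • e‖ ^ 2 = ‖w‖ ^ 2 + s ^ 2 := by
  rw [norm_add_sq_real, inner_smul_right, real_inner_comm, hJ, norm_smul, he, J.norm_map]
  simp

theorem norm_le_norm_add_smul (he : ‖e‖ = 1) (hJ : ∀ w, ⟪e, J w⟫_ℝ = 0) (w : Pt n) (s : ℝ) :
    ‖w‖ ≤ ‖J w + s • e‖ := by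
  refine le_of_sq_le_sq ?_ (norm_nonneg _)
  rw [norm_add_smul_sq he hJ]
  nlinarith

theorem graphMap_sub (ψ : Pt n → ℝ) (x y : Pt n) :
    graphMap J e ψ x - graphMap J e ψ y = J (x - y) + (ψ x - ψ y) • e := by
  simp only [graphMap, map_sub, sub_smul]; abel

theorem antilipschitzWith_graphMap (he : ‖e‖ = 1) (hJ : ∀ w, ⟪e, J w⟫_ℝ = 0) (ψ : Pt n → ℝ) :
    AntilipschitzWith 1 (graphMap J e ψ) := by
  refine AntilipschitzWith.of_le_mul_dist fun x y => ?_
  rw [dist_eq_norm, dist_eq_norm, graphMap_sub, NNReal.coe_one, one_mul]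
  exact norm_le_norm_add_smul he hJ _ _

theorem lipschitzWith_graphMap (he : ‖e‖ = 1) {ψ : Pt n → ℝ} {K : ℝ≥0} (hψ : LipschitzWith K ψ) :
    LipschitzWith (1 + K) (graphMap J e ψ) := by
  refine LipschitzWith.add ?_ ?_
  · exact J.lipschitz
  · refine LipschitzWith.of_dist_le_mul fun x y => ?_
    rw [dist_eq_norm, ← sub_smul, norm_smul, he, mul_one, ← dist_eq_norm]
    exact hψ.dist_le_mul x y

theorem isClosedEmbedding_graphMap (he : ‖e‖ = 1) (hJ : ∀ w, ⟪e, J w⟫_ℝ = 0) {ψ : Pt n → ℝ}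
    {K : ℝ≥0} (hψ : LipschitzWith K ψ) : IsClosedEmbedding (graphMap J e ψ) :=
  (antilipschitzWith_graphMap he hJ ψ).isClosedEmbedding (lipschitzWith_graphMap he hψ).uniformContinuous

theorem measurableEmbedding_graphMap (he : ‖e‖ = 1) (hJ : ∀ w, ⟪e, J w⟫_ℝ = 0) {ψ : Pt n → ℝ}
    {K : ℝ≥0} (hψ : LipschitzWith K ψ) : MeasurableEmbedding (graphMap J e ψ) :=
  (isClosedEmbedding_graphMap he hJ hψ).measurableEmbedding

/-- On a set where `ψ` is `r`-close to the linear map `A`, the area of its graph is that of the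
graph of `A` up to the factors `(1 + r) ^ n` and `(1 - r) ^ n`. -/
theorem graph_area_bounds_of_approximatesLinearOn (he : ‖e‖ = 1) (hJ : ∀ w, ⟪e, J w⟫_ℝ = 0)
    {ψ : Pt n → ℝ} {A : Pt n →L[ℝ] ℝ} {r : ℝ≥0} (hr : r < 1) {s : Set (Pt n)}
    (h : ApproximatesLinearOn ψ A s r) :
    μHE[n] (graphMap J e ψ '' s) ≤ (1 + r : ℝ≥0) ^ n * ENNReal.ofReal √(1 + ‖A‖ ^ 2) * volume s ∧
    (1 - r : ℝ≥0) ^ n * ENNReal.ofReal √(1 + ‖A‖ ^ 2) * volume s ≤ μHE[n] (graphMap J e ψ '' s) := by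
  obtain ⟨M, hdet, hM⟩ := exists_linearMap_det_eq_sqrt A
  have hvol : μHE[n] (M '' s) = ENNReal.ofReal √(1 + ‖A‖ ^ 2) * volume s := by
    rw [EuclideanSpace.euclideanHausdorffMeasure_eq_volume, Measure.addHaar_image_linearMap, hdet,
      abs_of_nonneg (Real.sqrt_nonneg _)]
  have hL : ∀ w, ‖J w + A w • e‖ = ‖M w‖ := fun w => by
    have := (norm_add_smul_sq he hJ w (A w)).trans (hM w).symm
    exact (sq_eq_sq₀ (norm_nonneg _) (norm_nonneg _)).1 this
  have hdiff : ∀ x ∈ s, ∀ y ∈ s,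
      ‖(graphMap J e ψ x - graphMap J e ψ y) - (J (x - y) + A (x - y) • e)‖ ≤ r * ‖M (x - y)‖ := by
    intro x hx y hy
    have h1 : (graphMap J e ψ x - graphMap J e ψ y) - (J (x - y) + A (x - y) • e)
        = (ψ x - ψ y - A (x - y)) • e := by rw [graphMap_sub]; module
    rw [h1, norm_smul, he, mul_one]
    refine (h x hx y hy).trans ?_
    gcongr
    rw [← hL]
    exact norm_le_norm_add_smul he hJ _ _
  have hd : ∀ x y, dist (M x) (M y) = ‖M (x - y)‖ := fun x y => by rw [dist_eq_norm, map_sub]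
  constructor
  · rw [mul_assoc, ← hvol, ← ENNReal.coe_pow, ENNReal.coe_pow]
    refine euclideanHausdorffMeasure_image_le_of_dist_le n fun x hx y hy => ?_
    rw [hd, dist_eq_norm, NNReal.coe_add, NNReal.coe_one]
    have h1 := norm_sub_norm_le (graphMap J e ψ x - graphMap J e ψ y) (J (x - y) + A (x - y) • e)
    rw [hL] at h1
    linarith [hdiff x hx y hy]
  · have hr' : (1 - r : ℝ≥0) ≠ 0 := (tsub_pos_of_lt hr).ne'
    have key : μHE[n] (M '' s) ≤
        (((1 - r)⁻¹ : ℝ≥0) : ℝ≥0∞) ^ n * μHE[n] (graphMap J e ψ '' s) := by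
      refine euclideanHausdorffMeasure_image_le_of_dist_le n fun x hx y hy => ?_
      rw [hd, dist_eq_norm, NNReal.coe_inv, ← div_eq_inv_mul,
        le_div_iff₀ (by exact_mod_cast tsub_pos_of_lt hr), NNReal.coe_sub hr.le, NNReal.coe_one]
      have h1 := norm_sub_norm_le (J (x - y) + A (x - y) • e)
        (graphMap J e ψ x - graphMap J e ψ y)
      have h2 := hdiff x hx y hy
      rw [hL] at h1
      rw [norm_sub_rev] at h2
      linarith
    rw [mul_assoc, ← hvol]
    calc _ ≤ ((1 - r : ℝ≥0) : ℝ≥0∞) ^ n *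
          ((((1 - r)⁻¹ : ℝ≥0) : ℝ≥0∞) ^ n * μHE[n] (graphMap J e ψ '' s)) := by gcongr
      _ = _ := by
        rw [← mul_assoc, ← mul_pow, ← ENNReal.coe_mul, mul_inv_cancel₀ hr', ENNReal.coe_one,
          one_pow, one_mul]

theorem measure_le_of_forall_subset_cover {X : Type*} [MeasurableSpace X] {μ ν : Measure X}
    {ι : Type*} [Countable ι] (T : ι → Set X) (hT : ∀ k, MeasurableSet (T k)) {A : Set X}
    (hA : MeasurableSet A) (hcover : A ⊆ ⋃ k, T k)
    (h : ∀ k, ∀ B ⊆ T k, MeasurableSet B → μ B ≤ ν B) : μ A ≤ ν A := by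
  cases nonempty_encodable ι
  set S : ℕ → Set X := fun k => ⋃ b ∈ Encodable.decode₂ ι k, T b with hS
  have hSm : ∀ k, MeasurableSet (S k) := fun k => by
    exact Encodable.iUnion_decode₂_cases (C := MeasurableSet) MeasurableSet.empty hT
  have hSU : ⋃ k, S k = ⋃ b, T b := Encodable.iUnion_decode₂ T
  have hdm : ∀ k, MeasurableSet (A ∩ disjointed S k) := fun k =>
    hA.inter (MeasurableSet.disjointed hSm k)
  have hdd : Pairwise (Function.onFun Disjoint fun k => A ∩ disjointed S k) := fun i j hij =>
    ((disjoint_disjointed S) hij).mono inter_subset_right inter_subset_right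
  have hAU : A = ⋃ k, A ∩ disjointed S k := by
    rw [← inter_iUnion, iUnion_disjointed, hSU, inter_eq_left.2 hcover]
  have hb : ∀ k, ∀ B ⊆ S k, MeasurableSet B → μ B ≤ ν B := fun k =>
    Encodable.iUnion_decode₂_cases (f := T) (n := k)
      (C := fun U => ∀ B ⊆ U, MeasurableSet B → μ B ≤ ν B)
      (fun B hB _ => by simp [subset_empty_iff.1 hB]) h
  rw [hAU, measure_iUnion hdd hdm, measure_iUnion hdd hdm]
  exact ENNReal.tsum_le_tsum fun k => hb k _ (inter_subset_right.trans (disjointed_subset S k)) (hdm k)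

/-- The area measure `√(1 + |∇ψ|²) dw` of the graph of `ψ`, pulled back to the parameter space. -/
noncomputable def graphArea (ψ : Pt n → ℝ) : Measure (Pt n) :=
  volume.withDensity fun w => ENNReal.ofReal √(1 + ‖fderiv ℝ ψ w‖ ^ 2)

theorem measurable_graphArea_density (ψ : Pt n → ℝ) :
    Measurable fun w => ENNReal.ofReal √(1 + ‖fderiv ℝ ψ w‖ ^ 2) := by
  have := measurable_fderiv ℝ ψ
  fun_prop

/-- The area of a piece of a graph is compared with `graphArea` up to factors close to `1`, after
a decomposition into countably many pieces on which `ψ` is nearly linear. -/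
theorem graphArea_bounds (he : ‖e‖ = 1) (hJ : ∀ w, ⟪e, J w⟫_ℝ = 0) {ψ : Pt n → ℝ} {K : ℝ≥0}
    (hψ : LipschitzWith K ψ) {r : ℝ≥0} (hr0 : 0 < r) (hr : r < 1) {B : Set (Pt n)}
    (hB : MeasurableSet B) (hBd : ∀ x ∈ B, DifferentiableAt ℝ ψ x) :
    Measure.comap (graphMap J e ψ) μHE[n] B ≤
      ((1 + r) ^ n * (1 + 2 * r) : ℝ≥0) • graphArea ψ B ∧
    ((1 - r) ^ n : ℝ≥0) • graphArea ψ B ≤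
      (1 + 2 * r : ℝ≥0) • Measure.comap (graphMap J e ψ) μHE[n] B := by
  have hemb := measurableEmbedding_graphMap he hJ hψ
  obtain ⟨D, hD⟩ := TopologicalSpace.exists_dense_seq (Pt n →L[ℝ] ℝ)
  set S : ℕ → Set (Pt n) := fun k => {x | DifferentiableAt ℝ ψ x ∧ ‖fderiv ℝ ψ x - D k‖ < r}
  have hSm : ∀ k, MeasurableSet (S k) := fun k => by
    refine (measurableSet_of_differentiableAt ℝ ψ).inter ?_
    have := measurable_fderiv ℝ ψ
    exact measurableSet_lt (this.sub_const (D k)).norm measurable_const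
  have hpart := fun k => exists_closed_cover_approximatesLinearOn_of_hasFDerivWithinAt ψ (S k)
    (fderiv ℝ ψ) (fun x hx => hx.1.hasFDerivAt.hasFDerivWithinAt) (fun _ => r) (fun _ => hr0.ne')
  choose t A htc htS htA hAy using hpart
  have hcover : B ⊆ ⋃ p : ℕ × ℕ, S p.1 ∩ t p.1 p.2 := fun x hx => by
    obtain ⟨_, ⟨k, rfl⟩, hk⟩ := Metric.dense_iff.1 hD (fderiv ℝ ψ x) r hr0 |>.imp
      fun y hy => And.intro hy.2 hy.1
    have hxS : x ∈ S k := ⟨hBd x hx, by rw [← dist_eq_norm, dist_comm]; exact hk⟩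
    obtain ⟨j, hj⟩ := mem_iUnion.1 (htS k hxS)
    exact mem_iUnion.2 ⟨(k, j), hxS, hj⟩
  have hTm : ∀ p : ℕ × ℕ, MeasurableSet (S p.1 ∩ t p.1 p.2) := fun p =>
    (hSm p.1).inter (htc p.1 p.2).measurableSet
  -- on each piece the density is within a factor `1 + 2 r` of the constant `√(1 + ‖A‖²)`
  have hclose : ∀ p : ℕ × ℕ, ∀ x ∈ S p.1 ∩ t p.1 p.2,
      |‖A p.1 p.2‖ - ‖fderiv ℝ ψ x‖| ≤ 2 * r := by
    rintro ⟨k, j⟩ x hx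
    obtain ⟨y, hy, hAy⟩ := hAy k ⟨x, hx.1⟩ j
    refine (abs_norm_sub_norm_le _ _).trans ?_
    rw [hAy]
    have h1 : fderiv ℝ ψ y - fderiv ℝ ψ x = (fderiv ℝ ψ y - D k) - (fderiv ℝ ψ x - D k) := by abel
    rw [h1]
    refine (norm_sub_le _ _).trans ?_
    linarith [hy.2, hx.1.2]
  have harea : ∀ p : ℕ × ℕ, ∀ C ⊆ S p.1 ∩ t p.1 p.2, MeasurableSet C →
      ENNReal.ofReal √(1 + ‖A p.1 p.2‖ ^ 2) * volume C ≤ (1 + 2 * r : ℝ≥0) * graphArea ψ C ∧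
      graphArea ψ C ≤ (1 + 2 * r : ℝ≥0) * (ENNReal.ofReal √(1 + ‖A p.1 p.2‖ ^ 2) * volume C) := by
    intro p C hC hCm
    rw [graphArea, withDensity_apply _ hCm]
    have hcoe : ((1 + 2 * r : ℝ≥0) : ℝ≥0∞) = ENNReal.ofReal (1 + 2 * r) := by
      rw [← ENNReal.ofReal_coe_nnreal]; push_cast; rfl
    constructor
    · rw [← setLIntegral_const, ← lintegral_const_mul _ (measurable_graphArea_density ψ)]
      refine setLIntegral_mono ((measurable_graphArea_density ψ).const_mul _) fun x hx => ?_
      rw [hcoe, ← ENNReal.ofReal_mul (by positivity)]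
      exact ENNReal.ofReal_le_ofReal (sqrt_one_add_sq_le_add (norm_nonneg _) (norm_nonneg _)
        (hclose p x (hC hx)))
    · rw [← mul_assoc, ← setLIntegral_const]
      refine setLIntegral_mono measurable_const fun x hx => ?_
      rw [hcoe, ← ENNReal.ofReal_mul (by positivity)]
      refine ENNReal.ofReal_le_ofReal (sqrt_one_add_sq_le_add (norm_nonneg _) (norm_nonneg _) ?_)
      rw [abs_sub_comm]
      exact hclose p x (hC hx)
  have happrox : ∀ p : ℕ × ℕ, ∀ C ⊆ S p.1 ∩ t p.1 p.2, ApproximatesLinearOn ψ (A p.1 p.2) C r :=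
    fun p C hC => (htA p.1 p.2).mono_set hC
  constructor
  · refine measure_le_of_forall_subset_cover (μ := Measure.comap (graphMap J e ψ) μHE[n])
      (ν := ((1 + r) ^ n * (1 + 2 * r) : ℝ≥0) • graphArea ψ) _ hTm hB hcover fun p C hC hCm => ?_
    rw [hemb.comap_apply]
    refine (graph_area_bounds_of_approximatesLinearOn he hJ hr (happrox p C hC)).1.trans ?_
    rw [Measure.smul_apply, ENNReal.smul_def, smul_eq_mul, ENNReal.coe_mul, mul_assoc, mul_assoc,
      ENNReal.coe_pow]
    exact mul_le_mul' le_rfl (harea p C hC hCm).1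
  · refine measure_le_of_forall_subset_cover (μ := ((1 - r) ^ n : ℝ≥0) • graphArea ψ)
      (ν := (1 + 2 * r : ℝ≥0) • Measure.comap (graphMap J e ψ) μHE[n]) _ hTm hB hcover
      fun p C hC hCm => ?_
    rw [Measure.smul_apply, ENNReal.smul_def, smul_eq_mul, Measure.smul_apply, ENNReal.smul_def,
      smul_eq_mul, hemb.comap_apply, ENNReal.coe_pow]
    calc _ ≤ ((1 - r : ℝ≥0) : ℝ≥0∞) ^ n * ((1 + 2 * r : ℝ≥0) *
          (ENNReal.ofReal √(1 + ‖A p.1 p.2‖ ^ 2) * volume C)) := by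
          gcongr; exact (harea p C hC hCm).2
      _ = (1 + 2 * r : ℝ≥0) * (((1 - r : ℝ≥0) : ℝ≥0∞) ^ n *
          ENNReal.ofReal √(1 + ‖A p.1 p.2‖ ^ 2) * volume C) := by ring
      _ ≤ _ := by
          gcongr
          exact (graph_area_bounds_of_approximatesLinearOn he hJ hr (happrox p C hC)).2

theorem graphMap_image_null (he : ‖e‖ = 1) {ψ : Pt n → ℝ} {K : ℝ≥0} (hψ : LipschitzWith K ψ)
    {s : Set (Pt n)} (hs : volume s = 0) : μHE[n] (graphMap J e ψ '' s) = 0 := by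
  have := euclideanHausdorffMeasure_image_le_of_dist_le (f := graphMap J e ψ) (g := id) (s := s) n
    fun x _ y _ => (lipschitzWith_graphMap he hψ).dist_le_mul x y
  rw [image_id, EuclideanSpace.euclideanHausdorffMeasure_eq_volume, hs, mul_zero] at this
  exact le_antisymm this zero_le

/-- The area formula for a Lipschitz graph. -/
theorem comap_graphMap (he : ‖e‖ = 1) (hJ : ∀ w, ⟪e, J w⟫_ℝ = 0) {ψ : Pt n → ℝ} {K : ℝ≥0}
    (hψ : LipschitzWith K ψ) : Measure.comap (graphMap J e ψ) μHE[n] = graphArea ψ := by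
  have hemb := measurableEmbedding_graphMap he hJ hψ
  ext B hB
  have hDm := measurableSet_of_differentiableAt ℝ ψ
  have hnull : volume {x | DifferentiableAt ℝ ψ x}ᶜ = 0 := hψ.ae_differentiableAt
  rw [← measure_inter_add_sdiff B hDm, ← measure_inter_add_sdiff (μ := graphArea ψ) B hDm]
  have h0 : Measure.comap (graphMap J e ψ) μHE[n] (B \ {x | DifferentiableAt ℝ ψ x}) = 0 := by
    rw [hemb.comap_apply]
    exact graphMap_image_null he hψ (measure_mono_null (fun x hx => hx.2) hnull)
  have h0' : graphArea ψ (B \ {x | DifferentiableAt ℝ ψ x}) = 0 :=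
    withDensity_absolutelyContinuous _ _ (measure_mono_null (fun x hx => hx.2) hnull)
  rw [h0, h0', add_zero, add_zero]
  have hb := fun {r : ℝ≥0} (hr0 : 0 < r) (hr : r < 1) => graphArea_bounds he hJ hψ hr0 hr
    (hB.inter hDm) fun x hx => hx.2
  set X := Measure.comap (graphMap J e ψ) μHE[n] (B ∩ {x | DifferentiableAt ℝ ψ x})
  set Y := graphArea ψ (B ∩ {x | DifferentiableAt ℝ ψ x})
  have hev : ∀ᶠ r : ℝ≥0 in 𝓝[>] 0, 0 < r ∧ r < 1 := Ioo_mem_nhdsGT one_pos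
  have hlim : ∀ (c : ℝ≥0 → ℝ≥0) (Z : ℝ≥0∞), Continuous c → c 0 = 1 →
      Tendsto (fun r => c r • Z) (𝓝[>] 0) (𝓝 Z) := by
    intro c Z hc hc0
    have h1 : Tendsto (fun r => (c r : ℝ≥0∞)) (𝓝[>] 0) (𝓝 1) := by
      rw [← ENNReal.coe_one, ENNReal.tendsto_coe, ← hc0]
      exact hc.continuousAt.tendsto.mono_left nhdsWithin_le_nhds
    have := ENNReal.Tendsto.mul_const (b := Z) h1 (Or.inl one_ne_zero)
    simpa [ENNReal.smul_def] using this
  apply le_antisymm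
  · refine ge_of_tendsto (hlim (fun r => (1 + r) ^ n * (1 + 2 * r)) Y (by fun_prop) (by simp)) ?_
    filter_upwards [hev] with r hr using (hb hr.1 hr.2).1
  · refine le_of_tendsto_of_tendsto (hlim (fun r => (1 - r) ^ n) Y (by fun_prop) (by simp))
      (hlim (fun r => 1 + 2 * r) X (by fun_prop) (by simp)) ?_
    filter_upwards [hev] with r hr using (hb hr.1 hr.2).2

theorem map_graphArea (he : ‖e‖ = 1) (hJ : ∀ w, ⟪e, J w⟫_ℝ = 0) {ψ : Pt n → ℝ} {K : ℝ≥0}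
    (hψ : LipschitzWith K ψ) :
    (graphArea ψ).map (graphMap J e ψ) = μHE[n].restrict (range (graphMap J e ψ)) := by
  rw [← comap_graphMap he hJ hψ, (measurableEmbedding_graphMap he hJ hψ).map_comap]

end AreaFormula

/-! ### Lipschitz graphs: coordinates, boundary points and normals -/

section Chart

variable {n : ℕ} {J : Pt n →ₗᵢ[ℝ] Pt (n + 1)} {e : Pt (n + 1)}

/-- Orthonormal coordinates `(s, w) ↦ J w + s e` adapted to a unit vector `e`. -/
theorem exists_orthogonal_coordinates (he : ‖e‖ = 1) :
    ∃ J : Pt n →ₗᵢ[ℝ] Pt (n + 1), (∀ w, ⟪e, J w⟫_ℝ = 0) ∧ (∀ y, ∃ w, J w + ⟪e, y⟫_ℝ • e = y) ∧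
      MeasurePreserving (fun p : ℝ × Pt n => J p.2 + p.1 • e) volume volume := by
  have he0 : e ≠ 0 := fun h => by simp [h] at he
  have : Fact (Module.finrank ℝ (Pt (n + 1)) = n + 1) := ⟨by simp⟩
  have hfin : Module.finrank ℝ (ℝ ∙ e)ᗮ = n := Submodule.finrank_orthogonal_span_singleton he0
  let b : OrthonormalBasis (Fin n) ℝ (ℝ ∙ e)ᗮ := (stdOrthonormalBasis ℝ _).reindex (finCongr hfin)
  let J : Pt n →ₗᵢ[ℝ] Pt (n + 1) := (ℝ ∙ e)ᗮ.subtypeₗᵢ.comp b.repr.symm.toLinearIsometry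
  have hJ : ∀ w, ⟪e, J w⟫_ℝ = 0 := fun w =>
    Submodule.mem_orthogonal_singleton_iff_inner_right.1 (b.repr.symm w).2
  refine ⟨J, hJ, fun y => ?_, ?_⟩
  · have hy : y - ⟪e, y⟫_ℝ • e ∈ (ℝ ∙ e)ᗮ := by
      rw [Submodule.mem_orthogonal_singleton_iff_inner_right, inner_sub_right, inner_smul_right,
        real_inner_self_eq_norm_sq, he]
      ring
    refine ⟨b.repr ⟨_, hy⟩, ?_⟩
    simp [J]
  · let R₀ : WithLp 2 (ℝ × Pt n) →ₗ[ℝ] Pt (n + 1) :=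
      { toFun := fun p => J p.snd + p.fst • e
        map_add' := fun p q => by simp [add_smul]; abel
        map_smul' := fun c p => by simp [mul_smul] }
    let R : WithLp 2 (ℝ × Pt n) →ₗᵢ[ℝ] Pt (n + 1) :=
      { R₀ with
        norm_map' := fun p => by
          refine (sq_eq_sq₀ (norm_nonneg _) (norm_nonneg _)).1 ?_
          rw [WithLp.prod_norm_sq_eq_of_L2]
          refine (norm_add_smul_sq he hJ _ _).trans ?_
          simp [add_comm] }
    have hd : Module.finrank ℝ (WithLp 2 (ℝ × Pt n)) = Module.finrank ℝ (Pt (n + 1)) := by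
      rw [(WithLp.linearEquiv 2 ℝ (ℝ × Pt n)).finrank_eq]
      simp [add_comm]
    exact (R.toLinearIsometryEquiv hd).measurePreserving.comp
      (WithLp.volume_preserving_toLp ℝ (Pt n))

/-- The coordinate projection onto the parameter space. -/
noncomputable def chartProj (J : Pt n →ₗᵢ[ℝ] Pt (n + 1)) : Pt (n + 1) →L[ℝ] Pt n :=
  ContinuousLinearMap.adjoint J.toContinuousLinearMap

theorem chartProj_apply_add_smul (hJ : ∀ w, ⟪e, J w⟫_ℝ = 0) (w : Pt n) (s : ℝ) :
    chartProj J (J w + s • e) = w := by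
  refine ext_inner_right ℝ fun w' => ?_
  rw [chartProj, ContinuousLinearMap.adjoint_inner_left, inner_add_left, inner_smul_left]
  simp [hJ]

theorem map_chartProj_add (hJ : ∀ w, ⟪e, J w⟫_ℝ = 0) (hJe : ∀ y, ∃ w, J w + ⟪e, y⟫_ℝ • e = y)
    (y : Pt (n + 1)) : J (chartProj J y) + ⟪e, y⟫_ℝ • e = y := by
  obtain ⟨w, hw⟩ := hJe y
  have h := chartProj_apply_add_smul hJ w ⟪e, y⟫_ℝ
  rw [hw] at h
  rw [h, hw]

theorem inner_add_smul (he : ‖e‖ = 1) (hJ : ∀ w, ⟪e, J w⟫_ℝ = 0) (w : Pt n) (s : ℝ) :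
    ⟪e, J w + s • e⟫_ℝ = s := by
  rw [inner_add_right, hJ, inner_smul_right, real_inner_self_eq_norm_sq, he]; simp

/-- The signed height of `y` above the graph of `ψ`. -/
noncomputable def height (J : Pt n →ₗᵢ[ℝ] Pt (n + 1)) (e : Pt (n + 1)) (ψ : Pt n → ℝ)
    (y : Pt (n + 1)) : ℝ :=
  ⟪e, y⟫_ℝ - ψ (chartProj J y)

theorem height_add_smul (he : ‖e‖ = 1) (hJ : ∀ w, ⟪e, J w⟫_ℝ = 0) (ψ : Pt n → ℝ) (w : Pt n)
    (s : ℝ) : height J e ψ (J w + s • e) = s - ψ w := by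
  rw [height, chartProj_apply_add_smul hJ, inner_add_smul he hJ]

theorem height_graphMap (he : ‖e‖ = 1) (hJ : ∀ w, ⟪e, J w⟫_ℝ = 0) (ψ : Pt n → ℝ) (w : Pt n) :
    height J e ψ (graphMap J e ψ w) = 0 := by
  rw [graphMap, height_add_smul he hJ, sub_self]

theorem continuous_height {ψ : Pt n → ℝ} (hψ : Continuous ψ) : Continuous (height J e ψ) := by
  unfold height; fun_prop

theorem eq_graphMap_of_height_eq_zero (hJ : ∀ w, ⟪e, J w⟫_ℝ = 0)
    (hJe : ∀ y, ∃ w, J w + ⟪e, y⟫_ℝ • e = y) {ψ : Pt n → ℝ} {y : Pt (n + 1)}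
    (hy : height J e ψ y = 0) : graphMap J e ψ (chartProj J y) = y := by
  rw [graphMap, ← sub_eq_zero.1 hy, map_chartProj_add hJ hJe]

/-- The non-normalized upward normal `e - ∇ψ` of the graph of `ψ`. -/
noncomputable def graphNormal (J : Pt n →ₗᵢ[ℝ] Pt (n + 1)) (e : Pt (n + 1)) (ψ : Pt n → ℝ)
    (w : Pt n) : Pt (n + 1) :=
  e - J (gradient ψ w)

theorem inner_graphNormal (ψ : Pt n → ℝ) (w : Pt n) (v : Pt (n + 1)) :
    ⟪graphNormal J e ψ w, v⟫_ℝ = ⟪e, v⟫_ℝ - fderiv ℝ ψ w (chartProj J v) := by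
  rw [graphNormal, inner_sub_left, gradient]
  congr 1
  rw [← InnerProductSpace.toDual_symm_apply (y := fderiv ℝ ψ w), chartProj,
    ContinuousLinearMap.adjoint_inner_right]
  rfl

theorem norm_graphNormal (he : ‖e‖ = 1) (hJ : ∀ w, ⟪e, J w⟫_ℝ = 0) (ψ : Pt n → ℝ) (w : Pt n) :
    ‖graphNormal J e ψ w‖ = √(1 + ‖fderiv ℝ ψ w‖ ^ 2) := by
  have h : graphNormal J e ψ w = J (-gradient ψ w) + (1 : ℝ) • e := by
    rw [graphNormal, map_neg, one_smul]; abel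
  rw [eq_comm, Real.sqrt_eq_iff_eq_sq (by positivity) (norm_nonneg _), h, norm_add_smul_sq he hJ,
    norm_neg, gradient, LinearIsometryEquiv.norm_map]
  ring

theorem one_le_norm_graphNormal (he : ‖e‖ = 1) (hJ : ∀ w, ⟪e, J w⟫_ℝ = 0) (ψ : Pt n → ℝ)
    (w : Pt n) : 1 ≤ ‖graphNormal J e ψ w‖ := by
  rw [norm_graphNormal he hJ]
  exact Real.one_le_sqrt.2 (by nlinarith [sq_nonneg ‖fderiv ℝ ψ w‖])

theorem measurable_graphNormal (ψ : Pt n → ℝ) : Measurable (graphNormal J e ψ) := by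
  have h1 := measurable_fderiv ℝ ψ
  have h2 : Measurable (gradient ψ) :=
    (InnerProductSpace.toDual ℝ (Pt n)).symm.continuous.measurable.comp h1
  exact measurable_const.sub (J.continuous.measurable.comp h2)

/-- A set has at most one outward unit normal at a point: otherwise, move from the point in the
direction of the difference of the two. -/
theorem IsOutwardNormal.eq {d : ℕ} {Ω : Set (Pt d)} {x m m' : Pt d} (h : IsOutwardNormal Ω x m)
    (h' : IsOutwardNormal Ω x m') : m = m' := by
  by_contra hne
  -- Along `x + s v` the component in the direction `m` is negative and the one in the direction `m'`
  -- is positive, both of order `s`: the first is impossible outside `Ω`, the second inside `Ω`.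
  set v := m' - m with hv
  have hv0 : 0 < ‖v‖ := norm_pos_iff.2 (sub_ne_zero.2 (Ne.symm hne))
  have hsq : ‖v‖ ^ 2 = 2 - 2 * ⟪m, m'⟫_ℝ := by
    rw [hv, norm_sub_sq_real, h.1, h'.1, real_inner_comm]; ring
  have hvm : ⟪v, m⟫_ℝ = -(‖v‖ ^ 2 / 2) := by
    rw [hsq, hv, inner_sub_left, real_inner_self_eq_norm_sq, h.1, real_inner_comm]; ring
  have hvm' : ⟪v, m'⟫_ℝ = ‖v‖ ^ 2 / 2 := by
    rw [hsq, hv, inner_sub_left, real_inner_self_eq_norm_sq, h'.1]; ring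
  have hδ : 0 < ‖v‖ / 4 := by positivity
  have hlim : Tendsto (fun s : ℝ => x + s • v) (𝓝[>] 0) (𝓝 x) := by
    have : Continuous fun s : ℝ => x + s • v := by fun_prop
    simpa using this.continuousAt (x := 0) |>.tendsto.mono_left nhdsWithin_le_nhds
  obtain ⟨s, ⟨hs1, hs2⟩, hs0⟩ := ((hlim.eventually ((h.2 _ hδ).and (h'.2 _ hδ))).and
    self_mem_nhdsWithin).exists
  rw [add_sub_cancel_left, norm_smul, Real.norm_of_nonneg hs0.le, inner_smul_left] at hs1 hs2
  simp only [conj_trivial, hvm, hvm'] at hs1 hs2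
  have hp : 0 < s * ‖v‖ ^ 2 := by positivity
  by_cases hx : x + s • v ∈ Ω
  · have := hs2.1 hx
    nlinarith
  · have := hs1.2 hx
    nlinarith

theorem outwardNormal_eq {d : ℕ} {Ω : Set (Pt d)} {x m : Pt d} (h : IsOutwardNormal Ω x m) :
    outwardNormal Ω x = m := by
  have hex : ∃ m, IsOutwardNormal Ω x m := ⟨m, h⟩
  rw [outwardNormal, dif_pos hex]
  exact hex.choose_spec.eq h

theorem hasFDerivAt_height {ψ : Pt n → ℝ} {y : Pt (n + 1)}
    (hd : DifferentiableAt ℝ ψ (chartProj J y)) :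
    HasFDerivAt (height J e ψ) (innerSL ℝ (graphNormal J e ψ (chartProj J y))) y := by
  have h := ((innerSL ℝ e).hasFDerivAt (x := y)).sub (hd.hasFDerivAt.comp y (chartProj J).hasFDerivAt)
  refine h.congr_fderiv ?_
  ext v
  simp [inner_graphNormal]

/-- Where `ψ` is differentiable, the subgraph of `ψ` has the expected normal. -/
theorem isOutwardNormal_graphMap (he : ‖e‖ = 1) (hJ : ∀ w, ⟪e, J w⟫_ℝ = 0) {ψ : Pt n → ℝ}
    {Ω U : Set (Pt (n + 1))} (hU : IsOpen U) (hΩ : ∀ y ∈ U, y ∈ Ω ↔ height J e ψ y < 0) {w : Pt n}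
    (hw : graphMap J e ψ w ∈ U) (hd : DifferentiableAt ℝ ψ w) :
    IsOutwardNormal Ω (graphMap J e ψ w) (‖graphNormal J e ψ w‖⁻¹ • graphNormal J e ψ w) := by
  have hN := one_le_norm_graphNormal he hJ ψ w
  set N := graphNormal J e ψ w
  have hN0 : 0 < ‖N‖ := by linarith
  refine ⟨by rw [norm_smul, norm_inv, norm_norm, inv_mul_cancel₀ hN0.ne'], fun δ hδ => ?_⟩
  have hpr : chartProj J (graphMap J e ψ w) = w := chartProj_apply_add_smul hJ _ _
  have hfd := hasFDerivAt_height (J := J) (e := e) (y := graphMap J e ψ w) (by rwa [hpr])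
  rw [hpr] at hfd
  have hlit := hfd.isLittleO.def hδ
  filter_upwards [hlit, hU.mem_nhds hw] with y hy hyU
  rw [height_graphMap he hJ, sub_zero, Real.norm_eq_abs, abs_le, innerSL_apply_apply] at hy
  have hin : ⟪y - graphMap J e ψ w, ‖N‖⁻¹ • N⟫_ℝ = ⟪N, y - graphMap J e ψ w⟫_ℝ / ‖N‖ := by
    rw [inner_smul_right, real_inner_comm]; field_simp
  have hδN : δ * ‖y - graphMap J e ψ w‖ ≤ δ * ‖y - graphMap J e ψ w‖ * ‖N‖ :=
    le_mul_of_one_le_right (by positivity) hN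
  rw [hin, hΩ y hyU, not_lt, div_le_iff₀ hN0, le_div_iff₀ hN0]
  exact ⟨fun h => by linarith, fun h => by linarith⟩

theorem frontier_inter_eq_range_inter (he : ‖e‖ = 1) (hJ : ∀ w, ⟪e, J w⟫_ℝ = 0)
    (hJe : ∀ y, ∃ w, J w + ⟪e, y⟫_ℝ • e = y) {ψ : Pt n → ℝ} (hψ : Continuous ψ)
    {Ω U : Set (Pt (n + 1))} (hU : IsOpen U)
    (hΩ : ∀ y ∈ U, y ∈ Ω ↔ height J e ψ y < 0) :
    frontier Ω ∩ U = range (graphMap J e ψ) ∩ U := by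
  have hc := continuous_height (J := J) (e := e) hψ
  ext y
  refine and_congr_left fun hyU => ?_
  constructor
  · intro hy
    refine ⟨chartProj J y, eq_graphMap_of_height_eq_zero hJ hJe (le_antisymm ?_ ?_)⟩
    · have hcl : y ∈ closure (Ω ∩ U) := by
        have := hU.inter_closure (s := U) (t := Ω) ⟨hyU, hy.1⟩
        rwa [inter_comm] at this
      exact closure_minimal (fun p hp => ((hΩ p hp.2).1 hp.1).le) (isClosed_le hc continuous_const)
        hcl
    · by_contra! h
      have h1 : {p | height J e ψ p < 0} ∩ U ∈ 𝓝 y :=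
        ((isOpen_lt hc continuous_const).inter hU).mem_nhds ⟨h, hyU⟩
      exact hy.2 (mem_interior_iff_mem_nhds.2
        (mem_of_superset h1 fun p hp => (hΩ p hp.2).2 hp.1))
  · rintro ⟨w, rfl⟩
    rw [frontier_eq_closure_inter_closure]
    constructor
    · have hlim : Tendsto (fun s : ℝ => J w + (ψ w - s) • e) (𝓝[>] 0) (𝓝 (graphMap J e ψ w)) := by
        have : Continuous fun s : ℝ => J w + (ψ w - s) • e := by fun_prop
        simpa [graphMap] using this.continuousAt (x := 0) |>.tendsto.mono_left nhdsWithin_le_nhds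
      refine mem_closure_of_tendsto hlim ?_
      filter_upwards [hlim.eventually (hU.mem_nhds hyU), self_mem_nhdsWithin] with s hs hs0
      rw [hΩ _ hs, height_add_smul he hJ]
      rw [mem_Ioi] at hs0; linarith
    · refine subset_closure fun h => ?_
      have := (hΩ _ hyU).1 h
      rw [height_graphMap he hJ] at this
      exact lt_irrefl _ this

end Chart

/-! ### The Gauss–Green formula below a Lipschitz graph -/

section LocalGaussGreen

variable {n : ℕ} {J : Pt n →ₗᵢ[ℝ] Pt (n + 1)} {e : Pt (n + 1)}

/-- The derivative of `t ↦ ∫_S g (y + t v) dy` at `0`. -/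
theorem hasDerivAt_setIntegral_comp_add_smul {E : Type*} [NormedAddCommGroup E] [NormedSpace ℝ E]
    [FiniteDimensional ℝ E] [MeasurableSpace E] [BorelSpace E] {μ : Measure E} [μ.IsAddHaarMeasure]
    {g : E → ℝ} {L : ℝ≥0} (hg : LipschitzWith L g) (hgc : HasCompactSupport g) (S : Set E) (v : E) :
    HasDerivAt (fun t : ℝ => ∫ y in S, g (y + t • v) ∂μ) (∫ y in S, lineDeriv ℝ g y v ∂μ) 0 := by
  have hgi : ∀ t : ℝ, Integrable (fun y => g (y + t • v)) μ := fun t =>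
    (hg.continuous.integrable_of_hasCompactSupport hgc).comp_add_right _
  set Kc := Metric.cthickening ‖v‖ (tsupport g)
  have hKc : IsCompact Kc := IsCompact.cthickening hgc
  refine (hasDerivAt_integral_of_dominated_loc_of_lip (s := Metric.ball 0 1)
    (bound := Kc.indicator fun _ => L * ‖v‖) (Metric.ball_mem_nhds 0 one_pos)
    (Eventually.of_forall fun t => (hgi t).aestronglyMeasurable.restrict) (hgi 0).restrict
    (aestronglyMeasurable_lineDeriv hg.continuous _) ?_ ?_ ?_).2
  · refine Eventually.of_forall fun y => ?_
    by_cases hy : y ∈ Kc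
    · rw [indicator_of_mem hy]
      refine LipschitzOnWith.of_dist_le_mul fun s _ t _ => (hg.dist_le_mul _ _).trans ?_
      rw [Real.coe_nnabs, abs_of_nonneg (by positivity), dist_add_left, dist_eq_norm, ← sub_smul,
        norm_smul, ← dist_eq_norm, mul_assoc, mul_comm ‖v‖]
    · rw [indicator_of_notMem hy]
      have h0 : ∀ t ∈ Metric.ball (0 : ℝ) 1, g (y + t • v) = 0 := fun t ht => by
        by_contra hne
        refine hy (Metric.mem_cthickening_of_dist_le y (y + t • v) _ _
          (subset_tsupport g hne) ?_)
        rw [dist_self_add_right, norm_smul]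
        exact mul_le_of_le_one_left (norm_nonneg _) (mem_ball_zero_iff.1 ht).le
      exact LipschitzOnWith.of_dist_le_mul fun s hs t ht => by
        change dist (g (y + s • v)) (g (y + t • v)) ≤ _
        rw [h0 s hs, h0 t ht]; simp
  · exact ((integrableOn_const hKc.measure_lt_top.ne).integrable_indicator
      hKc.measurableSet).restrict
  · filter_upwards [ae_restrict_of_ae (hg.ae_lineDifferentiableAt v)] with y hy
    exact hy.hasLineDerivAt

theorem integral_Iio_sub_eq {f : ℝ → ℝ} (hf : Continuous f) (hfc : HasCompactSupport f) (a b : ℝ) :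
    (∫ s in Iio b, f s) - ∫ s in Iio a, f s = ∫ s in a..b, f s :=
  intervalIntegral.integral_Iio_sub_Iio'
    (hf.integrable_of_hasCompactSupport hfc).integrableOn
    (hf.integrable_of_hasCompactSupport hfc).integrableOn

theorem hasDerivAt_integral_Iio {f : ℝ → ℝ} (hf : Continuous f) (hfc : HasCompactSupport f)
    (b : ℝ) : HasDerivAt (fun σ => ∫ s in Iio σ, f s) (f b) b := by
  have h := (hf.integral_hasStrictDerivAt 0 b).hasDerivAt.const_add (∫ s in Iio 0, f s)
  refine h.congr_of_eventuallyEq (Eventually.of_forall fun σ => ?_)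
  change _ = _ + _
  rw [← integral_Iio_sub_eq hf hfc]; ring

theorem abs_integral_Iio_sub_le {f : ℝ → ℝ} (hf : Continuous f) (hfc : HasCompactSupport f) {M : ℝ}
    (hM : ∀ s, |f s| ≤ M) (a b : ℝ) :
    |(∫ s in Iio b, f s) - ∫ s in Iio a, f s| ≤ M * |b - a| := by
  rw [integral_Iio_sub_eq hf hfc]
  exact intervalIntegral.norm_integral_le_of_norm_le_const (f := f) fun s _ => hM s

theorem continuous_add_smul : Continuous fun p : ℝ × Pt n => J p.2 + p.1 • e := by
  fun_prop

/-- The Gauss–Green formula for the subgraph of a Lipschitz function: both sides are the derivative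
at `t = 0` of the integral of `g` over the subgraph translated by `t v`, computed under the integral
sign on the left and through the motion of the graph on the right. -/
theorem setIntegral_subgraph_lineDeriv (he : ‖e‖ = 1) (hJ : ∀ w, ⟪e, J w⟫_ℝ = 0)
    (hJe : ∀ y, ∃ w, J w + ⟪e, y⟫_ℝ • e = y)
    (hmp : MeasurePreserving (fun p : ℝ × Pt n => J p.2 + p.1 • e) volume volume)
    {ψ : Pt n → ℝ} {K : ℝ≥0} (hψ : LipschitzWith K ψ) {g : Pt (n + 1) → ℝ} {L : ℝ≥0}
    (hg : LipschitzWith L g) (hgc : HasCompactSupport g) (v : Pt (n + 1)) :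
    ∫ y in {y | height J e ψ y < 0}, lineDeriv ℝ g y v =
      ∫ w, g (graphMap J e ψ w) * ⟪graphNormal J e ψ w, v⟫_ℝ := by
  -- The subgraph of `ψ` translated by `t v` is the subgraph of `σ t`.
  set σ : ℝ → Pt n → ℝ := fun t w => t * ⟪e, v⟫_ℝ + ψ (w - t • chartProj J v) with hσ
  have hgi : Integrable g := hg.continuous.integrable_of_hasCompactSupport hgc
  have hcont := continuous_add_smul (J := J) (e := e)
  have hsm : ∀ t : ℝ, MeasurableSet {y | height J e ψ (y - t • v) < 0} := fun t =>
    (isOpen_lt ((continuous_height hψ.continuous).comp (by fun_prop)) continuous_const).measurableSet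
  have hval : ∀ (t s : ℝ) (w : Pt n), height J e ψ (J w + s • e - t • v) = s - σ t w := by
    intro t s w
    have h1 : J w + s • e - t • v = J (w - t • chartProj J v) + (s - t * ⟪e, v⟫_ℝ) • e := by
      conv_lhs => rw [← map_chartProj_add hJ hJe v]
      rw [map_sub, map_smul]; module
    rw [h1, height_add_smul he hJ, hσ]; ring
  have hind : ∀ t : ℝ, Integrable (fun p : ℝ × Pt n =>
      {y | height J e ψ (y - t • v) < 0}.indicator g (J p.2 + p.1 • e)) := fun t =>
    hmp.integrable_comp_of_integrable (hgi.indicator (hsm t))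
  have hslice : ∀ (t : ℝ) (w : Pt n), ∫ s : ℝ, {y | height J e ψ (y - t • v) < 0}.indicator g
      (J w + s • e) = ∫ s in Iio (σ t w), g (J w + s • e) := by
    intro t w
    rw [← integral_indicator measurableSet_Iio]
    refine integral_congr_ae (Eventually.of_forall fun s => ?_)
    simp only [indicator, mem_ofPred_eq, hval, mem_Iio, sub_neg]
  have hfub : ∀ t : ℝ, ∫ y in {y | height J e ψ y < 0}, g (y + t • v) =
      ∫ w, ∫ s in Iio (σ t w), g (J w + s • e) := by
    intro t
    have h0 : MeasurableSet {y | height J e ψ y < 0} := by simpa using hsm 0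
    rw [← integral_indicator h0]
    have h1 : ∀ y, {y | height J e ψ y < 0}.indicator (fun y => g (y + t • v)) y =
        {y | height J e ψ (y - t • v) < 0}.indicator g (y + t • v) := fun y => by
      simp only [indicator, mem_ofPred_eq, add_sub_cancel_right]
    rw [integral_congr_ae (Eventually.of_forall h1),
      integral_add_right_eq_self ({y | height J e ψ (y - t • v) < 0}.indicator g) (t • v)]
    rw [← hmp.map_eq, integral_map hcont.aemeasurable
      (hmp.map_eq.symm ▸ (hgi.indicator (hsm t)).aestronglyMeasurable)]
    rw [Measure.volume_eq_prod, integral_prod_symm _ (hind t)]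
    exact integral_congr_ae (Eventually.of_forall fun w => hslice t w)
  have hleft := hasDerivAt_setIntegral_comp_add_smul (μ := volume) hg hgc
    {y | height J e ψ y < 0} v
  simp_rw [hfub] at hleft
  obtain ⟨M, hM⟩ := hgc.exists_bound_of_continuous hg.continuous
  have hM0 : 0 ≤ M := (norm_nonneg _).trans (hM 0)
  have hsc : ∀ w, Continuous fun s : ℝ => g (J w + s • e) := fun w =>
    hg.continuous.comp (by fun_prop)
  have hscc : ∀ w, HasCompactSupport fun s : ℝ => g (J w + s • e) := fun w => by
    have : IsClosedEmbedding fun s : ℝ => J w + s • e := by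
      refine Isometry.isClosedEmbedding (Isometry.of_dist_eq fun s t => ?_)
      rw [dist_add_left, dist_eq_norm, ← sub_smul, norm_smul, he, mul_one, ← dist_eq_norm]
    exact hgc.comp_isClosedEmbedding this
  set W : Set (Pt n) := chartProj J '' tsupport g
  have hW : IsCompact W := hgc.isCompact.image (chartProj J).continuous
  have hW0 : ∀ w ∉ W, ∀ s : ℝ, g (J w + s • e) = 0 := fun w hw s => by
    by_contra hne
    exact hw ⟨_, subset_tsupport g hne, chartProj_apply_add_smul hJ w s⟩
  set c : ℝ := |⟪e, v⟫_ℝ| + K * ‖chartProj J v‖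
  have hc0 : 0 ≤ c := by positivity
  have hσl : ∀ s t w, |σ s w - σ t w| ≤ c * |s - t| := by
    intro s t w
    have h1 : σ s w - σ t w = (s - t) * ⟪e, v⟫_ℝ +
      (ψ (w - s • chartProj J v) - ψ (w - t • chartProj J v)) := by simp only [hσ]; ring
    rw [h1]
    refine (abs_add_le _ _).trans ?_
    have h2 := hψ.dist_le_mul (w - s • chartProj J v) (w - t • chartProj J v)
    rw [Real.dist_eq, dist_sub_left, dist_eq_norm, ← sub_smul, norm_smul, Real.norm_eq_abs] at h2
    rw [abs_mul]
    simp only [c]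
    linarith
  have hright : HasDerivAt (fun t => ∫ w, ∫ s in Iio (σ t w), g (J w + s • e))
      (∫ w, g (graphMap J e ψ w) * ⟪graphNormal J e ψ w, v⟫_ℝ) 0 := by
    have hint : ∀ t, Integrable fun w => ∫ s in Iio (σ t w), g (J w + s • e) := fun t => by
      simp_rw [← hslice]
      exact (hind t).integral_prod_right
    refine (hasDerivAt_integral_of_dominated_loc_of_lip (s := univ)
      (bound := W.indicator fun _ => M * c) univ_mem
      (Eventually.of_forall fun t => (hint t).aestronglyMeasurable) (hint 0) ?_ ?_
      ((integrableOn_const hW.measure_lt_top.ne).integrable_indicator hW.measurableSet) ?_).2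
    · refine ((hg.continuous.comp (lipschitzWith_graphMap he hψ).continuous).measurable.mul
        ?_).aestronglyMeasurable
      exact (measurable_graphNormal ψ).inner_const
    · refine Eventually.of_forall fun w => ?_
      refine LipschitzOnWith.of_dist_le_mul fun s _ t _ => ?_
      change dist (∫ r in Iio (σ s w), g (J w + r • e)) (∫ r in Iio (σ t w), g (J w + r • e)) ≤ _
      by_cases hw : w ∈ W
      · rw [indicator_of_mem hw, Real.coe_nnabs, abs_of_nonneg (mul_nonneg hM0 hc0), Real.dist_eq]
        refine (abs_integral_Iio_sub_le (hsc w) (hscc w) (fun r => hM _) _ _).trans ?_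
        rw [mul_assoc, Real.dist_eq]
        exact mul_le_mul_of_nonneg_left (hσl s t w) hM0
      · simp only [hW0 w hw, integral_zero, dist_self]; positivity
    · filter_upwards [hψ.ae_differentiableAt] with w hw
      have hσ0 : σ 0 w = ψ w := by simp [hσ]
      have h1 := hasDerivAt_integral_Iio (hsc w) (hscc w) (σ 0 w)
      have h2 : HasDerivAt (fun t => σ t w) ⟪graphNormal J e ψ w, v⟫_ℝ 0 := by
        have h3 : HasDerivAt (fun t : ℝ => w - t • chartProj J v) (-chartProj J v) 0 := by
          simpa using ((hasDerivAt_id (0 : ℝ)).smul_const (chartProj J v)).const_sub w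
        have hw' : HasFDerivAt ψ (fderiv ℝ ψ w) (w - (0 : ℝ) • chartProj J v) := by
          simpa using hw.hasFDerivAt
        have h4 := ((hasDerivAt_id (0 : ℝ)).mul_const ⟪e, v⟫_ℝ).add
          (hw'.comp_hasDerivAt 0 h3)
        rw [inner_graphNormal]
        refine h4.congr_deriv ?_
        simp; ring
      have h5 := h1.comp 0 h2
      rw [hσ0] at h5
      exact h5
  exact hleft.unique hright

end LocalGaussGreen

/-! ### Graph charts of the boundary -/

section GaussGreen

variable {n : ℕ} {J : Pt n →ₗᵢ[ℝ] Pt (n + 1)} {e : Pt (n + 1)} {ψ : Pt n → ℝ} {K : ℝ≥0}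
  {Ω U : Set (Pt (n + 1))}

/-- In the bounded open set `U`, the set `Ω` is the strict subgraph, in the direction `e`, of the
`K`-Lipschitz function `ψ` of the coordinates `J` of the hyperplane orthogonal to `e`. -/
structure IsGraphChart (J : Pt n →ₗᵢ[ℝ] Pt (n + 1)) (e : Pt (n + 1)) (ψ : Pt n → ℝ) (K : ℝ≥0)
    (Ω U : Set (Pt (n + 1))) : Prop where
  norm_eq : ‖e‖ = 1
  orth : ∀ w, ⟪e, J w⟫_ℝ = 0
  decomp : ∀ y, ∃ w, J w + ⟪e, y⟫_ℝ • e = y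
  measurePreserving : MeasurePreserving (fun p : ℝ × Pt n => J p.2 + p.1 • e) volume volume
  lipschitz : LipschitzWith K ψ
  isOpen : IsOpen U
  isBounded : Bornology.IsBounded U
  mem_iff : ∀ y ∈ U, y ∈ Ω ↔ height J e ψ y < 0

theorem HasLipschitzBoundary.exists_isGraphChart (h : HasLipschitzBoundary Ω) {x : Pt (n + 1)}
    (hx : x ∈ frontier Ω) :
    ∃ (U : Set (Pt (n + 1))) (J : Pt n →ₗᵢ[ℝ] Pt (n + 1)) (e : Pt (n + 1)) (ψ : Pt n → ℝ)
      (K : ℝ≥0), x ∈ U ∧ IsGraphChart J e ψ K Ω U := by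
  obtain ⟨e, φ, K, r, he, hφ, hr, hmem⟩ := h x hx
  obtain ⟨J, hJ, hJe, hmp⟩ := exists_orthogonal_coordinates he
  refine ⟨Metric.ball x r, J, e, φ ∘ J, K * 1, Metric.mem_ball_self hr, he, hJ, hJe, hmp,
    hφ.comp J.lipschitz, Metric.isOpen_ball, Metric.isBounded_ball, fun y hy => ?_⟩
  rw [hmem y hy, height, sub_neg, Function.comp_apply]
  have h1 : y - ⟪e, y⟫_ℝ • e = J (chartProj J y) := by
    rw [sub_eq_iff_eq_add, map_chartProj_add hJ hJe]
  rw [h1]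

namespace IsGraphChart

theorem surface_restrict (h : IsGraphChart J e ψ K Ω U) :
    (surface (n + 1)).restrict (frontier Ω ∩ U) =
      ((graphArea ψ).restrict (graphMap J e ψ ⁻¹' U)).map (graphMap J e ψ) := by
  have hemb := measurableEmbedding_graphMap h.norm_eq h.orth h.lipschitz
  rw [frontier_inter_eq_range_inter h.norm_eq h.orth h.decomp h.lipschitz.continuous h.isOpen
    h.mem_iff, ← hemb.restrict_map, map_graphArea h.norm_eq h.orth h.lipschitz,
    Measure.restrict_restrict h.isOpen.measurableSet, inter_comm]
  rfl

theorem surface_lt_top (h : IsGraphChart J e ψ K Ω U) : surface (n + 1) (frontier Ω ∩ U) < ∞ := by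
  have hemb := measurableEmbedding_graphMap h.norm_eq h.orth h.lipschitz
  rw [← Measure.restrict_apply_univ, h.surface_restrict, hemb.map_apply, preimage_univ,
    Measure.restrict_apply_univ, graphArea,
    withDensity_apply _ (hemb.measurable h.isOpen.measurableSet)]
  have hb : Bornology.IsBounded (graphMap J e ψ ⁻¹' U) :=
    (antilipschitzWith_graphMap h.norm_eq h.orth ψ).isBounded_preimage h.isBounded
  refine (setLIntegral_mono (g := fun _ => ENNReal.ofReal √(1 + (K : ℝ) ^ 2)) measurable_const
    fun w _ => ?_).trans_lt ?_
  · have : ‖fderiv ℝ ψ w‖ ≤ K := norm_fderiv_le_of_lipschitz ℝ h.lipschitz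
    gcongr
  · rw [setLIntegral_const]
    exact ENNReal.mul_lt_top ENNReal.ofReal_lt_top hb.measure_lt_top

theorem ae_isOutwardNormal_graphMap (h : IsGraphChart J e ψ K Ω U) :
    ∀ᵐ w ∂(graphArea ψ).restrict (graphMap J e ψ ⁻¹' U), IsOutwardNormal Ω (graphMap J e ψ w)
      (‖graphNormal J e ψ w‖⁻¹ • graphNormal J e ψ w) := by
  have hemb := measurableEmbedding_graphMap h.norm_eq h.orth h.lipschitz
  rw [ae_restrict_iff' (hemb.measurable h.isOpen.measurableSet)]
  refine (withDensity_absolutelyContinuous _ _).ae_le ?_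
  filter_upwards [h.lipschitz.ae_differentiableAt] with w hw hwU
  exact isOutwardNormal_graphMap h.norm_eq h.orth h.isOpen h.mem_iff hwU hw

theorem ae_exists_isOutwardNormal (h : IsGraphChart J e ψ K Ω U) :
    ∀ᵐ x ∂(surface (n + 1)).restrict (frontier Ω ∩ U), ∃ m, IsOutwardNormal Ω x m := by
  have hemb := measurableEmbedding_graphMap h.norm_eq h.orth h.lipschitz
  rw [h.surface_restrict, hemb.ae_map_iff]
  filter_upwards [h.ae_isOutwardNormal_graphMap] with w hw using ⟨_, hw⟩

theorem aestronglyMeasurable_outwardNormal (h : IsGraphChart J e ψ K Ω U) :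
    AEStronglyMeasurable (outwardNormal Ω) ((surface (n + 1)).restrict (frontier Ω ∩ U)) := by
  have hemb := measurableEmbedding_graphMap h.norm_eq h.orth h.lipschitz
  rw [h.surface_restrict, hemb.aestronglyMeasurable_map_iff]
  have hm := measurable_graphNormal (J := J) (e := e) ψ
  refine AEStronglyMeasurable.congr (hm.norm.inv.smul hm).aestronglyMeasurable ?_
  filter_upwards [h.ae_isOutwardNormal_graphMap] with w hw using (outwardNormal_eq hw).symm

/-- The Gauss–Green formula for functions supported in a chart. -/
theorem setIntegral_lineDeriv (h : IsGraphChart J e ψ K Ω U) (hΩ : IsOpen Ω)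
    {g : Pt (n + 1) → ℝ} {L : ℝ≥0} (hg : LipschitzWith L g) (hgc : HasCompactSupport g)
    (hgU : tsupport g ⊆ U) (v : Pt (n + 1)) :
    ∫ y in Ω, lineDeriv ℝ g y v =
      ∫ y in frontier Ω, g y * ⟪outwardNormal Ω y, v⟫_ℝ ∂surface (n + 1) := by
  have hemb := measurableEmbedding_graphMap h.norm_eq h.orth h.lipschitz
  have hUm : MeasurableSet (graphMap J e ψ ⁻¹' U) := hemb.measurable h.isOpen.measurableSet
  have hg0 : ∀ y ∉ U, g y = 0 := fun y hy => image_eq_zero_of_notMem_tsupport fun hy' => hy (hgU hy')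
  have hld0 : ∀ y ∉ U, lineDeriv ℝ g y v = 0 := fun y hy => by
    have h0 : g =ᶠ[𝓝 y] fun _ => 0 :=
      notMem_tsupport_iff_eventuallyEq.1 fun hy' => hy (hgU hy')
    rw [h0.lineDeriv_eq]
    simp [lineDeriv]
  have hleft : ∫ y in Ω, lineDeriv ℝ g y v = ∫ y in {y | height J e ψ y < 0}, lineDeriv ℝ g y v := by
    rw [← integral_indicator hΩ.measurableSet, ← integral_indicator
      (isOpen_lt (continuous_height h.lipschitz.continuous) continuous_const).measurableSet]
    congr 1
    ext y
    by_cases hy : y ∈ U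
    · simp only [indicator, mem_ofPred_eq, h.mem_iff y hy]
    · simp only [indicator, hld0 y hy, ite_self]
  have hright : ∫ y in frontier Ω, g y * ⟪outwardNormal Ω y, v⟫_ℝ ∂surface (n + 1) =
      ∫ y in frontier Ω ∩ U, g y * ⟪outwardNormal Ω y, v⟫_ℝ ∂surface (n + 1) := by
    refine setIntegral_eq_of_subset_of_forall_sdiff_eq_zero isClosed_frontier.measurableSet
      inter_subset_left fun y hy => ?_
    rw [hg0 y fun hyU => hy.2 ⟨hy.1, hyU⟩, zero_mul]
  rw [hleft, hright, setIntegral_subgraph_lineDeriv h.norm_eq h.orth h.decomp h.measurePreserving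
    h.lipschitz hg hgc v, h.surface_restrict, hemb.integral_map]
  have hcongr : ∫ w in graphMap J e ψ ⁻¹' U, g (graphMap J e ψ w) *
        ⟪outwardNormal Ω (graphMap J e ψ w), v⟫_ℝ ∂graphArea ψ =
      ∫ w in graphMap J e ψ ⁻¹' U, g (graphMap J e ψ w) *
        ⟪‖graphNormal J e ψ w‖⁻¹ • graphNormal J e ψ w, v⟫_ℝ ∂graphArea ψ := by
    refine integral_congr_ae ?_
    filter_upwards [h.ae_isOutwardNormal_graphMap] with w hw
    rw [outwardNormal_eq hw]
  rw [hcongr, graphArea, restrict_withDensity hUm, integral_withDensity_eq_integral_toReal_smul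
    (measurable_graphArea_density ψ) (Eventually.of_forall fun _ => ENNReal.ofReal_lt_top),
    ← integral_indicator hUm]
  congr 1
  ext w
  by_cases hw : w ∈ graphMap J e ψ ⁻¹' U
  · rw [indicator_of_mem hw, ENNReal.toReal_ofReal (Real.sqrt_nonneg _),
      ← norm_graphNormal h.norm_eq h.orth, inner_smul_left, smul_eq_mul, conj_trivial]
    have := one_le_norm_graphNormal h.norm_eq h.orth ψ w
    have h0 : ‖graphNormal J e ψ w‖ ≠ 0 := by linarith
    field_simp
  · rw [indicator_of_notMem hw, hg0 _ hw, zero_mul]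

end IsGraphChart

end GaussGreen

/-! ### The Gauss–Green formula on bounded Lipschitz domains -/

section GaussGreenGlobal

/-- The product of two real Lipschitz functions is Lipschitz if one has compact support. -/
theorem exists_lipschitzWith_mul {E : Type*} [PseudoMetricSpace E] {f g : E → ℝ} {K L : ℝ≥0}
    (hf : LipschitzWith K f) (hg : LipschitzWith L g) (hgc : HasCompactSupport g) :
    ∃ C : ℝ≥0, LipschitzWith C fun x => g x * f x := by
  obtain ⟨M, hM⟩ := hgc.isCompact.exists_bound_of_continuousOn hf.continuous.continuousOn
  obtain ⟨B, hB⟩ := hgc.exists_bound_of_continuous hg.continuous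
  have hkey : ∀ x ∈ tsupport g, ∀ y, |g x * f x - g y * f y| ≤ (|M| * L + |B| * K) * dist x y := by
    intro x hx y
    have h1 : g x * f x - g y * f y = f x * (g x - g y) + g y * (f x - f y) := by ring
    have h2 : |f x| ≤ |M| := (hM x hx).trans (le_abs_self M)
    have h3 : |g y| ≤ |B| := (hB y).trans (le_abs_self B)
    have h4 : |g x - g y| ≤ L * dist x y := hg.dist_le_mul x y
    have h5 : |f x - f y| ≤ K * dist x y := hf.dist_le_mul x y
    rw [h1]
    calc _ ≤ |f x| * |g x - g y| + |g y| * |f x - f y| := by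
          rw [← abs_mul, ← abs_mul]; exact abs_add_le _ _
      _ ≤ |M| * (L * dist x y) + |B| * (K * dist x y) := by gcongr
      _ = _ := by ring
  refine ⟨Real.nnabs M * L + Real.nnabs B * K, LipschitzWith.of_dist_le_mul fun x y => ?_⟩
  rw [Real.dist_eq]
  push_cast
  by_cases hx : x ∈ tsupport g
  · simpa using hkey x hx y
  by_cases hy : y ∈ tsupport g
  · rw [abs_sub_comm, dist_comm]; simpa using hkey y hy x
  · rw [image_eq_zero_of_notMem_tsupport hx, image_eq_zero_of_notMem_tsupport hy]
    simp only [zero_mul, sub_zero, abs_zero]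
    positivity

theorem integral_lineDeriv_eq_zero {E : Type*} [NormedAddCommGroup E] [NormedSpace ℝ E]
    [FiniteDimensional ℝ E] [MeasurableSpace E] [BorelSpace E] {μ : Measure E} [μ.IsAddHaarMeasure]
    {g : E → ℝ} {L : ℝ≥0} (hg : LipschitzWith L g) (hgc : HasCompactSupport g) (v : E) :
    ∫ y, lineDeriv ℝ g y v ∂μ = 0 := by
  have h := LipschitzWith.integral_lineDeriv_mul_eq (μ := μ)
    (LipschitzWith.const (1 : ℝ) : LipschitzWith 0 fun _ : E => (1 : ℝ)) hg hgc (-v)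
  simpa [lineDeriv] using h.symm

variable {n : ℕ} {Ω : Set (Pt (n + 1))}

namespace IsBoundedLipschitzDomain

theorem isCompact_closure (hΩ : IsBoundedLipschitzDomain Ω) : IsCompact (closure Ω) :=
  hΩ.isBounded.isCompact_closure

theorem isCompact_frontier (hΩ : IsBoundedLipschitzDomain Ω) : IsCompact (frontier Ω) :=
  hΩ.isCompact_closure.of_isClosed_subset isClosed_frontier frontier_subset_closure

theorem isFiniteMeasure_restrict (hΩ : IsBoundedLipschitzDomain Ω) :
    IsFiniteMeasure (volume.restrict Ω) :=
  ⟨by simpa using hΩ.isBounded.measure_lt_top⟩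

/-- Finitely many graph charts cover the boundary. -/
theorem exists_charts (hΩ : IsBoundedLipschitzDomain Ω) :
    ∃ (ι : Type) (_ : Finite ι) (U : ι → Set (Pt (n + 1))), frontier Ω ⊆ ⋃ i, U i ∧
      ∀ i, ∃ J e ψ K, IsGraphChart (n := n) J e ψ K Ω (U i) := by
  choose! U J e ψ K hxU hchart using
    fun x (hx : x ∈ frontier Ω) => hΩ.boundary.exists_isGraphChart hx
  obtain ⟨t, htf, ht⟩ := hΩ.isCompact_frontier.elim_nhds_subcover U
    fun x hx => (hchart x hx).isOpen.mem_nhds (hxU x hx)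
  exact ⟨Fin t.card, inferInstance, fun i => U (t.equivFin.symm i), by
    intro x hx
    obtain ⟨y, hy, hxy⟩ := mem_iUnion₂.1 (ht hx)
    exact mem_iUnion.2 ⟨t.equivFin ⟨y, hy⟩, by simpa using hxy⟩,
    fun i => ⟨_, _, _, _, hchart _ (htf _ (t.equivFin.symm i).2)⟩⟩

theorem surface_frontier_lt_top (hΩ : IsBoundedLipschitzDomain Ω) :
    surface (n + 1) (frontier Ω) < ∞ := by
  obtain ⟨ι, _, U, hU, hchart⟩ := hΩ.exists_charts
  have : Fintype ι := Fintype.ofFinite ι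
  rw [← inter_eq_left.2 hU, inter_iUnion]
  refine (measure_iUnion_le _).trans_lt ?_
  rw [tsum_fintype]
  refine ENNReal.sum_lt_top.2 fun i _ => ?_
  obtain ⟨J, e, ψ, K, h⟩ := hchart i
  exact h.surface_lt_top

theorem ae_exists_isOutwardNormal (hΩ : IsBoundedLipschitzDomain Ω) :
    ∀ᵐ x ∂(surface (n + 1)).restrict (frontier Ω), ∃ m, IsOutwardNormal Ω x m := by
  obtain ⟨ι, _, U, hU, hchart⟩ := hΩ.exists_charts
  rw [← inter_eq_left.2 hU, inter_iUnion, ae_restrict_iUnion_iff]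
  intro i
  obtain ⟨J, e, ψ, K, h⟩ := hchart i
  exact h.ae_exists_isOutwardNormal

theorem ae_isOutwardNormal (hΩ : IsBoundedLipschitzDomain Ω) :
    ∀ᵐ x ∂(surface (n + 1)).restrict (frontier Ω), IsOutwardNormal Ω x (outwardNormal Ω x) := by
  filter_upwards [hΩ.ae_exists_isOutwardNormal] with x ⟨m, hm⟩
  rwa [outwardNormal_eq hm]

theorem aestronglyMeasurable_outwardNormal (hΩ : IsBoundedLipschitzDomain Ω) :
    AEStronglyMeasurable (outwardNormal Ω) ((surface (n + 1)).restrict (frontier Ω)) := by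
  obtain ⟨ι, _, U, hU, hchart⟩ := hΩ.exists_charts
  rw [← inter_eq_left.2 hU, inter_iUnion, aestronglyMeasurable_iUnion_iff]
  intro i
  obtain ⟨J, e, ψ, K, h⟩ := hchart i
  exact h.aestronglyMeasurable_outwardNormal

theorem isFiniteMeasure_surface (hΩ : IsBoundedLipschitzDomain Ω) :
    IsFiniteMeasure ((surface (n + 1)).restrict (frontier Ω)) :=
  ⟨by simpa using hΩ.surface_frontier_lt_top⟩

theorem integrable_mul_inner_outwardNormal (hΩ : IsBoundedLipschitzDomain Ω)
    {g : Pt (n + 1) → ℝ} (hg : ContinuousOn g (frontier Ω)) (v : Pt (n + 1)) :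
    Integrable (fun y => g y * ⟪outwardNormal Ω y, v⟫_ℝ)
      ((surface (n + 1)).restrict (frontier Ω)) := by
  have := hΩ.isFiniteMeasure_surface
  obtain ⟨M, hM⟩ := hΩ.isCompact_frontier.exists_bound_of_continuousOn hg
  have hfm : MeasurableSet (frontier Ω) := isClosed_frontier.measurableSet
  refine Integrable.of_bound (C := M * ‖v‖) ((hg.aestronglyMeasurable hfm).mul
    (hΩ.aestronglyMeasurable_outwardNormal.inner_const)) ?_
  filter_upwards [hΩ.ae_isOutwardNormal, ae_restrict_mem hfm] with x hx hxf
  rw [norm_mul]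
  have h1 := norm_inner_le_norm (𝕜 := ℝ) (outwardNormal Ω x) v
  rw [hx.1, one_mul] at h1
  exact mul_le_mul (hM x hxf) h1 (norm_nonneg _) ((norm_nonneg _).trans (hM x hxf))

/-- The Gauss–Green formula, localized by a smooth partition of unity. -/
theorem setIntegral_lineDeriv (hΩ : IsBoundedLipschitzDomain Ω) {F : Pt (n + 1) → ℝ} {L : ℝ≥0}
    (hF : LipschitzWith L F) (v : Pt (n + 1)) :
    ∫ y in Ω, lineDeriv ℝ F y v =
      ∫ y in frontier Ω, F y * ⟪outwardNormal Ω y, v⟫_ℝ ∂surface (n + 1) := by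
  obtain ⟨ι, _, U, hU, hchart⟩ := hΩ.exists_charts
  have : Fintype ι := Fintype.ofFinite ι
  have := hΩ.isFiniteMeasure_restrict
  -- The closure is covered by `Ω` itself (index `none`), which has no boundary contribution, and by
  -- the charts.
  let V : Option ι → Set (Pt (n + 1)) := fun i => i.elim Ω U
  have hVo : ∀ i, IsOpen (V i) := by
    rintro (_ | i)
    · exact hΩ.isOpen
    · obtain ⟨J, e, ψ, K, h⟩ := hchart i
      exact h.isOpen
  have hVb : ∀ i, Bornology.IsBounded (V i) := by
    rintro (_ | i)
    · exact hΩ.isBounded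
    · obtain ⟨J, e, ψ, K, h⟩ := hchart i
      exact h.isBounded
  have hVc : closure Ω ⊆ ⋃ i, V i := by
    intro x hx
    by_cases hxΩ : x ∈ Ω
    · exact mem_iUnion.2 ⟨none, hxΩ⟩
    · have hxf : x ∈ frontier Ω := ⟨hx, by rwa [hΩ.isOpen.interior_eq]⟩
      obtain ⟨i, hi⟩ := mem_iUnion.1 (hU hxf)
      exact mem_iUnion.2 ⟨some i, hi⟩
  obtain ⟨p, hp⟩ := SmoothPartitionOfUnity.exists_isSubordinate
    (modelWithCornersSelf ℝ (Pt (n + 1))) isClosed_closure V hVo hVc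
  have hpc : ∀ i, HasCompactSupport (p i) := fun i =>
    ((hVb i).subset (hp i)).isCompact_closure.of_isClosed_subset (isClosed_tsupport _)
      subset_closure
  have hpl : ∀ i, ∃ C : ℝ≥0, LipschitzWith C (p i) := fun i =>
    ContDiff.lipschitzWith_of_hasCompactSupport (hpc i) (p i).contMDiff.contDiff (by simp)
  choose C hC using hpl
  choose D hD using fun i => exists_lipschitzWith_mul hF (hC i) (hpc i)
  set g : Option ι → Pt (n + 1) → ℝ := fun i x => p i x * F x with hg
  have hgc : ∀ i, HasCompactSupport (g i) := fun i => (hpc i).mul_right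
  have hgV : ∀ i, tsupport (g i) ⊆ V i := fun i => (tsupport_mul_subset_left).trans (hp i)
  have hsum : ∀ x ∈ closure Ω, F x = ∑ i, g i x := fun x hx => by
    have h1 := p.sum_eq_one hx
    rw [finsum_eq_sum_of_fintype] at h1
    rw [hg, ← Finset.sum_mul, h1, one_mul]
  have hcharts : ∀ i, ∫ y in Ω, lineDeriv ℝ (g i) y v =
      ∫ y in frontier Ω, g i y * ⟪outwardNormal Ω y, v⟫_ℝ ∂surface (n + 1) := by
    rintro (_ | i)
    · rw [setIntegral_eq_integral_of_forall_compl_eq_zero, integral_lineDeriv_eq_zero (hD none)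
        (hgc none), eq_comm]
      · refine setIntegral_eq_zero_of_forall_eq_zero fun x hx => ?_
        have : x ∉ Ω := fun h => hx.2 (by rwa [hΩ.isOpen.interior_eq])
        rw [image_eq_zero_of_notMem_tsupport fun h => this (hgV none h), zero_mul]
      · intro x hx
        have h0 : g none =ᶠ[𝓝 x] fun _ => 0 :=
          notMem_tsupport_iff_eventuallyEq.1 fun h => hx (hgV none h)
        rw [h0.lineDeriv_eq]
        simp [lineDeriv]
    · obtain ⟨J, e, ψ, K, h⟩ := hchart i
      exact h.setIntegral_lineDeriv hΩ.isOpen (hD (some i)) (hgc (some i)) (hgV (some i)) v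
  have hleft : ∫ y in Ω, lineDeriv ℝ F y v = ∑ i, ∫ y in Ω, lineDeriv ℝ (g i) y v := by
    rw [← integral_finsetSum _ fun i _ =>
      (((hD i).memLp_lineDeriv (μ := volume) v).restrict Ω).integrable le_top]
    refine integral_congr_ae ?_
    have hae : ∀ᵐ y ∂volume.restrict Ω, ∀ i, LineDifferentiableAt ℝ (g i) y v :=
      ae_all_iff.2 fun i => ae_restrict_of_ae ((hD i).ae_lineDifferentiableAt v)
    filter_upwards [hae, ae_restrict_mem hΩ.isOpen.measurableSet] with y hy hyΩ
    have h1 : F =ᶠ[𝓝 y] fun x => ∑ i, g i x := by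
      filter_upwards [hΩ.isOpen.mem_nhds hyΩ] with x hx using hsum x (subset_closure hx)
    rw [h1.lineDeriv_eq]
    exact (HasDerivAt.fun_sum fun i _ => (hy i).hasLineDerivAt).deriv
  have hright : ∫ y in frontier Ω, F y * ⟪outwardNormal Ω y, v⟫_ℝ ∂surface (n + 1) =
      ∑ i, ∫ y in frontier Ω, g i y * ⟪outwardNormal Ω y, v⟫_ℝ ∂surface (n + 1) := by
    rw [← integral_finsetSum _ fun i _ =>
      hΩ.integrable_mul_inner_outwardNormal (hD i).continuous.continuousOn v]
    refine setIntegral_congr_fun isClosed_frontier.measurableSet fun y hy => ?_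
    exact (congrArg (· * ⟪outwardNormal Ω y, v⟫_ℝ) (hsum y (frontier_subset_closure hy))).trans
      (Finset.sum_mul _ _ _)
  rw [hleft, hright]
  exact Finset.sum_congr rfl fun i _ => hcharts i

theorem ae_differentiableAt (hΩ : IsOpen Ω) {F : Pt (n + 1) → ℝ} {L : ℝ≥0}
    (hF : LipschitzOnWith L F Ω) : ∀ᵐ x ∂volume.restrict Ω, DifferentiableAt ℝ F x := by
  filter_upwards [hF.ae_differentiableWithinAt hΩ.measurableSet (μ := volume),
    ae_restrict_mem hΩ.measurableSet] with x hx hxΩ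
  exact hx.differentiableAt (hΩ.mem_nhds hxΩ)

/-- The Gauss–Green formula for a function that is Lipschitz up to the boundary. -/
theorem setIntegral_pd (hΩ : IsBoundedLipschitzDomain Ω) {F : Pt (n + 1) → ℝ} {L : ℝ≥0}
    (hF : LipschitzOnWith L F (closure Ω)) (j : Fin (n + 1)) :
    ∫ y in Ω, pd j F y =
      ∫ y in frontier Ω, F y * outwardNormal Ω y j ∂surface (n + 1) := by
  obtain ⟨G, hG, hFG⟩ := hF.extend_real
  have h := hΩ.setIntegral_lineDeriv hG (EuclideanSpace.single j 1)
  refine Eq.trans ?_ (h.trans ?_)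
  · refine integral_congr_ae ?_
    filter_upwards [ae_restrict_of_ae hG.ae_differentiableAt,
      ae_restrict_mem hΩ.isOpen.measurableSet] with y hy hyΩ
    have h1 : F =ᶠ[𝓝 y] G := by
      filter_upwards [hΩ.isOpen.mem_nhds hyΩ] with x hx using hFG (subset_closure hx)
    rw [pd, h1.fderiv_eq, hy.lineDeriv_eq_fderiv]
  · refine setIntegral_congr_fun isClosed_frontier.measurableSet fun y hy => ?_
    simp only
    rw [hFG (frontier_subset_closure hy), EuclideanSpace.inner_single_right]
    simp

/-- The partial derivatives of a Lipschitz function are essentially bounded. -/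
theorem memLp_pd (hΩ : IsBoundedLipschitzDomain Ω) {F : Pt (n + 1) → ℝ} {L : ℝ≥0}
    (hF : LipschitzOnWith L F Ω) (j : Fin (n + 1)) : MemLp (pd j F) ∞ (volume.restrict Ω) := by
  obtain ⟨G, hG, hFG⟩ := hF.extend_real
  refine ((hG.memLp_lineDeriv (μ := volume) (EuclideanSpace.single j 1)).restrict Ω).ae_eq ?_
  filter_upwards [ae_restrict_of_ae hG.ae_differentiableAt,
    ae_restrict_mem hΩ.isOpen.measurableSet] with y hy hyΩ
  have h1 : F =ᶠ[𝓝 y] G := by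
    filter_upwards [hΩ.isOpen.mem_nhds hyΩ] with x hx using hFG hx
  rw [pd, h1.fderiv_eq, hy.lineDeriv_eq_fderiv]

end IsBoundedLipschitzDomain

end GaussGreenGlobal

/-! ### Differentiation in time -/

section TimeDerivative

theorem abs_slope_sub_le_of_rat {f : ℝ → ℝ} (hf : Continuous f) {t δ ε : ℝ}
    (h : ∀ q r : ℚ, (q : ℝ) ≠ 0 → |(q : ℝ)| < δ → (r : ℝ) ≠ 0 → |(r : ℝ)| < δ →
      |(q : ℝ)⁻¹ * (f (t + q) - f t) - (r : ℝ)⁻¹ * (f (t + r) - f t)| ≤ ε)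
    {x y : ℝ} (hx0 : x ≠ 0) (hx : |x| < δ) (hy0 : y ≠ 0) (hy : |y| < δ) :
    |x⁻¹ * (f (t + x) - f t) - y⁻¹ * (f (t + y) - f t)| ≤ ε := by
  have hne : ∀ x : ℝ, (comap ((↑) : ℚ → ℝ) (𝓝 x)).NeBot :=
    Rat.isDenseEmbedding_coe_real.isDenseInducing.comap_nhds_neBot
  have hev : ∀ {x : ℝ}, x ≠ 0 → |x| < δ →
      ∀ᶠ q : ℚ in comap ((↑) : ℚ → ℝ) (𝓝 x), (q : ℝ) ≠ 0 ∧ |(q : ℝ)| < δ := fun {x} h0 hδ =>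
    tendsto_comap.eventually (((isOpen_ne.inter (isOpen_lt continuous_abs continuous_const)).mem_nhds
      ⟨h0, hδ⟩))
  have hlim : ∀ {x : ℝ}, x ≠ 0 → Tendsto (fun q : ℚ => (q : ℝ)⁻¹ * (f (t + q) - f t))
      (comap ((↑) : ℚ → ℝ) (𝓝 x)) (𝓝 (x⁻¹ * (f (t + x) - f t))) := fun {x} h0 => by
    have hc : ContinuousAt (fun y : ℝ => y⁻¹ * (f (t + y) - f t)) x :=
      (continuousAt_inv₀ h0).mul (by fun_prop)
    exact hc.tendsto.comp tendsto_comap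
  have := hne x
  have := hne y
  refine le_of_tendsto (((hlim hx0).comp tendsto_fst).sub ((hlim hy0).comp tendsto_snd)).abs ?_
  filter_upwards [(hev hx0 hx).prod_mk (hev hy0 hy)] with p hp
  exact h _ _ hp.1.1 hp.1.2 hp.2.1 hp.2.2

/-- Differentiability of a continuous function in terms of countably many difference quotients. -/
theorem differentiableAt_iff_forall_rat {f : ℝ → ℝ} (hf : Continuous f) (t : ℝ) :
    DifferentiableAt ℝ f t ↔ ∀ k : ℕ, ∃ m : ℕ, ∀ q r : ℚ,
      ((q : ℝ) ≠ 0 ∧ |(q : ℝ)| < 1 / (m + 1) ∧ (r : ℝ) ≠ 0 ∧ |(r : ℝ)| < 1 / (m + 1)) →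
      |(q : ℝ)⁻¹ * (f (t + q) - f t) - (r : ℝ)⁻¹ * (f (t + r) - f t)| ≤ 1 / (k + 1) := by
  constructor
  · intro hd k
    have hk : (0 : ℝ) < 1 / (k + 1) / 2 := by positivity
    have h1 := hasDerivAt_iff_tendsto_slope_zero.1 hd.hasDerivAt
    obtain ⟨δ, hδ, h2⟩ := Metric.mem_nhdsWithin_iff.1 (h1 (Metric.ball_mem_nhds _ hk))
    obtain ⟨m, hm⟩ := exists_nat_one_div_lt hδ
    refine ⟨m, fun q r hqr => ?_⟩
    have h3 : ∀ x : ℝ, x ≠ 0 → |x| < 1 / (m + 1) →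
        |x⁻¹ * (f (t + x) - f t) - deriv f t| < 1 / (k + 1) / 2 := fun x h0 hx =>
      h2 ⟨by rw [mem_ball_zero_iff]; exact hx.trans hm, h0⟩
    have h4 := h3 q hqr.1 hqr.2.1
    have h5 := h3 r hqr.2.2.1 hqr.2.2.2
    rw [abs_lt] at h4 h5
    rw [abs_le]
    constructor <;> linarith
  · intro h
    have hC : Cauchy (map (fun x : ℝ => x⁻¹ * (f (t + x) - f t)) (𝓝[≠] 0)) := by
      rw [Metric.cauchy_iff]
      refine ⟨inferInstance, fun ε hε => ?_⟩
      obtain ⟨k, hk⟩ := exists_nat_one_div_lt hε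
      obtain ⟨m, hm⟩ := h k
      refine ⟨_, image_mem_map (inter_mem_nhdsWithin {0}ᶜ
        (Metric.ball_mem_nhds (0 : ℝ) (ε := 1 / (m + 1)) (by positivity))), ?_⟩
      rintro _ ⟨x, ⟨hx0, hx⟩, rfl⟩ _ ⟨y, ⟨hy0, hy⟩, rfl⟩
      rw [mem_ball_zero_iff] at hx hy
      exact (abs_slope_sub_le_of_rat hf
        (fun q r h1 h2 h3 h4 => hm q r ⟨h1, h2, h3, h4⟩) hx0 hx hy0 hy).trans_lt hk
    obtain ⟨l, hl⟩ := cauchy_iff_exists_le_nhds.1 hC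
    exact (hasDerivAt_iff_tendsto_slope_zero.2 hl).differentiableAt

variable {X : Type*} [MeasurableSpace X] {μ : Measure X}

theorem measurableSet_differentiableAt_of_continuous_of_measurable {H : ℝ → X → ℝ}
    (hc : ∀ x, Continuous fun s => H s x) (hm : ∀ s, Measurable (H s)) :
    MeasurableSet {p : ℝ × X | DifferentiableAt ℝ (fun s => H s p.2) p.1} := by
  have hu : Measurable (Function.uncurry H) := measurable_uncurry_of_continuous_of_measurable hc hm
  have hq : ∀ q : ℝ, Measurable fun p : ℝ × X => q⁻¹ * (H (p.1 + q) p.2 - H p.1 p.2) := fun q =>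
    ((hu.comp ((measurable_fst.add_const q).prodMk measurable_snd)).sub hu).const_mul _
  simp_rw [fun p : ℝ × X => differentiableAt_iff_forall_rat (hc p.2) p.1]
  refine measurableSet_setOfPred.2 ?_
  refine Measurable.forall fun k => Measurable.exists fun m => Measurable.forall fun q =>
    Measurable.forall fun r => Measurable.imp measurable_const ?_
  exact measurableSet_setOfPred.1
    (measurableSet_le ((hq q).sub (hq r)).abs measurable_const)

/-- A field that is Lipschitz in time at almost every point is, at almost every time, differentiable
in time at almost every point. Only measurability at fixed times is required. -/
theorem ae_ae_differentiableAt_of_lipschitzOnWith [SFinite μ] {T : ℝ} {F : ℝ → X → ℝ}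
    (hm : ∀ s ∈ Icc 0 T, AEStronglyMeasurable (F s) μ)
    (hL : ∀ᵐ x ∂μ, ∃ K : ℝ≥0, LipschitzOnWith K (fun s => F s x) (Icc 0 T)) :
    ∀ᵐ t ∂volume.restrict (Ioo 0 T), ∀ᵐ x ∂μ, DifferentiableAt ℝ (fun s => F s x) t := by
  rcases le_or_gt T 0 with hT | hT
  · simp [Ioo_eq_empty hT.not_gt]
  -- Clamp time to `[0, T]` and discard a null set of points, so that the resulting field `H` is
  -- continuous in time everywhere and measurable at rational, hence at all, times.
  set p : ℝ → ℝ := fun s => projIcc 0 T hT.le s with hp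
  have hpm : ∀ s, p s ∈ Icc 0 T := fun s => (projIcc 0 T hT.le s).2
  have hpc : Continuous p := continuous_subtype_val.comp continuous_projIcc
  choose m hmm hmF using fun q : ℚ => hm (p q) (hpm q)
  have hgood : ∀ᵐ x ∂μ, (∀ q : ℚ, F (p q) x = m q x) ∧
      ∃ K : ℝ≥0, LipschitzOnWith K (fun s => F s x) (Icc 0 T) := (ae_all_iff.2 hmF).and hL
  obtain ⟨G, hGs, hGm, hG⟩ : ∃ G ⊆ {x | (∀ q : ℚ, F (p q) x = m q x) ∧
      ∃ K : ℝ≥0, LipschitzOnWith K (fun s => F s x) (Icc 0 T)}, MeasurableSet G ∧ μ Gᶜ = 0 := by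
    refine ⟨(toMeasurable μ {x | (∀ q : ℚ, F (p q) x = m q x) ∧
      ∃ K : ℝ≥0, LipschitzOnWith K (fun s => F s x) (Icc 0 T)}ᶜ)ᶜ,
      compl_subset_comm.1 (subset_toMeasurable _ _), (measurableSet_toMeasurable _ _).compl, ?_⟩
    rw [compl_compl, measure_toMeasurable]
    exact hgood
  classical
  set H : ℝ → X → ℝ := fun s => G.indicator (F (p s)) with hH
  have hHc : ∀ x, Continuous fun s => H s x := fun x => by
    by_cases hx : x ∈ G
    · obtain ⟨K, hK⟩ := (hGs hx).2
      simp only [hH, indicator_of_mem hx]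
      exact hK.continuousOn.comp_continuous hpc hpm
    · simp only [hH, indicator_of_notMem hx]; exact continuous_const
  have hHq : ∀ q : ℚ, Measurable (H q) := fun q => by
    have : H q = G.indicator (m q) := indicator_congr fun x hx => (hGs hx).1 q
    rw [this]
    exact (hmm q).measurable.indicator hGm
  have hHm : ∀ s, Measurable (H s) := fun s => by
    have hne : (comap ((↑) : ℚ → ℝ) (𝓝 s)).NeBot :=
      Rat.isDenseEmbedding_coe_real.isDenseInducing.comap_nhds_neBot s
    refine measurable_of_tendsto_metrizable' (comap ((↑) : ℚ → ℝ) (𝓝 s)) hHq ?_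
    exact tendsto_pi_nhds.2 fun x => (hHc x).continuousAt.tendsto.comp tendsto_comap
  have hloc : ∀ t ∈ Ioo 0 T, ∀ x ∈ G, (fun s => F s x) =ᶠ[𝓝 t] fun s => H s x := fun t ht x hx => by
    filter_upwards [Icc_mem_nhds ht.1 ht.2] with s hs
    simp only [hH, indicator_of_mem hx, hp, projIcc_of_mem hT.le hs]
  -- Fubini exchanges the two quantifiers, and at fixed points Rademacher's theorem applies.
  have hae : ∀ᵐ t ∂volume.restrict (Ioo 0 T), ∀ᵐ x ∂μ, DifferentiableAt ℝ (fun s => H s x) t := by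
    rw [Measure.ae_ae_comm (p := fun t x => DifferentiableAt ℝ (fun s => H s x) t)
      (measurableSet_differentiableAt_of_continuous_of_measurable hHc hHm)]
    refine Eventually.of_forall fun x => ?_
    by_cases hx : x ∈ G
    · obtain ⟨K, hK⟩ := (hGs hx).2
      filter_upwards [(hK.mono Ioo_subset_Icc_self).ae_differentiableWithinAt measurableSet_Ioo
        (μ := volume), ae_restrict_mem measurableSet_Ioo] with t ht htI
      exact (ht.differentiableAt (Ioo_mem_nhds htI.1 htI.2)).congr_of_eventuallyEq
        (hloc t htI x hx).symm
    · simp only [hH, indicator_of_notMem hx]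
      exact Eventually.of_forall fun t => differentiableAt_const _
  filter_upwards [hae, ae_restrict_mem measurableSet_Ioo] with t ht htI
  have hGae : ∀ᵐ x ∂μ, x ∈ G := hG
  filter_upwards [ht, hGae] with x hx hxG
  exact hx.congr_of_eventuallyEq (hloc t htI x hxG)

theorem aestronglyMeasurable_of_hasDerivAt {F : ℝ → X → ℝ} {F' : X → ℝ} {t : ℝ}
    (hm : ∀ᶠ s in 𝓝 t, AEStronglyMeasurable (F s) μ)
    (h : ∀ᵐ x ∂μ, HasDerivAt (fun s => F s x) (F' x) t) : AEStronglyMeasurable F' μ := by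
  have hlim : Tendsto (fun s : ℝ => t + s) (𝓝[≠] 0) (𝓝 t) := by
    have : Continuous fun s : ℝ => t + s := by fun_prop
    simpa using this.continuousAt (x := 0) |>.tendsto.mono_left nhdsWithin_le_nhds
  obtain ⟨s, hs⟩ := exists_seq_tendsto (𝓝[≠] (0 : ℝ))
  obtain ⟨N, hN⟩ := eventually_atTop.1 ((hlim.comp hs).eventually hm)
  have hs' := hs.comp (tendsto_add_atTop_nat N)
  refine aestronglyMeasurable_of_tendsto_ae atTop
    (f := fun k x => (s (k + N))⁻¹ * (F (t + s (k + N)) x - F t x)) (fun k => ?_) ?_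
  · exact ((hN (k + N) (by omega)).sub hm.self_of_nhds).const_mul _
  · filter_upwards [h] with x hx
    exact (hasDerivAt_iff_tendsto_slope_zero.1 hx).comp hs'

/-- Differentiation under the integral sign for an integrand that is uniformly Lipschitz in time
on a neighbourhood `S` of `t`. -/
theorem hasDerivAt_integral_of_abs_sub_le {F : ℝ → X → ℝ} {F' : X → ℝ} {t : ℝ} {S : Set ℝ}
    (hS : S ∈ 𝓝 t) (hm : ∀ s ∈ S, AEStronglyMeasurable (F s) μ) (hi : Integrable (F t) μ)
    {B : X → ℝ} (hB : Integrable B μ)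
    (hL : ∀ᵐ x ∂μ, ∀ s ∈ S, ∀ r ∈ S, |F s x - F r x| ≤ B x * |s - r|)
    (h : ∀ᵐ x ∂μ, HasDerivAt (fun s => F s x) (F' x) t) :
    Integrable F' μ ∧ HasDerivAt (fun s => ∫ x, F s x ∂μ) (∫ x, F' x ∂μ) t := by
  have hm' : ∀ᶠ s in 𝓝 t, AEStronglyMeasurable (F s) μ := by
    filter_upwards [hS] with s hs using hm s hs
  refine hasDerivAt_integral_of_dominated_loc_of_lip hS hm' hi
    (aestronglyMeasurable_of_hasDerivAt hm' h) ?_ hB h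
  filter_upwards [hL] with x hx
  refine LipschitzOnWith.of_dist_le_mul fun s hs r hr => ?_
  rw [Real.dist_eq, Real.dist_eq, Real.coe_nnabs]
  exact (hx s hs r hr).trans (by gcongr; exact le_abs_self _)

end TimeDerivative

/-! ### Integration by parts and uniform estimates on the closure of the domain -/

section Domain

variable {n : ℕ} {Ω : Set (Pt (n + 1))}

theorem exists_lipschitzOnWith_mul {E : Type*} [PseudoMetricSpace E] {s : Set E}
    (hs : IsCompact s) {f g : E → ℝ} {K L : ℝ≥0} (hf : LipschitzOnWith K f s)
    (hg : LipschitzOnWith L g s) : ∃ C : ℝ≥0, LipschitzOnWith C (fun x => f x * g x) s := by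
  obtain ⟨M, hM⟩ := hs.exists_bound_of_continuousOn hf.continuousOn
  obtain ⟨B, hB⟩ := hs.exists_bound_of_continuousOn hg.continuousOn
  refine ⟨Real.nnabs M * L + Real.nnabs B * K, LipschitzOnWith.of_dist_le_mul fun x hx y hy => ?_⟩
  have h1 : f x * g x - f y * g y = f x * (g x - g y) + g y * (f x - f y) := by ring
  have h2 : |f x| ≤ |M| := (hM x hx).trans (le_abs_self M)
  have h3 : |g y| ≤ |B| := (hB y hy).trans (le_abs_self B)
  have h4 : |g x - g y| ≤ L * dist x y := hg.dist_le_mul x hx y hy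
  have h5 : |f x - f y| ≤ K * dist x y := hf.dist_le_mul x hx y hy
  rw [Real.dist_eq, h1]
  push_cast
  calc _ ≤ |f x| * |g x - g y| + |g y| * |f x - f y| := by
        rw [← abs_mul, ← abs_mul]; exact abs_add_le _ _
    _ ≤ |M| * (L * dist x y) + |B| * (K * dist x y) := by gcongr
    _ = _ := by ring

theorem locallyLipschitz_mul {E : Type*} [PseudoMetricSpace E] {f g : E → ℝ}
    (hf : LocallyLipschitz f) (hg : LocallyLipschitz g) : LocallyLipschitz fun x => f x * g x :=
  ((contDiff_fst.mul contDiff_snd : ContDiff ℝ 1 fun p : ℝ × ℝ => p.1 * p.2).locallyLipschitz).comp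
    (hf.prodMk hg)

theorem locallyLipschitz_finsetSum {E ι : Type*} [PseudoMetricSpace E] (s : Finset ι)
    {f : ι → E → ℝ} (hf : ∀ i, LocallyLipschitz (f i)) :
    LocallyLipschitz fun x => ∑ i ∈ s, f i x := by
  classical
  induction s using Finset.induction_on with
  | empty => simpa using LocallyLipschitz.const (0 : ℝ)
  | insert a s ha ih =>
    simp only [Finset.sum_insert ha]
    exact (hf a).add ih

/-- An inequality between continuous functions that holds almost everywhere in an open set holds
everywhere in its closure. -/
theorem le_of_ae_le_of_mem_closure {E : Type*} [NormedAddCommGroup E] [MeasurableSpace E]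
    {μ : Measure E} [μ.IsOpenPosMeasure] {O : Set E} (hO : IsOpen O) (hOm : MeasurableSet O)
    {f g : E → ℝ} (hf : ContinuousOn f (closure O)) (hg : ContinuousOn g (closure O))
    (h : ∀ᵐ x ∂μ.restrict O, f x ≤ g x) {x : E} (hx : x ∈ closure O) : f x ≤ g x := by
  set A : Set E := {y | y ∈ O ∧ f y ≤ g y}
  have hAO : closure A = closure O := by
    refine (closure_mono fun y hy => hy.1).antisymm (closure_minimal (fun y hy => ?_) isClosed_closure)
    rw [mem_closure_iff]
    intro V hV hyV
    by_contra hne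
    have hsub : V ∩ O ⊆ {y | ¬(y ∈ O → f y ≤ g y)} := fun p hp hp' => hne ⟨p, hp.1, hp.2, hp' hp.2⟩
    rw [ae_restrict_iff' hOm] at h
    exact ((hV.inter hO).measure_pos μ ⟨y, hyV, hy⟩).ne' (measure_mono_null hsub h)
  rw [← hAO] at hf hg hx
  exact le_on_closure (fun y hy => hy.2) hf hg hx

/-- A locally Lipschitz space-time field is uniformly Lipschitz in time. -/
theorem exists_norm_sub_le_of_locallyLipschitz {E V : Type*} [PseudoMetricSpace E]
    [SeminormedAddCommGroup V] {s : Set E} (hs : IsCompact s) {c : ℝ × E → V}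
    (hc : LocallyLipschitz c) (T : ℝ) :
    ∃ L : ℝ≥0, ∀ x ∈ s, ∀ t ∈ Icc 0 T, ∀ r ∈ Icc 0 T, ‖c (t, x) - c (r, x)‖ ≤ L * |t - r| := by
  obtain ⟨L, hL⟩ := LocallyLipschitzOn.exists_lipschitzOnWith_of_compact
    (isCompact_Icc.prod hs) (hc.locallyLipschitzOn (s := Icc 0 T ×ˢ s))
  refine ⟨L, fun x hx t ht r hr => ?_⟩
  have := hL.dist_le_mul (t, x) ⟨ht, hx⟩ (r, x) ⟨hr, hx⟩
  rwa [dist_eq_norm, Prod.dist_eq, dist_self, max_eq_left dist_nonneg, Real.dist_eq] at this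

namespace IsBoundedLipschitzDomain

theorem memLp_top_of_continuousOn (hΩ : IsBoundedLipschitzDomain Ω) {f : Pt (n + 1) → ℝ}
    (hf : ContinuousOn f (closure Ω)) : MemLp f ∞ (volume.restrict Ω) := by
  obtain ⟨M, hM⟩ := hΩ.isCompact_closure.exists_bound_of_continuousOn hf
  refine memLp_top_of_bound ((hf.mono subset_closure).aestronglyMeasurable hΩ.isOpen.measurableSet)
    M ?_
  filter_upwards [ae_restrict_mem hΩ.isOpen.measurableSet] with x hx using hM x (subset_closure hx)

theorem integrable_of_memLp_top (hΩ : IsBoundedLipschitzDomain Ω) {f : Pt (n + 1) → ℝ}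
    (hf : MemLp f ∞ (volume.restrict Ω)) : Integrable f (volume.restrict Ω) := by
  have := hΩ.isFiniteMeasure_restrict
  exact hf.integrable le_top

/-- Integration by parts for functions that are Lipschitz up to the boundary. -/
theorem setIntegral_pd_mul (hΩ : IsBoundedLipschitzDomain Ω) {S g : Pt (n + 1) → ℝ} {K L : ℝ≥0}
    (hS : LipschitzOnWith K S (closure Ω)) (hg : LipschitzOnWith L g (closure Ω))
    (j : Fin (n + 1)) :
    ∫ x in Ω, pd j S x * g x =
      (∫ x in frontier Ω, S x * g x * outwardNormal Ω x j ∂surface (n + 1)) -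
        ∫ x in Ω, S x * pd j g x := by
  obtain ⟨C, hC⟩ := exists_lipschitzOnWith_mul hΩ.isCompact_closure hS hg
  rw [← hΩ.setIntegral_pd hC j, eq_sub_iff_add_eq, ← integral_add]
  · refine integral_congr_ae ?_
    filter_upwards [ae_differentiableAt hΩ.isOpen (hS.mono subset_closure),
      ae_differentiableAt hΩ.isOpen (hg.mono subset_closure)] with x hx hx'
    rw [pd, pd, pd, fderiv_fun_mul hx hx']
    simp; ring
  · exact hΩ.integrable_of_memLp_top ((hΩ.memLp_top_of_continuousOn hg.continuousOn).mul
      (hΩ.memLp_pd (hS.mono subset_closure) j))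
  · exact hΩ.integrable_of_memLp_top ((hΩ.memLp_pd (hg.mono subset_closure) j).mul
      (hΩ.memLp_top_of_continuousOn hS.continuousOn))

/-- Differentiation in time of an integral over the domain whose integrand is a sum of products of
bounded coefficients and locally Lipschitz space-time fields. -/
theorem hasDerivAt_setIntegral_sum (hΩ : IsBoundedLipschitzDomain Ω) {ι : Type*} [Fintype ι]
    {b : ι → Pt (n + 1) → ℝ} (hb : ∀ k, MemLp (b k) ∞ (volume.restrict Ω))
    {c : ι → ℝ × Pt (n + 1) → ℝ} (hc : ∀ k, LocallyLipschitz (c k)) {F' : Pt (n + 1) → ℝ}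
    {T t : ℝ} (ht : t ∈ Ioo 0 T)
    (h : ∀ᵐ x ∂volume.restrict Ω, HasDerivAt (fun s => ∑ k, b k x * c k (s, x)) (F' x) t) :
    Integrable F' (volume.restrict Ω) ∧
      HasDerivAt (fun s => ∫ x in Ω, ∑ k, b k x * c k (s, x)) (∫ x in Ω, F' x) t := by
  choose L hL using fun k => exists_norm_sub_le_of_locallyLipschitz hΩ.isCompact_closure (hc k) T
  have hmem : ∀ s, MemLp (fun x => ∑ k, b k x * c k (s, x)) ∞ (volume.restrict Ω) := fun s =>
    memLp_finsetSum _ fun k _ => (hΩ.memLp_top_of_continuousOn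
      ((hc k).continuous.comp (by fun_prop : Continuous fun x => (s, x))).continuousOn).mul (hb k)
  refine hasDerivAt_integral_of_abs_sub_le (Icc_mem_nhds ht.1 ht.2)
    (B := fun x => ∑ k, |b k x| * L k) (fun s _ => (hmem s).aestronglyMeasurable)
    (hΩ.integrable_of_memLp_top (hmem t)) ?_ ?_ h
  · exact integrable_finsetSum _ fun k _ =>
      ((hΩ.integrable_of_memLp_top (hb k)).abs).mul_const _
  · filter_upwards [ae_restrict_mem hΩ.isOpen.measurableSet] with x hx s hs r hr
    rw [← Finset.sum_sub_distrib, Finset.sum_mul]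
    refine (Finset.abs_sum_le_sum_abs _ _).trans (Finset.sum_le_sum fun k _ => ?_)
    rw [← mul_sub, abs_mul, mul_assoc]
    exact mul_le_mul_of_nonneg_left (hL k x (subset_closure hx) s hs r hr) (abs_nonneg _)

end IsBoundedLipschitzDomain

end Domain

/-! ### Space-time fields of class `C^{1,1}` -/

section Field

theorem gradient_apply {d : ℕ} (f : Pt d → ℝ) (x : Pt d) (j : Fin d) : gradient f x j = pd j f x := by
  rw [pd, gradient, ← InnerProductSpace.toDual_symm_apply (y := fderiv ℝ f x),
    EuclideanSpace.inner_single_right]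
  simp

/-- The scalar space-time field `w` is of class `C^1` with locally Lipschitz derivative. -/
structure IsC11 {d : ℕ} (w : ℝ → Pt d → ℝ) : Prop where
  contDiff : ContDiff ℝ 1 (fun p : ℝ × Pt d => w p.1 p.2)
  lipschitz : LocallyLipschitz (fderiv ℝ (fun p : ℝ × Pt d => w p.1 p.2))

namespace IsC11

variable {d : ℕ} {w : ℝ → Pt d → ℝ}

theorem hasFDerivAt (h : IsC11 w) (p : ℝ × Pt d) :
    HasFDerivAt (fun p : ℝ × Pt d => w p.1 p.2) (fderiv ℝ (fun p : ℝ × Pt d => w p.1 p.2) p) p :=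
  (h.contDiff.differentiable one_ne_zero p).hasFDerivAt

theorem hasFDerivAt_space (h : IsC11 w) (t : ℝ) (x : Pt d) :
    HasFDerivAt (w t) ((fderiv ℝ (fun p : ℝ × Pt d => w p.1 p.2) (t, x)).comp
      (ContinuousLinearMap.inr ℝ ℝ (Pt d))) x :=
  (h.hasFDerivAt (t, x)).comp x (hasFDerivAt_prodMk_right t x)

theorem hasDerivAt_time (h : IsC11 w) (t : ℝ) (x : Pt d) :
    HasDerivAt (fun s => w s x) (fderiv ℝ (fun p : ℝ × Pt d => w p.1 p.2) (t, x) (1, 0)) t := by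
  have h1 : HasDerivAt (fun s : ℝ => (s, x)) ((1 : ℝ), (0 : Pt d)) t :=
    (hasDerivAt_id t).prodMk (hasDerivAt_const t x)
  exact (h.hasFDerivAt (t, x)).comp_hasDerivAt t h1

theorem dt_eq (h : IsC11 w) (t : ℝ) (x : Pt d) :
    dt w t x = fderiv ℝ (fun p : ℝ × Pt d => w p.1 p.2) (t, x) (1, 0) :=
  (h.hasDerivAt_time t x).deriv

theorem hasDerivAt_dt (h : IsC11 w) (t : ℝ) (x : Pt d) :
    HasDerivAt (fun s => w s x) (dt w t x) t := by
  rw [h.dt_eq]; exact h.hasDerivAt_time t x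

theorem pd_eq (h : IsC11 w) (j : Fin d) (t : ℝ) (x : Pt d) :
    pd j (w t) x =
      fderiv ℝ (fun p : ℝ × Pt d => w p.1 p.2) (t, x) (0, EuclideanSpace.single j 1) := by
  rw [pd, (h.hasFDerivAt_space t x).fderiv]; rfl

theorem locallyLipschitz (h : IsC11 w) : LocallyLipschitz (fun p : ℝ × Pt d => w p.1 p.2) :=
  h.contDiff.locallyLipschitz

theorem locallyLipschitz_fderiv_apply (h : IsC11 w) (v : ℝ × Pt d) :
    LocallyLipschitz (fun p => fderiv ℝ (fun p : ℝ × Pt d => w p.1 p.2) p v) :=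
  (ContinuousLinearMap.apply ℝ ℝ v).lipschitz.locallyLipschitz.comp h.lipschitz

theorem locallyLipschitz_dt (h : IsC11 w) : LocallyLipschitz (fun p : ℝ × Pt d => dt w p.1 p.2) := by
  simp_rw [h.dt_eq]; exact h.locallyLipschitz_fderiv_apply _

theorem locallyLipschitz_pd (h : IsC11 w) (j : Fin d) :
    LocallyLipschitz (fun p : ℝ × Pt d => pd j (w p.1) p.2) := by
  simp_rw [h.pd_eq]; exact h.locallyLipschitz_fderiv_apply _

/-- By Rademacher's theorem in space-time and the symmetry of second derivatives, almost
everywhere the first derivatives are differentiable in time and `∂_t ∂_j w = ∂_j ∂_t w`. -/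
theorem ae_hasDerivAt (h : IsC11 w) (t₁ : Set ℝ) (O : Set (Pt d)) :
    ∀ᵐ t ∂volume.restrict t₁, ∀ᵐ x ∂volume.restrict O,
      HasDerivAt (fun s => dt w s x) (dt (dt w) t x) t ∧
      ∀ j, HasDerivAt (fun s => pd j (w s) x) (pd j (dt w t) x) t := by
  set D := fderiv ℝ (fun p : ℝ × Pt d => w p.1 p.2) with hD
  have hae : ∀ᵐ p ∂(volume : Measure ℝ).prod (volume : Measure (Pt d)), DifferentiableAt ℝ D p := by
    have hloc : ∀ k : ℕ, ∀ᵐ p ∂(volume : Measure ℝ).prod (volume : Measure (Pt d)),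
        p ∈ Metric.ball 0 (k : ℝ) → DifferentiableAt ℝ D p := by
      intro k
      obtain ⟨L, hL⟩ := LocallyLipschitzOn.exists_lipschitzOnWith_of_compact
        (isCompact_closedBall (0 : ℝ × Pt d) k) (h.lipschitz.locallyLipschitzOn)
      filter_upwards [(hL.mono Metric.ball_subset_closedBall).ae_differentiableWithinAt_of_mem
        (μ := (volume : Measure ℝ).prod (volume : Measure (Pt d)))] with p hp hpk
      exact (hp hpk).differentiableAt (Metric.isOpen_ball.mem_nhds hpk)
    filter_upwards [ae_all_iff.2 hloc] with p hp
    obtain ⟨k, hk⟩ := exists_nat_gt ‖p‖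
    exact hp k (mem_ball_zero_iff.2 hk)
  refine ae_restrict_of_ae ((Measure.ae_ae_of_ae_prod hae).mono fun t ht => ?_)
  refine ae_restrict_of_ae (ht.mono fun x hx => ?_)
  have hv : ∀ v, HasFDerivAt (fun p => D p v)
      ((ContinuousLinearMap.apply ℝ ℝ v).comp (fderiv ℝ D (t, x))) (t, x) := fun v =>
    (ContinuousLinearMap.apply ℝ ℝ v).hasFDerivAt.comp _ hx.hasFDerivAt
  have hcurve : HasDerivAt (fun s : ℝ => (s, x)) ((1 : ℝ), (0 : Pt d)) t :=
    (hasDerivAt_id t).prodMk (hasDerivAt_const t x)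
  have htime : ∀ v, HasDerivAt (fun s => D (s, x) v) (fderiv ℝ D (t, x) (1, 0) v) t := fun v => by
    have := (hv v).comp_hasDerivAt t hcurve
    exact this
  constructor
  · have h1 : HasDerivAt (fun s => dt w s x) (fderiv ℝ D (t, x) (1, 0) (1, 0)) t := by
      simp_rw [h.dt_eq]; exact htime _
    exact h1.differentiableAt.hasDerivAt
  · intro j
    have h1 : HasFDerivAt (fun y => dt w t y)
        (((ContinuousLinearMap.apply ℝ ℝ ((1 : ℝ), (0 : Pt d))).comp (fderiv ℝ D (t, x))).comp
          (ContinuousLinearMap.inr ℝ ℝ (Pt d))) x := by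
      simp_rw [h.dt_eq]
      exact (hv (1, 0)).comp x (hasFDerivAt_prodMk_right t x)
    have h2 : pd j (dt w t) x = fderiv ℝ D (t, x) (0, EuclideanSpace.single j 1) (1, 0) := by
      rw [pd]
      exact congrArg (fun L : Pt d →L[ℝ] ℝ => L (EuclideanSpace.single j 1)) h1.fderiv
    rw [h2, second_derivative_symmetric h.hasFDerivAt hx.hasFDerivAt]
    simp_rw [h.pd_eq]
    exact htime _

end IsC11

theorem isC11_apply {d : ℕ} {u : ℝ → Pt d → Pt d}
    (h1 : ContDiff ℝ 1 (fun p : ℝ × Pt d => u p.1 p.2))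
    (h2 : LocallyLipschitz (fderiv ℝ (fun p : ℝ × Pt d => u p.1 p.2))) (i : Fin d) :
    IsC11 fun t x => u t x i := by
  refine ⟨(EuclideanSpace.proj i : Pt d →L[ℝ] ℝ).contDiff.comp h1, ?_⟩
  have h3 : fderiv ℝ (fun p : ℝ × Pt d => u p.1 p.2 i) = fun p =>
      (EuclideanSpace.proj i : Pt d →L[ℝ] ℝ).comp (fderiv ℝ (fun p : ℝ × Pt d => u p.1 p.2) p) :=
    funext fun p => ((EuclideanSpace.proj i : Pt d →L[ℝ] ℝ).hasFDerivAt.comp p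
      (h1.differentiable one_ne_zero p).hasFDerivAt).fderiv
  rw [h3]
  exact ((ContinuousLinearMap.compL ℝ (ℝ × Pt d) (Pt d) ℝ
    (EuclideanSpace.proj i : Pt d →L[ℝ] ℝ)).lipschitz.locallyLipschitz).comp h2

theorem dt_apply {d : ℕ} {u : ℝ → Pt d → Pt d} {t : ℝ} {x : Pt d}
    (h : DifferentiableAt ℝ (fun s => u s x) t) (i : Fin d) :
    dt u t x i = dt (fun s y => u s y i) t x := by
  have := (EuclideanSpace.proj i : Pt d →L[ℝ] ℝ).hasFDerivAt.comp_hasDerivAt t h.hasDerivAt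
  exact this.deriv.symm

end Field

/-! ### Rates of the elastic, kinetic and crack energies -/

section BulkRates

variable {n : ℕ} {P : Data (n + 1)} {u : ℝ → Pt (n + 1) → Pt (n + 1)} {z : ℝ → Pt (n + 1) → ℝ}

namespace Data.Smooth

theorem isC11_u (hs : P.Smooth u z) (i : Fin (n + 1)) : IsC11 fun t x => u t x i :=
  isC11_apply hs.contDiff_u hs.lipschitz_u i

theorem isC11_z (hs : P.Smooth u z) : IsC11 z := ⟨hs.contDiff_z, hs.lipschitz_z⟩

theorem hasDerivAt_u (hs : P.Smooth u z) (t : ℝ) (x : Pt (n + 1)) :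
    HasDerivAt (fun s => u s x) (dt u t x) t := by
  have h : DifferentiableAt ℝ (fun s => u s x) t :=
    differentiableAt_euclidean.2 fun i => ((hs.isC11_u i).hasDerivAt_dt t x).differentiableAt
  exact h.hasDerivAt

theorem dt_u_apply (hs : P.Smooth u z) (t : ℝ) (x : Pt (n + 1)) (i : Fin (n + 1)) :
    dt u t x i = dt (fun s y => u s y i) t x :=
  dt_apply (hs.hasDerivAt_u t x).differentiableAt i

theorem locallyLipschitz_strain (hs : P.Smooth u z) (i j : Fin (n + 1)) :
    LocallyLipschitz fun p : ℝ × Pt (n + 1) => strain (u p.1) p.2 i j :=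
  locallyLipschitz_mul (LocallyLipschitz.const (1 / 2 : ℝ))
    (((hs.isC11_u i).locallyLipschitz_pd j).add ((hs.isC11_u j).locallyLipschitz_pd i))

theorem locallyLipschitz_one_sub_sq (hs : P.Smooth u z) :
    LocallyLipschitz fun p : ℝ × Pt (n + 1) => (1 - z p.1 p.2) ^ 2 := by
  have h : LocallyLipschitz fun p : ℝ × Pt (n + 1) => 1 - z p.1 p.2 :=
    (LocallyLipschitz.const 1).sub hs.isC11_z.locallyLipschitz
  simp_rw [sq]
  exact locallyLipschitz_mul h h

theorem continuous_slice {c : ℝ × Pt (n + 1) → ℝ} (hc : LocallyLipschitz c) (t : ℝ) :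
    Continuous fun x => c (t, x) :=
  hc.continuous.comp (by fun_prop)

theorem exists_lipschitzOnWith_slice {s : Set (Pt (n + 1))} (hs : IsCompact s)
    {c : ℝ × Pt (n + 1) → ℝ} (hc : LocallyLipschitz c) (t : ℝ) :
    ∃ K : ℝ≥0, LipschitzOnWith K (fun x => c (t, x)) s :=
  LocallyLipschitzOn.exists_lipschitzOnWith_of_compact hs
    ((hc.comp (LocallyLipschitz.prodMk_left t)).locallyLipschitzOn)

theorem exists_lipschitzOnWith_dt_u (hs : P.Smooth u z) {s : Set (Pt (n + 1))} (hsc : IsCompact s)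
    (t : ℝ) (i : Fin (n + 1)) : ∃ K : ℝ≥0, LipschitzOnWith K (fun x => dt u t x i) s := by
  simp_rw [hs.dt_u_apply]
  exact exists_lipschitzOnWith_slice hsc (hs.isC11_u i).locallyLipschitz_dt t

theorem continuous_dt_u (hs : P.Smooth u z) (t : ℝ) (i : Fin (n + 1)) :
    Continuous fun x => dt u t x i := by
  simp_rw [hs.dt_u_apply]
  exact continuous_slice (hs.isC11_u i).locallyLipschitz_dt t

/-- Second-order regularity at almost every time: the velocity is differentiable in time and time
derivatives commute with the strain and with the gradient of `z` almost everywhere. -/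
theorem ae_hasDerivAt (hs : P.Smooth u z) :
    ∀ᵐ t ∂volume.restrict (Ioo 0 P.T), ∀ᵐ x ∂volume.restrict P.Ω,
      HasDerivAt (fun s => dt u s x) (dt (dt u) t x) t ∧
      (∀ i j, HasDerivAt (fun s => strain (u s) x i j) (strain (dt u t) x i j) t) ∧
      ∀ j, HasDerivAt (fun s => pd j (z s) x) (pd j (dt z t) x) t := by
  have h1 := fun i => (hs.isC11_u i).ae_hasDerivAt (Ioo 0 P.T) P.Ω
  filter_upwards [ae_all_iff.2 h1, hs.isC11_z.ae_hasDerivAt (Ioo 0 P.T) P.Ω] with t ht htz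
  filter_upwards [ae_all_iff.2 ht, htz] with x hx hxz
  refine ⟨?_, fun i j => ?_, hxz.2⟩
  · have h2 : DifferentiableAt ℝ (fun s => dt u s x) t := differentiableAt_euclidean.2 fun i => by
      simp_rw [hs.dt_u_apply]
      exact (hx i).1.differentiableAt
    exact h2.hasDerivAt
  · have h3 : ∀ i, (fun y => dt u t y i) = dt (fun s y => u s y i) t := fun i =>
      funext fun y => hs.dt_u_apply t y i
    simp only [strain, Matrix.of_apply, h3]
    exact (((hx i).2 j).add ((hx j).2 i)).const_mul (1 / 2 : ℝ)

end Data.Smooth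

namespace Data

theorem ddot_damagedStress (v : Pt (n + 1) → Pt (n + 1)) (ζ : Pt (n + 1) → ℝ) (x : Pt (n + 1))
    (η : Tensor (n + 1)) :
    ddot (P.damagedStress v ζ x) η = (1 - ζ x) ^ 2 * ddot (P.stress v x) η := by
  simp only [ddot, damagedStress, Matrix.smul_apply, smul_eq_mul, Finset.mul_sum, mul_assoc]

theorem ddot_damagedStress_eq_sum (v : Pt (n + 1) → Pt (n + 1)) (ζ : Pt (n + 1) → ℝ)
    (x : Pt (n + 1)) :
    ddot (P.damagedStress v ζ x) (strain v x) =
      ∑ k : (Fin (n + 1) × Fin (n + 1)) × (Fin (n + 1) × Fin (n + 1)),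
        P.C x k.1.1 k.1.2 k.2.1 k.2.2 *
          ((1 - ζ x) ^ 2 * (strain v x k.2.1 k.2.2 * strain v x k.1.1 k.1.2)) := by
  rw [ddot_damagedStress]
  simp only [Fintype.sum_prod_type, ddot, stress, Matrix.of_apply, Finset.mul_sum, Finset.sum_mul]
  refine Finset.sum_congr rfl fun i _ => Finset.sum_congr rfl fun j _ =>
    Finset.sum_congr rfl fun k _ => Finset.sum_congr rfl fun l _ => by ring

/-- The elasticity tensor is symmetric as a bilinear form. -/
theorem Admissible.sum_elasticity_comm (hP : P.Admissible) {x : Pt (n + 1)} (hx : x ∈ P.Ω)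
    (a b : Tensor (n + 1)) :
    ∑ i, ∑ j, (∑ k, ∑ l, P.C x i j k l * a k l) * b i j =
      ∑ i, ∑ j, (∑ k, ∑ l, P.C x i j k l * b k l) * a i j := by
  have h : ∀ a b : Tensor (n + 1), ∑ i, ∑ j, (∑ k, ∑ l, P.C x i j k l * a k l) * b i j =
      ∑ p : Fin (n + 1) × Fin (n + 1), ∑ q : Fin (n + 1) × Fin (n + 1),
        P.C x p.1 p.2 q.1 q.2 * (a q.1 q.2 * b p.1 p.2) := fun a b => by
    simp only [Fintype.sum_prod_type, Finset.sum_mul, mul_assoc]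
  rw [h, h, Finset.sum_comm]
  refine Finset.sum_congr rfl fun p _ => Finset.sum_congr rfl fun q _ => ?_
  rw [(hP.elasticity_symm x hx q.1 q.2 p.1 p.2).1]
  ring

/-- For a symmetric stress only the symmetric part of a velocity gradient does work. -/
theorem Admissible.ddot_damagedStress_strain (hP : P.Admissible) {x : Pt (n + 1)} (hx : x ∈ P.Ω)
    (v w : Pt (n + 1) → Pt (n + 1)) (ζ : Pt (n + 1) → ℝ) :
    ddot (P.damagedStress v ζ x) (strain w x) =
      ∑ i, ∑ j, P.damagedStress v ζ x i j * pd j (fun y => w y i) x := by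
  have hsymm : ∀ i j, P.damagedStress v ζ x i j = P.damagedStress v ζ x j i := fun i j => by
    simp only [damagedStress, stress, Matrix.smul_apply, Matrix.of_apply]
    congr 1
    refine Finset.sum_congr rfl fun k _ => Finset.sum_congr rfl fun l _ => ?_
    rw [(hP.elasticity_symm x hx i j k l).2]
  have h1 : ∑ i, ∑ j, P.damagedStress v ζ x i j * pd i (fun y => w y j) x =
      ∑ i, ∑ j, P.damagedStress v ζ x i j * pd j (fun y => w y i) x := by
    rw [Finset.sum_comm]
    refine Finset.sum_congr rfl fun i _ => Finset.sum_congr rfl fun j _ => ?_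
    rw [hsymm]
  have h2 : ddot (P.damagedStress v ζ x) (strain w x) = (1 / 2 : ℝ) *
      (∑ i, ∑ j, P.damagedStress v ζ x i j * pd j (fun y => w y i) x +
        ∑ i, ∑ j, P.damagedStress v ζ x i j * pd i (fun y => w y j) x) := by
    simp only [ddot, strain, Matrix.of_apply, ← Finset.sum_add_distrib, Finset.mul_sum]
    refine Finset.sum_congr rfl fun i _ => Finset.sum_congr rfl fun j _ => by ring
  rw [h2, h1]; ring

theorem Admissible.hasDerivAt_W (hP : P.Admissible) {x : Pt (n + 1)} (hx : x ∈ P.Ω) {t : ℝ}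
    (h : ∀ i j, HasDerivAt (fun s => strain (u s) x i j) (strain (dt u t) x i j) t) :
    HasDerivAt (fun s => P.W (u s) x) (2 * ddot (P.stress (u t) x) (strain (dt u t) x)) t := by
  have h1 : HasDerivAt (fun s => P.W (u s) x) (∑ i, ∑ j,
      ((∑ k, ∑ l, P.C x i j k l * strain (dt u t) x k l) * strain (u t) x i j +
        (∑ k, ∑ l, P.C x i j k l * strain (u t) x k l) * strain (dt u t) x i j)) t := by
    change HasDerivAt (fun s => ∑ i, ∑ j, (∑ k, ∑ l, P.C x i j k l * strain (u s) x k l) *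
      strain (u s) x i j) _ t
    refine HasDerivAt.fun_sum fun i _ => HasDerivAt.fun_sum fun j _ => ?_
    have h2 : HasDerivAt (fun s => ∑ k, ∑ l, P.C x i j k l * strain (u s) x k l)
        (∑ k, ∑ l, P.C x i j k l * strain (dt u t) x k l) t :=
      HasDerivAt.fun_sum fun k _ => HasDerivAt.fun_sum fun l _ => (h k l).const_mul _
    exact h2.mul (h i j)
  refine h1.congr_deriv ?_
  simp only [Finset.sum_add_distrib]
  rw [hP.sum_elasticity_comm hx, two_mul]
  rfl

end Data

/-- The rate of the elastic energy. -/
theorem Data.Smooth.hasDerivAt_elastic (hs : P.Smooth u z) (hP : P.Admissible) {t : ℝ}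
    (ht : t ∈ Ioo 0 P.T) (hreg : ∀ᵐ x ∂volume.restrict P.Ω, ∀ i j,
      HasDerivAt (fun s => strain (u s) x i j) (strain (dt u t) x i j) t) :
    HasDerivAt (fun s => ∫ x in P.Ω, ddot (P.damagedStress (u s) (z s) x) (strain (u s) x))
      (∫ x in P.Ω, 2 * (ddot (P.damagedStress (u t) (z t) x) (strain (dt u t) x) -
        dt z t x * ((1 - z t x) * P.W (u t) x))) t := by
  have hc : ∀ k : (Fin (n + 1) × Fin (n + 1)) × (Fin (n + 1) × Fin (n + 1)),
      LocallyLipschitz fun p : ℝ × Pt (n + 1) => (1 - z p.1 p.2) ^ 2 *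
        (strain (u p.1) p.2 k.2.1 k.2.2 * strain (u p.1) p.2 k.1.1 k.1.2) := fun k =>
    locallyLipschitz_mul hs.locallyLipschitz_one_sub_sq
      (locallyLipschitz_mul (hs.locallyLipschitz_strain _ _) (hs.locallyLipschitz_strain _ _))
  have h0 := fun F' => hP.domain.hasDerivAt_setIntegral_sum (F' := F')
    (fun k : (Fin (n + 1) × Fin (n + 1)) × (Fin (n + 1) × Fin (n + 1)) =>
      hP.elasticity_bounded k.1.1 k.1.2 k.2.1 k.2.2) hc ht
  simp only [← P.ddot_damagedStress_eq_sum] at h0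
  refine (h0 _ ?_).2
  filter_upwards [hreg, ae_restrict_mem hP.domain.isOpen.measurableSet] with x hx hxΩ
  simp_rw [P.ddot_damagedStress]
  have h1 := (hs.isC11_z.hasDerivAt_dt t x).const_sub 1
  refine ((h1.fun_pow 2).mul (hP.hasDerivAt_W hxΩ hx)).congr_deriv ?_
  simp only [Data.W]
  push_cast
  ring

/-- The rate of the kinetic energy. -/
theorem Data.Smooth.hasDerivAt_kinetic (hs : P.Smooth u z) (hP : P.Admissible) {t : ℝ}
    (ht : t ∈ Ioo 0 P.T) (hreg : ∀ᵐ x ∂volume.restrict P.Ω,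
      HasDerivAt (fun s => dt u s x) (dt (dt u) t x) t) :
    HasDerivAt (fun s => ∫ x in P.Ω, ‖dt u s x‖ ^ 2)
      (∫ x in P.Ω, 2 * ⟪dt (dt u) t x, dt u t x⟫_ℝ) t := by
  have h1 : ∀ s x, ‖dt u s x‖ ^ 2 = ∑ i, 1 * (dt u s x i * dt u s x i) := fun s x => by
    rw [EuclideanSpace.real_norm_sq_eq]; simp [sq]
  simp_rw [h1]
  have hl : ∀ i, LocallyLipschitz fun p : ℝ × Pt (n + 1) => dt u p.1 p.2 i := fun i => by
    simp_rw [hs.dt_u_apply]; exact (hs.isC11_u i).locallyLipschitz_dt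
  refine (hP.domain.hasDerivAt_setIntegral_sum (b := fun _ _ => (1 : ℝ))
    (c := fun i p => dt u p.1 p.2 i * dt u p.1 p.2 i)
    (fun _ => hP.domain.memLp_top_of_continuousOn continuousOn_const)
    (fun i => locallyLipschitz_mul (hl i) (hl i)) ht ?_).2
  filter_upwards [hreg] with x hx
  simp_rw [← h1]
  refine hx.norm_sq.congr_deriv ?_
  rw [real_inner_comm]

/-- The rate of the surface energy of the crack. -/
theorem Data.Smooth.hasDerivAt_crack (hs : P.Smooth u z) (hP : P.Admissible) {t : ℝ}
    (ht : t ∈ Ioo 0 P.T) (hreg : ∀ᵐ x ∂volume.restrict P.Ω, ∀ j,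
      HasDerivAt (fun s => pd j (z s) x) (pd j (dt z t) x) t) :
    HasDerivAt (fun s => ∫ x in P.Ω, P.γ x * (P.ε * ‖gradient (z s) x‖ ^ 2 + z s x ^ 2 / P.ε))
      (∫ x in P.Ω, 2 * (P.ε * (∑ j, P.flux (z t) x j * pd j (dt z t) x) +
        P.γ x / P.ε * z t x * dt z t x)) t := by
  have h1 : ∀ s x, P.γ x * (P.ε * ‖gradient (z s) x‖ ^ 2 + z s x ^ 2 / P.ε) =
      ∑ _k : Unit, P.γ x * (P.ε * (∑ j, pd j (z s) x * pd j (z s) x) +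
        (1 / P.ε) * (z s x * z s x)) := fun s x => by
    rw [EuclideanSpace.real_norm_sq_eq]
    simp only [gradient_apply, Finset.univ_unique, Finset.sum_const, Finset.card_singleton,
      one_smul, sq]
    ring
  simp_rw [h1]
  refine (hP.domain.hasDerivAt_setIntegral_sum (ι := Unit) (b := fun _ => P.γ)
    (c := fun _ p => P.ε * (∑ j, pd j (z p.1) p.2 * pd j (z p.1) p.2) +
      (1 / P.ε) * (z p.1 p.2 * z p.1 p.2)) (fun _ => hP.toughness_bounded) (fun _ => ?_) ht ?_).2
  · refine (locallyLipschitz_mul (LocallyLipschitz.const _) (locallyLipschitz_finsetSum _ fun j =>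
      locallyLipschitz_mul (hs.isC11_z.locallyLipschitz_pd j)
        (hs.isC11_z.locallyLipschitz_pd j))).add
      (locallyLipschitz_mul (LocallyLipschitz.const _)
        (locallyLipschitz_mul hs.isC11_z.locallyLipschitz hs.isC11_z.locallyLipschitz))
  · filter_upwards [hreg] with x hx
    have hz := hs.isC11_z.hasDerivAt_dt t x
    have h2 : HasDerivAt (fun s => ∑ j, pd j (z s) x * pd j (z s) x)
        (∑ j, (pd j (dt z t) x * pd j (z t) x + pd j (z t) x * pd j (dt z t) x)) t :=
      HasDerivAt.fun_sum fun j _ => (hx j).mul (hx j)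
    simp only [Finset.univ_unique, Finset.sum_const, Finset.card_singleton, one_smul]
    refine (((h2.const_mul P.ε).add ((hz.mul hz).const_mul (1 / P.ε))).const_mul
      (P.γ x)).congr_deriv ?_
    have h3 : ∑ j, (pd j (dt z t) x * pd j (z t) x + pd j (z t) x * pd j (dt z t) x) =
        2 * ∑ j, pd j (z t) x * pd j (dt z t) x := by
      rw [Finset.mul_sum]
      exact Finset.sum_congr rfl fun j _ => by ring
    have h4 : ∑ j, P.flux (z t) x j * pd j (dt z t) x =
        P.γ x * ∑ j, pd j (z t) x * pd j (dt z t) x := by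
      rw [Finset.mul_sum]
      refine Finset.sum_congr rfl fun j _ => ?_
      rw [Data.flux, PiLp.smul_apply, gradient_apply, smul_eq_mul, mul_assoc]
    rw [h3, h4]
    ring

end BulkRates

/-! ### Work of the volume force and regularity of the stress up to the boundary -/

section ForceRates

variable {n : ℕ} {P : Data (n + 1)} {u : ℝ → Pt (n + 1) → Pt (n + 1)} {z : ℝ → Pt (n + 1) → ℝ}

theorem abs_inner_sub_inner_le {E : Type*} [NormedAddCommGroup E] [InnerProductSpace ℝ E]
    (a a' b b' : E) : |⟪a, b⟫_ℝ - ⟪a', b'⟫_ℝ| ≤ ‖a‖ * ‖b - b'‖ + ‖a - a'‖ * ‖b'‖ := by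
  have h : ⟪a, b⟫_ℝ - ⟪a', b'⟫_ℝ = ⟪a, b - b'⟫_ℝ + ⟪a - a', b'⟫_ℝ := by
    rw [inner_sub_right, inner_sub_left]; ring
  rw [h]
  exact (abs_add_le _ _).trans (add_le_add (abs_real_inner_le_norm _ _) (abs_real_inner_le_norm _ _))

theorem exists_ae_abs_le_of_memLp_top {X : Type*} [MeasurableSpace X] {μ : Measure X} {f : X → ℝ}
    (hf : MemLp f ∞ μ) : ∃ M : ℝ, ∀ᵐ x ∂μ, |f x| ≤ M := by
  have hfin : eLpNormEssSup f μ ≠ ∞ := by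
    rw [← eLpNorm_exponent_top]; exact hf.2.ne
  refine ⟨(eLpNormEssSup f μ).toReal, ?_⟩
  filter_upwards [ae_le_eLpNormEssSup (f := f) (μ := μ)] with x hx
  simpa using ENNReal.toReal_mono hfin hx

theorem Data.Admissible.ae_differentiableAt_force (hP : P.Admissible) :
    ∀ᵐ t ∂volume.restrict (Ioo 0 P.T), ∀ᵐ x ∂volume.restrict P.Ω,
      DifferentiableAt ℝ (fun s => P.f s x) t := by
  obtain ⟨k, hk, hf⟩ := hP.force_lipschitz
  have h : ∀ i, ∀ᵐ t ∂volume.restrict (Ioo 0 P.T), ∀ᵐ x ∂volume.restrict P.Ω,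
      DifferentiableAt ℝ (fun s => P.f s x i) t := by
    intro i
    refine ae_ae_differentiableAt_of_lipschitzOnWith (F := fun s x => P.f s x i) (fun s _ => ?_) ?_
    · have h1 : Measurable (P.f s) := hP.force_measurable.comp measurable_prodMk_left
      exact ((EuclideanSpace.proj i : Pt (n + 1) →L[ℝ] ℝ).continuous.measurable.comp
        h1).aestronglyMeasurable
    · filter_upwards [hf] with x hx
      refine ⟨Real.nnabs (k x), LipschitzOnWith.of_dist_le_mul fun s hs t ht => ?_⟩
      rw [Real.coe_nnabs, Real.dist_eq, Real.dist_eq]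
      have h1 : |P.f s x i - P.f t x i| ≤ ‖P.f s x - P.f t x‖ :=
        PiLp.norm_apply_le (P.f s x - P.f t x) i
      exact (h1.trans (hx s hs t ht)).trans (by gcongr; exact le_abs_self _)
  filter_upwards [ae_all_iff.2 h] with t ht
  filter_upwards [ae_all_iff.2 ht] with x hx
  exact differentiableAt_euclidean.2 hx

theorem Data.Smooth.exists_bounds_u (hs : P.Smooth u z) {s : Set (Pt (n + 1))} (hsc : IsCompact s) :
    ∃ M L : ℝ≥0, ∀ x ∈ s, ∀ t ∈ Icc 0 P.T, ‖u t x‖ ≤ M ∧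
      ∀ r ∈ Icc 0 P.T, ‖u t x - u r x‖ ≤ L * |t - r| := by
  obtain ⟨L, hL⟩ := exists_norm_sub_le_of_locallyLipschitz hsc hs.contDiff_u.locallyLipschitz P.T
  obtain ⟨M, hM⟩ := (isCompact_Icc.prod hsc).exists_bound_of_continuousOn (s := Icc 0 P.T ×ˢ s)
    hs.contDiff_u.continuous.continuousOn
  exact ⟨Real.nnabs M, L, fun x hx t ht => ⟨(hM (t, x) ⟨ht, hx⟩).trans (le_abs_self M),
    hL x hx t ht⟩⟩

theorem Data.Smooth.continuous_u (hs : P.Smooth u z) (t : ℝ) : Continuous (u t) :=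
  hs.contDiff_u.continuous.comp (Continuous.prodMk_right t)

theorem Data.Smooth.continuous_dt_u_vec (hs : P.Smooth u z) (t : ℝ) : Continuous (dt u t) :=
  (PiLp.continuous_toLp 2 _).comp (continuous_pi fun i => hs.continuous_dt_u t i)

/-- The rate of the work of the volume force. -/
theorem Data.Smooth.hasDerivAt_force (hs : P.Smooth u z) (hP : P.Admissible) {t : ℝ}
    (ht : t ∈ Ioo 0 P.T)
    (hreg : ∀ᵐ x ∂volume.restrict P.Ω, DifferentiableAt ℝ (fun s => P.f s x) t) :
    Integrable (fun x => ⟪P.f t x, dt u t x⟫_ℝ) (volume.restrict P.Ω) ∧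
      HasDerivAt (fun s => ∫ x in P.Ω, ⟪P.f s x, u s x⟫_ℝ)
        ((∫ x in P.Ω, ⟪P.f t x, dt u t x⟫_ℝ) + ∫ x in P.Ω, ⟪dt P.f t x, u t x⟫_ℝ) t := by
  have := hP.domain.isFiniteMeasure_restrict
  have hΩm := hP.domain.isOpen.measurableSet
  obtain ⟨k, hk, hf⟩ := hP.force_lipschitz
  obtain ⟨M, L, hML⟩ := hs.exists_bounds_u hP.domain.isCompact_closure
  have htI : t ∈ Icc 0 P.T := Ioo_subset_Icc_self ht
  have hfm : ∀ s, AEStronglyMeasurable (P.f s) (volume.restrict P.Ω) := fun s =>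
    (hP.force_measurable.comp measurable_prodMk_left).aestronglyMeasurable
  have hfi : Integrable (P.f t) (volume.restrict P.Ω) :=
    (hP.force_memLp t htI).integrable one_le_two
  have hki : Integrable k (volume.restrict P.Ω) := hk.integrable one_le_two
  have hinner : ∀ {v : Pt (n + 1) → Pt (n + 1)}, Continuous v →
      Integrable (fun x => ⟪P.f t x, v x⟫_ℝ) (volume.restrict P.Ω) := fun {v} hv => by
    obtain ⟨C, hC⟩ := hP.domain.isCompact_closure.exists_bound_of_continuousOn hv.continuousOn
    refine (hfi.norm.mul_const C).mono' ((hfm t).inner hv.aestronglyMeasurable) ?_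
    filter_upwards [ae_restrict_mem hΩm] with x hx
    refine (norm_inner_le_norm _ _).trans ?_
    gcongr
    exact hC x (subset_closure hx)
  have h1 := hasDerivAt_integral_of_abs_sub_le (μ := volume.restrict P.Ω)
    (F := fun s x => ⟪P.f s x, u s x⟫_ℝ)
    (F' := fun x => ⟪P.f t x, dt u t x⟫_ℝ + ⟪dt P.f t x, u t x⟫_ℝ)
    (B := fun x => (‖P.f t x‖ + |k x| * P.T) * L + |k x| * M)
    (Icc_mem_nhds ht.1 ht.2) (fun s _ => (hfm s).inner (hs.continuous_u s).aestronglyMeasurable)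
    (hinner (hs.continuous_u t)) ?_ ?_ ?_
  · have hi := hinner (hs.continuous_dt_u_vec t)
    refine ⟨hi, ?_⟩
    rw [← integral_add hi]
    · exact h1.2
    · refine (h1.1.sub hi).congr (Eventually.of_forall fun x => ?_)
      simp
  · exact ((hfi.norm.add (hki.abs.mul_const _)).mul_const _).add (hki.abs.mul_const _)
  · filter_upwards [hf, ae_restrict_mem hΩm] with x hx hxΩ s hsI r hrI
    have hu := hML x (subset_closure hxΩ)
    have hkx : ∀ s ∈ Icc 0 P.T, ∀ r ∈ Icc 0 P.T, ‖P.f s x - P.f r x‖ ≤ |k x| * |s - r| :=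
      fun s hs r hr => (hx s hs r hr).trans (by gcongr; exact le_abs_self _)
    have hst : |s - t| ≤ P.T := by
      rw [abs_le]; constructor <;> linarith [hsI.1, hsI.2, htI.1, htI.2]
    have hfs : ‖P.f s x‖ ≤ ‖P.f t x‖ + |k x| * P.T := by
      have h2 := norm_le_norm_add_norm_sub' (P.f s x) (P.f t x)
      have h3 := hkx s hsI t htI
      have h4 : |k x| * |s - t| ≤ |k x| * P.T := by gcongr
      linarith
    calc _ ≤ ‖P.f s x‖ * ‖u s x - u r x‖ + ‖P.f s x - P.f r x‖ * ‖u r x‖ :=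
          abs_inner_sub_inner_le _ _ _ _
      _ ≤ (‖P.f t x‖ + |k x| * P.T) * (L * |s - r|) + (|k x| * |s - r|) * M := by
          gcongr
          · exact (norm_nonneg _).trans hfs
          · exact (hu s hsI).2 r hrI
          · exact hkx s hsI r hrI
          · exact (hu r hrI).1
      _ = _ := by ring
  · filter_upwards [hreg] with x hx
    exact hx.hasDerivAt.inner ℝ (hs.hasDerivAt_u t x)

/-- The damaged stress is uniformly Lipschitz in time up to the boundary. Inside the domain this
follows from the bound on the elasticity tensor; the tensor need not be bounded on the boundary,
but there the estimate persists by the continuity of the stress in space. -/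
theorem Data.Smooth.exists_abs_damagedStress_sub_le (hs : P.Smooth u z) (hP : P.Admissible)
    (i j : Fin (n + 1)) : ∃ L : ℝ, ∀ s ∈ Icc 0 P.T, ∀ r ∈ Icc 0 P.T, ∀ x ∈ closure P.Ω,
      |P.damagedStress (u s) (z s) x i j - P.damagedStress (u r) (z r) x i j| ≤ L * |s - r| := by
  have hbd : ∀ k l, ∃ M : ℝ, ∀ᵐ x ∂volume.restrict P.Ω, |P.C x i j k l| ≤ M := fun k l =>
    exists_ae_abs_le_of_memLp_top (hP.elasticity_bounded i j k l)
  choose M hM using hbd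
  choose L hL using fun k l => exists_norm_sub_le_of_locallyLipschitz
    hP.domain.isCompact_closure (locallyLipschitz_mul hs.locallyLipschitz_one_sub_sq
      (hs.locallyLipschitz_strain k l)) P.T
  refine ⟨∑ k, ∑ l, M k l * L k l, fun s hsI r hrI x hx => ?_⟩
  have hc : ∀ t ∈ Icc 0 P.T, ContinuousOn (fun x => P.damagedStress (u t) (z t) x i j)
      (closure P.Ω) := fun t ht => (hs.stress t ht i j).choose_spec.continuousOn
  refine le_of_ae_le_of_mem_closure (μ := volume) hP.domain.isOpen hP.domain.isOpen.measurableSet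
    ((hc s hsI).sub (hc r hrI)).abs continuousOn_const ?_ hx
  have hM' : ∀ᵐ x ∂volume.restrict P.Ω, ∀ k l, |P.C x i j k l| ≤ M k l :=
    ae_all_iff.2 fun k => ae_all_iff.2 fun l => hM k l
  filter_upwards [hM', ae_restrict_mem hP.domain.isOpen.measurableSet] with y hy hyΩ
  have h1 : ∀ t, P.damagedStress (u t) (z t) y i j =
      ∑ k, ∑ l, P.C y i j k l * ((1 - z t y) ^ 2 * strain (u t) y k l) := fun t => by
    simp only [Data.damagedStress, Data.stress, Matrix.smul_apply, Matrix.of_apply, smul_eq_mul,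
      Finset.mul_sum]
    exact Finset.sum_congr rfl fun k _ => Finset.sum_congr rfl fun l _ => by ring
  change |P.damagedStress (u s) (z s) y i j - P.damagedStress (u r) (z r) y i j| ≤ _
  rw [h1, h1]
  simp only [← Finset.sum_sub_distrib, Finset.sum_mul]
  refine (Finset.abs_sum_le_sum_abs _ _).trans (Finset.sum_le_sum fun k _ => ?_)
  refine (Finset.abs_sum_le_sum_abs _ _).trans (Finset.sum_le_sum fun l _ => ?_)
  rw [← mul_sub, abs_mul, mul_assoc]
  exact mul_le_mul (hy k l) (hL k l y (subset_closure hyΩ) s hsI r hrI) (abs_nonneg _)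
    ((abs_nonneg _).trans (hy k l))

end ForceRates

/-! ### Work of the surface force -/

section Boundary

variable {n : ℕ} {P : Data (n + 1)} {u : ℝ → Pt (n + 1) → Pt (n + 1)} {z : ℝ → Pt (n + 1) → ℝ}

theorem inner_tapply {d : ℕ} (S : Tensor d) (m v : Pt d) :
    ⟪tapply S m, v⟫_ℝ = ∑ i, ∑ j, S i j * v i * m j := by
  rw [PiLp.inner_apply]
  refine Finset.sum_congr rfl fun i _ => ?_
  simp only [tapply, RCLike.inner_apply, conj_trivial, Finset.mul_sum]
  exact Finset.sum_congr rfl fun j _ => by ring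

theorem IsBoundedLipschitzDomain.integrable_mul_outwardNormal {Ω : Set (Pt (n + 1))}
    (hΩ : IsBoundedLipschitzDomain Ω) {g : Pt (n + 1) → ℝ} (hg : ContinuousOn g (frontier Ω))
    (j : Fin (n + 1)) :
    Integrable (fun y => g y * outwardNormal Ω y j) ((surface (n + 1)).restrict (frontier Ω)) := by
  have h := hΩ.integrable_mul_inner_outwardNormal hg (EuclideanSpace.single j 1)
  simpa [EuclideanSpace.inner_single_right] using h

namespace Data.Smooth

theorem continuousOn_damagedStress (hs : P.Smooth u z) {t : ℝ} (ht : t ∈ Icc 0 P.T)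
    (i j : Fin (n + 1)) :
    ContinuousOn (fun x => P.damagedStress (u t) (z t) x i j) (closure P.Ω) :=
  (hs.stress t ht i j).choose_spec.continuousOn

theorem integrable_boundary_work (hs : P.Smooth u z) (hP : P.Admissible) {t : ℝ}
    (ht : t ∈ Icc 0 P.T) {v : Pt (n + 1) → Pt (n + 1)} (hv : Continuous v) :
    Integrable (fun x => ⟪tapply (P.damagedStress (u t) (z t) x) (outwardNormal P.Ω x), v x⟫_ℝ)
      ((surface (n + 1)).restrict (frontier P.Ω)) := by
  simp_rw [inner_tapply]
  refine integrable_finsetSum _ fun i _ => integrable_finsetSum _ fun j _ => ?_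
  refine hP.domain.integrable_mul_outwardNormal (((hs.continuousOn_damagedStress ht i j).mono
    frontier_subset_closure).mul ?_) j
  exact ((EuclideanSpace.proj i : Pt (n + 1) →L[ℝ] ℝ).continuous.comp hv).continuousOn

theorem ae_differentiableAt_damagedStress (hs : P.Smooth u z) (hP : P.Admissible) :
    ∀ᵐ t ∂volume.restrict (Ioo 0 P.T), ∀ᵐ x ∂(surface (n + 1)).restrict (frontier P.Ω),
      ∀ i j, DifferentiableAt ℝ (fun s => P.damagedStress (u s) (z s) x i j) t := by
  have := hP.domain.isFiniteMeasure_surface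
  have hfm : MeasurableSet (frontier P.Ω) := isClosed_frontier.measurableSet
  have h : ∀ i j, ∀ᵐ t ∂volume.restrict (Ioo 0 P.T),
      ∀ᵐ x ∂(surface (n + 1)).restrict (frontier P.Ω),
        DifferentiableAt ℝ (fun s => P.damagedStress (u s) (z s) x i j) t := by
    intro i j
    obtain ⟨L, hL⟩ := hs.exists_abs_damagedStress_sub_le hP i j
    refine ae_ae_differentiableAt_of_lipschitzOnWith
      (F := fun s x => P.damagedStress (u s) (z s) x i j) (fun s hsI => ?_) ?_
    · exact ((hs.continuousOn_damagedStress hsI i j).mono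
        frontier_subset_closure).aestronglyMeasurable hfm
    · filter_upwards [ae_restrict_mem hfm] with x hx
      refine ⟨Real.nnabs L, LipschitzOnWith.of_dist_le_mul fun s hsI t htI => ?_⟩
      rw [Real.coe_nnabs, Real.dist_eq, Real.dist_eq]
      exact (hL s hsI t htI x (frontier_subset_closure hx)).trans (by gcongr; exact le_abs_self _)
  have h' := ae_all_iff.2 fun i => ae_all_iff.2 fun j => h i j
  filter_upwards [h'] with t ht
  exact ae_all_iff.2 fun i => ae_all_iff.2 fun j => ht i j

/-- The rate of the work of the surface force. On `Γ_N` the force is the traction `σ ν`, which is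
differentiable in time almost everywhere by the regularity of the stress. -/
theorem hasDerivAt_surfaceForce (hs : P.Smooth u z) (hP : P.Admissible) (hsol : P.IsSolution u z)
    {t : ℝ} (ht : t ∈ Ioo 0 P.T)
    (hreg : ∀ᵐ x ∂(surface (n + 1)).restrict (frontier P.Ω),
      ∀ i j, DifferentiableAt ℝ (fun s => P.damagedStress (u s) (z s) x i j) t) :
    HasDerivAt (fun s => ∫ x in P.ΓN, ⟪P.q s x, u s x⟫_ℝ ∂surface (n + 1))
      ((∫ x in P.ΓN, ⟪tapply (P.damagedStress (u t) (z t) x) (outwardNormal P.Ω x),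
          dt u t x⟫_ℝ ∂surface (n + 1)) +
        ∫ x in P.ΓN, ⟪dt P.q t x, u t x⟫_ℝ ∂surface (n + 1)) t := by
  have hfin := hP.domain.isFiniteMeasure_surface
  have htI : t ∈ Icc 0 P.T := Ioo_subset_Icc_self ht
  have hsub : P.ΓN ⊆ frontier P.Ω := hP.union ▸ subset_union_right
  have hle : (surface (n + 1)).restrict P.ΓN ≤ (surface (n + 1)).restrict (frontier P.Ω) :=
    Measure.restrict_mono_set _ hsub
  have : IsFiniteMeasure ((surface (n + 1)).restrict P.ΓN) := isFiniteMeasure_of_le _ hle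
  have hn : ∀ᵐ x ∂(surface (n + 1)).restrict P.ΓN, x ∈ P.ΓN ∧
      IsOutwardNormal P.Ω x (outwardNormal P.Ω x) :=
    (ae_restrict_mem hP.measurable_ΓN).and (ae_mono hle hP.domain.ae_isOutwardNormal)
  have hq : ∀ᵐ x ∂(surface (n + 1)).restrict P.ΓN, ∀ s ∈ Icc 0 P.T,
      P.q s x = tapply (P.damagedStress (u s) (z s) x) (outwardNormal P.Ω x) := by
    filter_upwards [hn] with x hx s hsI
    exact (hsol.neumann s hsI x hx.1 _ hx.2).symm
  have hint : ∀ s ∈ Icc 0 P.T, ∀ {v : Pt (n + 1) → Pt (n + 1)}, Continuous v → Integrable (fun x =>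
      ⟪tapply (P.damagedStress (u s) (z s) x) (outwardNormal P.Ω x), v x⟫_ℝ)
      ((surface (n + 1)).restrict P.ΓN) := fun s hsI v hv =>
    (hs.integrable_boundary_work hP hsI hv).mono_measure hle
  have hintq : ∀ s ∈ Icc 0 P.T, Integrable (fun x => ⟪P.q s x, u s x⟫_ℝ)
      ((surface (n + 1)).restrict P.ΓN) := fun s hsI =>
    (hint s hsI (hs.continuous_u s)).congr (by filter_upwards [hq] with x hx; rw [hx s hsI])
  obtain ⟨M, L, hML⟩ := hs.exists_bounds_u hP.domain.isCompact_closure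
  choose A hA using hs.exists_abs_damagedStress_sub_le hP
  choose C hC using fun i j => hP.domain.isCompact_closure.exists_bound_of_continuousOn
    (hs.continuousOn_damagedStress htI i j)
  have h1 := hasDerivAt_integral_of_abs_sub_le (μ := (surface (n + 1)).restrict P.ΓN)
    (F := fun s x => ⟪P.q s x, u s x⟫_ℝ)
    (F' := fun x => ⟪P.q t x, dt u t x⟫_ℝ + ⟪dt P.q t x, u t x⟫_ℝ)
    (B := fun _ => ∑ i, ∑ j, ((|C i j| + |A i j| * P.T) * L + |A i j| * M))
    (Icc_mem_nhds ht.1 ht.2) (fun s hsI => (hintq s hsI).aestronglyMeasurable) (hintq t htI)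
    (integrable_const _) ?_ ?_
  · have hi := hint t htI (hs.continuous_dt_u_vec t)
    rw [← integral_add hi]
    · refine h1.2.congr_deriv (integral_congr_ae ?_)
      filter_upwards [hq] with x hx
      rw [hx t htI]
    · refine (h1.1.sub hi).congr ?_
      filter_upwards [hq] with x hx
      simp [hx t htI]
  · filter_upwards [hq, hn] with x hx hxn s hsI r hrI
    have hxc : x ∈ closure P.Ω := frontier_subset_closure (hsub hxn.1)
    have hσ := fun i j => hA i j s hsI r hrI x hxc
    have hst : |s - t| ≤ P.T := by
      rw [abs_le]; constructor <;> linarith [hsI.1, hsI.2, htI.1, htI.2]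
    have hν : ∀ j, |outwardNormal P.Ω x j| ≤ 1 := fun j =>
      hxn.2.1 ▸ PiLp.norm_apply_le (outwardNormal P.Ω x) j
    rw [hx s hsI, hx r hrI, inner_tapply, inner_tapply]
    simp only [← Finset.sum_sub_distrib, Finset.sum_mul]
    refine (Finset.abs_sum_le_sum_abs _ _).trans (Finset.sum_le_sum fun i _ => ?_)
    refine (Finset.abs_sum_le_sum_abs _ _).trans (Finset.sum_le_sum fun j _ => ?_)
    have hσs : |P.damagedStress (u s) (z s) x i j| ≤ |C i j| + |A i j| * P.T := by
      have h2 := abs_sub_abs_le_abs_sub (P.damagedStress (u s) (z s) x i j)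
        (P.damagedStress (u t) (z t) x i j)
      have h3 := hA i j s hsI t htI x hxc
      have h4 : A i j * |s - t| ≤ |A i j| * P.T :=
        mul_le_mul (le_abs_self _) hst (abs_nonneg _) (abs_nonneg _)
      have h5 : |P.damagedStress (u t) (z t) x i j| ≤ |C i j| :=
        (hC i j x hxc).trans (le_abs_self _)
      linarith
    have hus : |u s x i - u r x i| ≤ L * |s - r| :=
      (PiLp.norm_apply_le (u s x - u r x) i).trans ((hML x hxc s hsI).2 r hrI)
    have hur : |u r x i| ≤ M := (PiLp.norm_apply_le (u r x) i).trans (hML x hxc r hrI).1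
    have hsr : |P.damagedStress (u s) (z s) x i j - P.damagedStress (u r) (z r) x i j| ≤
        |A i j| * |s - r| := (hσ i j).trans (by gcongr; exact le_abs_self _)
    have h6 : P.damagedStress (u s) (z s) x i j * u s x i * outwardNormal P.Ω x j -
        P.damagedStress (u r) (z r) x i j * u r x i * outwardNormal P.Ω x j =
        (P.damagedStress (u s) (z s) x i j * (u s x i - u r x i) +
        (P.damagedStress (u s) (z s) x i j - P.damagedStress (u r) (z r) x i j) * u r x i) *
        outwardNormal P.Ω x j := by ring
    rw [h6, abs_mul]
    calc _ ≤ |P.damagedStress (u s) (z s) x i j * (u s x i - u r x i) +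
        (P.damagedStress (u s) (z s) x i j - P.damagedStress (u r) (z r) x i j) * u r x i| * 1 := by
          gcongr; exact hν j
      _ ≤ |P.damagedStress (u s) (z s) x i j| * |u s x i - u r x i| +
        |P.damagedStress (u s) (z s) x i j - P.damagedStress (u r) (z r) x i j| * |u r x i| := by
          rw [mul_one, ← abs_mul, ← abs_mul]; exact abs_add_le _ _
      _ ≤ (|C i j| + |A i j| * P.T) * (L * |s - r|) + |A i j| * |s - r| * M := by
          gcongr
          exact (abs_nonneg _).trans hσs
      _ = _ := by ring
  · filter_upwards [hq, ae_mono hle hreg] with x hx hxd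
    have hqd : DifferentiableAt ℝ (fun s => P.q s x) t := by
      have h2 : DifferentiableAt ℝ (fun s => tapply (P.damagedStress (u s) (z s) x)
          (outwardNormal P.Ω x)) t := by
        refine differentiableAt_euclidean.2 fun i => ?_
        simp only [tapply]
        exact DifferentiableAt.fun_sum fun j _ => (hxd i j).mul_const _
      refine h2.congr_of_eventuallyEq ?_
      filter_upwards [Icc_mem_nhds ht.1 ht.2] with s hsI using hx s hsI
    exact hqd.hasDerivAt.inner ℝ (hs.hasDerivAt_u t x)

end Data.Smooth

end Boundary

/-! ### Gauss–Green formulas for the stress and for the flux -/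

section Divergence

variable {n : ℕ} {Ω : Set (Pt (n + 1))}

namespace IsBoundedLipschitzDomain

theorem integrable_sum_mul_pd (hΩ : IsBoundedLipschitzDomain Ω) {w : Pt (n + 1) → Pt (n + 1)}
    {g : Pt (n + 1) → ℝ} {L : ℝ≥0}
    (hw : ∀ j, ∃ K : ℝ≥0, LipschitzOnWith K (fun x => w x j) (closure Ω))
    (hg : LipschitzOnWith L g (closure Ω)) :
    Integrable (fun x => ∑ j, w x j * pd j g x) (volume.restrict Ω) := by
  refine integrable_finsetSum _ fun j _ => ?_
  obtain ⟨K, hK⟩ := hw j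
  exact hΩ.integrable_of_memLp_top ((hΩ.memLp_pd (hg.mono subset_closure) j).mul'
    (hΩ.memLp_top_of_continuousOn hK.continuousOn))

theorem integrable_vdiv_mul (hΩ : IsBoundedLipschitzDomain Ω) {w : Pt (n + 1) → Pt (n + 1)}
    {g : Pt (n + 1) → ℝ} {L : ℝ≥0}
    (hw : ∀ j, ∃ K : ℝ≥0, LipschitzOnWith K (fun x => w x j) (closure Ω))
    (hg : LipschitzOnWith L g (closure Ω)) :
    Integrable (fun x => vdiv w x * g x) (volume.restrict Ω) := by
  simp only [vdiv, Finset.sum_mul]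
  refine integrable_finsetSum _ fun j _ => ?_
  obtain ⟨K, hK⟩ := hw j
  exact hΩ.integrable_of_memLp_top ((hΩ.memLp_top_of_continuousOn hg.continuousOn).mul'
    (hΩ.memLp_pd (hK.mono subset_closure) j))

/-- The Gauss–Green formula for a vector field times a scalar field. -/
theorem setIntegral_vdiv_mul (hΩ : IsBoundedLipschitzDomain Ω) {w : Pt (n + 1) → Pt (n + 1)}
    {g : Pt (n + 1) → ℝ} {L : ℝ≥0}
    (hw : ∀ j, ∃ K : ℝ≥0, LipschitzOnWith K (fun x => w x j) (closure Ω))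
    (hg : LipschitzOnWith L g (closure Ω)) :
    ∫ x in Ω, vdiv w x * g x =
      (∫ x in frontier Ω, ⟪w x, outwardNormal Ω x⟫_ℝ * g x ∂surface (n + 1)) -
        ∫ x in Ω, ∑ j, w x j * pd j g x := by
  choose K hK using hw
  have h1 : ∀ x, ⟪w x, outwardNormal Ω x⟫_ℝ * g x = ∑ j, w x j * g x * outwardNormal Ω x j :=
    fun x => by
      rw [PiLp.inner_apply, Finset.sum_mul]
      refine Finset.sum_congr rfl fun j _ => ?_
      simp only [RCLike.inner_apply, conj_trivial]
      ring
  simp only [h1, vdiv, Finset.sum_mul]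
  rw [integral_finsetSum, integral_finsetSum, integral_finsetSum, ← Finset.sum_sub_distrib]
  · exact Finset.sum_congr rfl fun j _ => hΩ.setIntegral_pd_mul (hK j) hg j
  · exact fun j _ => hΩ.integrable_of_memLp_top ((hΩ.memLp_pd (hg.mono subset_closure) j).mul'
      (hΩ.memLp_top_of_continuousOn (hK j).continuousOn))
  · exact fun j _ => hΩ.integrable_mul_outwardNormal
      (((hK j).continuousOn.mul hg.continuousOn).mono frontier_subset_closure) j
  · exact fun j _ => hΩ.integrable_of_memLp_top
      ((hΩ.memLp_top_of_continuousOn hg.continuousOn).mul'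
        (hΩ.memLp_pd ((hK j).mono subset_closure) j))

end IsBoundedLipschitzDomain

/-- The `i`-th row of a tensor field, as a vector field. -/
def row {d : ℕ} (S : Pt d → Tensor d) (i : Fin d) (x : Pt d) : Pt d := WithLp.toLp 2 (S x i)

theorem inner_tdiv {d : ℕ} (S : Pt d → Tensor d) (v : Pt d → Pt d) (x : Pt d) :
    ⟪tdiv S x, v x⟫_ℝ = ∑ i, vdiv (row S i) x * v x i := by
  rw [PiLp.inner_apply]
  refine Finset.sum_congr rfl fun i _ => ?_
  simp only [RCLike.inner_apply, conj_trivial, tdiv, vdiv, row]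
  ring

theorem inner_tapply_eq_sum_row {d : ℕ} (S : Pt d → Tensor d) (m : Pt d) (v : Pt d → Pt d)
    (x : Pt d) : ⟪tapply (S x) m, v x⟫_ℝ = ∑ i, ⟪row S i x, m⟫_ℝ * v x i := by
  rw [inner_tapply]
  refine Finset.sum_congr rfl fun i _ => ?_
  rw [PiLp.inner_apply, Finset.sum_mul]
  refine Finset.sum_congr rfl fun j _ => ?_
  simp only [RCLike.inner_apply, conj_trivial, row]
  ring

variable {P : Data (n + 1)} {u : ℝ → Pt (n + 1) → Pt (n + 1)} {z : ℝ → Pt (n + 1) → ℝ}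

namespace Data.Smooth

theorem exists_lipschitzOnWith_dt_z (hs : P.Smooth u z) (hP : P.Admissible) (t : ℝ) :
    ∃ K : ℝ≥0, LipschitzOnWith K (dt z t) (closure P.Ω) :=
  exists_lipschitzOnWith_slice hP.domain.isCompact_closure hs.isC11_z.locallyLipschitz_dt t

theorem integrable_inner_tdiv (hs : P.Smooth u z) (hP : P.Admissible) {t : ℝ}
    (ht : t ∈ Icc 0 P.T) :
    Integrable (fun x => ⟪tdiv (P.damagedStress (u t) (z t)) x, dt u t x⟫_ℝ)
      (volume.restrict P.Ω) := by
  simp only [inner_tdiv]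
  refine integrable_finsetSum _ fun i _ => ?_
  obtain ⟨L, hL⟩ := hs.exists_lipschitzOnWith_dt_u hP.domain.isCompact_closure t i
  exact hP.domain.integrable_vdiv_mul (fun j => hs.stress t ht i j) hL

theorem integrable_stress_power (hs : P.Smooth u z) (hP : P.Admissible) {t : ℝ}
    (ht : t ∈ Icc 0 P.T) :
    Integrable (fun x => ddot (P.damagedStress (u t) (z t) x) (strain (dt u t) x))
      (volume.restrict P.Ω) := by
  have h : Integrable (fun x => ∑ i, ∑ j, row (P.damagedStress (u t) (z t)) i x j *
      pd j (fun y => dt u t y i) x) (volume.restrict P.Ω) := by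
    refine integrable_finsetSum _ fun i _ => ?_
    obtain ⟨L, hL⟩ := hs.exists_lipschitzOnWith_dt_u hP.domain.isCompact_closure t i
    exact hP.domain.integrable_sum_mul_pd (fun j => hs.stress t ht i j) hL
  refine h.congr ?_
  filter_upwards [ae_restrict_mem hP.domain.isOpen.measurableSet] with x hx
  exact (hP.ddot_damagedStress_strain hx _ _ _).symm

/-- Principle of virtual work for the damaged stress and the velocity. -/
theorem setIntegral_inner_tdiv (hs : P.Smooth u z) (hP : P.Admissible) {t : ℝ}
    (ht : t ∈ Icc 0 P.T) :
    ∫ x in P.Ω, ⟪tdiv (P.damagedStress (u t) (z t)) x, dt u t x⟫_ℝ =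
      (∫ x in frontier P.Ω, ⟪tapply (P.damagedStress (u t) (z t) x) (outwardNormal P.Ω x),
        dt u t x⟫_ℝ ∂surface (n + 1)) -
        ∫ x in P.Ω, ddot (P.damagedStress (u t) (z t) x) (strain (dt u t) x) := by
  set S := P.damagedStress (u t) (z t) with hS
  choose L hL using hs.exists_lipschitzOnWith_dt_u hP.domain.isCompact_closure t
  have hrow : ∀ i j, ∃ K : ℝ≥0, LipschitzOnWith K (fun x => row S i x j) (closure P.Ω) :=
    fun i j => hs.stress t ht i j
  have h1 : ∫ x in P.Ω, ddot (S x) (strain (dt u t) x) =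
      ∫ x in P.Ω, ∑ i, ∑ j, row S i x j * pd j (fun y => dt u t y i) x :=
    setIntegral_congr_fun hP.domain.isOpen.measurableSet fun x hx =>
      hP.ddot_damagedStress_strain hx _ _ _
  simp only [h1, inner_tdiv, inner_tapply_eq_sum_row]
  rw [integral_finsetSum, integral_finsetSum, integral_finsetSum, ← Finset.sum_sub_distrib]
  · exact Finset.sum_congr rfl fun i _ => hP.domain.setIntegral_vdiv_mul (hrow i) (hL i)
  · exact fun i _ => hP.domain.integrable_sum_mul_pd (hrow i) (hL i)
  · intro i _
    simp only [PiLp.inner_apply, RCLike.inner_apply, conj_trivial, Finset.sum_mul]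
    refine integrable_finsetSum _ fun j _ => ?_
    refine (hP.domain.integrable_mul_outwardNormal (((hrow i j).choose_spec.continuousOn.mul
      (hL i).continuousOn).mono frontier_subset_closure) j).congr
      (Eventually.of_forall fun x => ?_)
    change row S i x j * dt u t x i * outwardNormal P.Ω x j = _
    ring
  · exact fun i _ => hP.domain.integrable_vdiv_mul (hrow i) (hL i)

/-- Integration by parts for the flux and the damage rate. The flux is only given on `Ω`; its
Lipschitz extension to the closure has vanishing normal component wherever `∂z/∂ν` vanishes, since
`|γ ∇z ⬝ m| ≤ M |∇z ⬝ m|` in `Ω` for every fixed vector `m` and both sides are continuous up to the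
boundary. -/
theorem setIntegral_vdiv_flux (hs : P.Smooth u z) (hP : P.Admissible) (hsol : P.IsSolution u z)
    {t : ℝ} (ht : t ∈ Icc 0 P.T) :
    Integrable (fun x => vdiv (P.flux (z t)) x * dt z t x) (volume.restrict P.Ω) ∧
    Integrable (fun x => ∑ j, P.flux (z t) x j * pd j (dt z t) x) (volume.restrict P.Ω) ∧
    ∫ x in P.Ω, vdiv (P.flux (z t)) x * dt z t x =
      -∫ x in P.Ω, ∑ j, P.flux (z t) x j * pd j (dt z t) x := by
  have hΩ := hP.domain
  have hΩm := hΩ.isOpen.measurableSet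
  obtain ⟨L, hL⟩ := hs.exists_lipschitzOnWith_dt_z hP t
  obtain ⟨K, hK⟩ := hs.flux t ht
  have hKj : ∀ j, LipschitzOnWith K (fun x => P.flux (z t) x j) P.Ω := fun j =>
    LipschitzOnWith.of_dist_le_mul fun x hx y hy => by
      rw [Real.dist_eq]
      refine le_trans ?_ (hK.dist_le_mul x hx y hy)
      rw [dist_eq_norm]
      exact PiLp.norm_apply_le (P.flux (z t) x - P.flux (z t) y) j
  choose S hS hSeq using fun j => (hKj j).extend_real
  -- `w` is the Lipschitz extension of the flux; the values of `γ ∇z` outside `Ω` play no role.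
  let w : Pt (n + 1) → Pt (n + 1) := fun x => WithLp.toLp 2 fun j => S j x
  have hwL : ∀ j, ∃ K : ℝ≥0, LipschitzOnWith K (fun x => w x j) (closure P.Ω) := fun j =>
    ⟨K, (hS j).lipschitzOnWith⟩
  have hw : ∀ x ∈ P.Ω, ∀ j, P.flux (z t) x j = w x j := fun x hx j => hSeq j hx
  have hdiv : ∀ x ∈ P.Ω, vdiv (P.flux (z t)) x = vdiv w x := fun x hx => by
    refine Finset.sum_congr rfl fun j _ => ?_
    have h1 : (fun y => P.flux (z t) y j) =ᶠ[𝓝 x] fun y => w y j := by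
      filter_upwards [hΩ.isOpen.mem_nhds hx] with y hy using hw y hy j
    rw [pd, pd, h1.fderiv_eq]
  have hb : ∀ x ∈ frontier P.Ω, ∀ m, IsOutwardNormal P.Ω x m → ⟪w x, m⟫_ℝ = 0 := by
    intro x hx m hm
    obtain ⟨M, hM⟩ := exists_ae_abs_le_of_memLp_top hP.toughness_bounded
    have hwc : Continuous w := (PiLp.continuous_toLp 2 _).comp
      (continuous_pi fun j => (hS j).continuous)
    have hgc : Continuous (gradient (z t)) := by
      have h2 : gradient (z t) = fun x => WithLp.toLp 2 fun j => pd j (z t) x := by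
        funext x; ext j; exact gradient_apply _ _ _
      rw [h2]
      exact (PiLp.continuous_toLp 2 _).comp
        (continuous_pi fun j => continuous_slice (hs.isC11_z.locallyLipschitz_pd j) t)
    have h3 := le_of_ae_le_of_mem_closure (μ := volume) hΩ.isOpen hΩm
      (f := fun y => |⟪w y, m⟫_ℝ|) (g := fun y => M * |⟪gradient (z t) y, m⟫_ℝ|)
      (by fun_prop) (by fun_prop) ?_ (frontier_subset_closure hx)
    · rw [hsol.normalDerivative t ht x hx m hm, abs_zero, mul_zero] at h3
      exact abs_eq_zero.1 (h3.antisymm (abs_nonneg _))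
    · filter_upwards [hM, ae_restrict_mem hΩm] with y hy hyΩ
      have h4 : w y = P.γ y • gradient (z t) y := by
        ext j; exact (hw y hyΩ j).symm
      rw [h4, real_inner_smul_left, abs_mul]
      gcongr
  have h0 : ∫ x in frontier P.Ω, ⟪w x, outwardNormal P.Ω x⟫_ℝ * dt z t x ∂surface (n + 1) = 0 := by
    refine integral_eq_zero_of_ae ?_
    filter_upwards [hΩ.ae_isOutwardNormal, ae_restrict_mem isClosed_frontier.measurableSet]
      with x hx hxf
    rw [hb x hxf _ hx, zero_mul]
    rfl
  refine ⟨(hΩ.integrable_vdiv_mul hwL hL).congr ?_, (hΩ.integrable_sum_mul_pd hwL hL).congr ?_, ?_⟩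
  · filter_upwards [ae_restrict_mem hΩm] with x hx
    rw [hdiv x hx]
  · filter_upwards [ae_restrict_mem hΩm] with x hx
    simp only [hw x hx]
  · have h5 := hΩ.setIntegral_vdiv_mul hwL hL
    rw [h0, zero_sub] at h5
    rw [setIntegral_congr_fun hΩm fun x hx => by rw [hdiv x hx], h5]
    congr 1
    exact setIntegral_congr_fun hΩm fun x hx => by simp only [hw x hx]

theorem memLp_W (hs : P.Smooth u z) (hP : P.Admissible) (t : ℝ) :
    MemLp (fun x => P.W (u t) x) ∞ (volume.restrict P.Ω) := by
  have he : ∀ i j, MemLp (fun x => strain (u t) x i j) ∞ (volume.restrict P.Ω) := fun i j =>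
    hP.domain.memLp_top_of_continuousOn
      (continuous_slice (hs.locallyLipschitz_strain i j) t).continuousOn
  simp only [Data.W, ddot, Data.stress, Matrix.of_apply]
  refine memLp_finsetSum _ fun i _ => memLp_finsetSum _ fun j _ =>
    (he i j).mul' (p := ∞) (q := ∞) ?_
  exact memLp_finsetSum _ fun k _ => memLp_finsetSum _ fun l _ =>
    (he k l).mul' (hP.elasticity_bounded i j k l)

end Data.Smooth

end Divergence

/-! ### The energy balance -/

section Balance

variable {n : ℕ} {P : Data (n + 1)} {u : ℝ → Pt (n + 1) → Pt (n + 1)} {z : ℝ → Pt (n + 1) → ℝ}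

/-- At the Dirichlet part the prescribed and the actual velocity agree, so the total power of the
traction splits into the contributions of `g` and of `q`. -/
theorem Data.Smooth.setIntegral_frontier_power (hs : P.Smooth u z) (hP : P.Admissible)
    (hsol : P.IsSolution u z) {t : ℝ} (ht : t ∈ Ioo 0 P.T) :
    ∫ x in frontier P.Ω, ⟪tapply (P.damagedStress (u t) (z t) x) (outwardNormal P.Ω x),
        dt u t x⟫_ℝ ∂surface (n + 1) =
      (∫ x in P.ΓD, ⟪dt P.g t x, tapply (P.damagedStress (u t) (z t) x)
        (outwardNormal P.Ω x)⟫_ℝ ∂surface (n + 1)) +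
      ∫ x in P.ΓN, ⟪tapply (P.damagedStress (u t) (z t) x) (outwardNormal P.Ω x),
        dt u t x⟫_ℝ ∂surface (n + 1) := by
  have hi := hs.integrable_boundary_work hP (Ioo_subset_Icc_self ht) (hs.continuous_dt_u_vec t)
  rw [← hP.union] at hi ⊢
  rw [setIntegral_union hP.disjoint hP.measurable_ΓN
    (IntegrableOn.mono_set hi subset_union_left) (IntegrableOn.mono_set hi subset_union_right)]
  congr 1
  · refine setIntegral_congr_fun hP.measurable_ΓD fun x hx => ?_
    have h1 : dt P.g t x = dt u t x := by
      refine EventuallyEq.deriv_eq ?_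
      filter_upwards [Icc_mem_nhds ht.1 ht.2] with s hsI
      exact (hsol.dirichlet s hsI x hx).symm
    simp only [h1]
    exact real_inner_comm _ _

/-- The power of the driving force of the damage variable: where the positive part in the evolution
law is active it equals `α ż²`, and elsewhere `ż = 0`. -/
theorem mul_sq_eq_of_mul_eq_max {α a r : ℝ} (h : α * a = max r 0) (hα : α ≠ 0) :
    α * a ^ 2 = r * a := by
  rcases le_total r 0 with hr | hr
  · rw [max_eq_right hr] at h
    have : a = 0 := (mul_eq_zero.1 h).resolve_left hα
    simp [this]
  · rw [max_eq_left hr] at h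
    rw [sq, ← mul_assoc, h]

/-- The energy balance, in any dimension `n + 1`. -/
theorem ae_hasDerivAt_energy (hP : P.Admissible) (hs : P.Smooth u z) (hsol : P.IsSolution u z) :
    ∀ᵐ t ∂volume.restrict (Ioo 0 P.T),
      HasDerivAt (fun s => P.energy s (u s) (dt u s) (z s))
        (-P.α * (∫ x in P.Ω, |dt z t x| ^ 2) + P.injectionRate t (u t) (z t)) t := by
  filter_upwards [hs.ae_hasDerivAt, hP.ae_differentiableAt_force,
    hs.ae_differentiableAt_damagedStress hP, hsol.momentum, hsol.damage,
    ae_restrict_mem measurableSet_Ioo] with t hreg hf hq hmom hdam ht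
  have htI : t ∈ Icc 0 P.T := Ioo_subset_Icc_self ht
  have hΩ := hP.domain
  have hel := hs.hasDerivAt_elastic hP ht (hreg.mono fun x hx => hx.2.1)
  have hki := hs.hasDerivAt_kinetic hP ht (hreg.mono fun x hx => hx.1)
  have hcr := hs.hasDerivAt_crack hP ht (hreg.mono fun x hx => hx.2.2)
  obtain ⟨hfi, hfd⟩ := hs.hasDerivAt_force hP ht hf
  have hqd := hs.hasDerivAt_surfaceForce hP hsol ht hq
  obtain ⟨hVi, hCi, hV⟩ := hs.setIntegral_vdiv_flux hP hsol htI
  have hdz : MemLp (dt z t) ∞ (volume.restrict P.Ω) := hΩ.memLp_top_of_continuousOn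
    (Data.Smooth.continuous_slice hs.isC11_z.locallyLipschitz_dt t).continuousOn
  have hz : MemLp (z t) ∞ (volume.restrict P.Ω) := hΩ.memLp_top_of_continuousOn
    (Data.Smooth.continuous_slice hs.isC11_z.locallyLipschitz t).continuousOn
  have hz1 : MemLp (fun x => 1 - z t x) ∞ (volume.restrict P.Ω) := hΩ.memLp_top_of_continuousOn
    (continuous_const.sub (Data.Smooth.continuous_slice hs.isC11_z.locallyLipschitz t)).continuousOn
  have hBi : Integrable (fun x => dt z t x * ((1 - z t x) * P.W (u t) x)) (volume.restrict P.Ω) :=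
    hΩ.integrable_of_memLp_top (((hs.memLp_W hP t).mul' hz1 (r := ∞)).mul' hdz)
  have hγ : MemLp (fun x => P.γ x / P.ε) ∞ (volume.restrict P.Ω) := by
    simp_rw [div_eq_mul_inv]
    exact hP.toughness_bounded.mul_const _
  have hGi : Integrable (fun x => P.γ x / P.ε * z t x * dt z t x) (volume.restrict P.Ω) :=
    hΩ.integrable_of_memLp_top (hdz.mul' (hz.mul' hγ (r := ∞)))
  have hAi := hs.integrable_stress_power hP htI
  -- The momentum equation tested with the velocity.
  have hmom' : P.ρ * ∫ x in P.Ω, ⟪dt (dt u) t x, dt u t x⟫_ℝ =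
      (∫ x in P.Ω, ⟪tdiv (P.damagedStress (u t) (z t)) x, dt u t x⟫_ℝ) +
        ∫ x in P.Ω, ⟪P.f t x, dt u t x⟫_ℝ := by
    rw [← integral_const_mul, ← integral_add (hs.integrable_inner_tdiv hP htI) hfi]
    refine integral_congr_ae ?_
    filter_upwards [hmom] with x hx
    rw [← real_inner_smul_left, hx, inner_add_left]
  -- The damage law tested with the damage rate.
  have hdam' : P.α * ∫ x in P.Ω, |dt z t x| ^ 2 =
      P.ε * (∫ x in P.Ω, vdiv (P.flux (z t)) x * dt z t x) -
        (∫ x in P.Ω, P.γ x / P.ε * z t x * dt z t x) +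
        ∫ x in P.Ω, dt z t x * ((1 - z t x) * P.W (u t) x) := by
    rw [← integral_const_mul, ← integral_const_mul, ← integral_sub (hVi.const_mul _) hGi,
      ← integral_add ((hVi.const_mul P.ε).sub' hGi) hBi]
    refine integral_congr_ae ?_
    filter_upwards [hdam] with x hx
    rw [sq_abs, mul_sq_eq_of_mul_eq_max hx hP.viscosity_pos.ne']
    ring
  have hdiv := hs.setIntegral_inner_tdiv hP htI
  rw [hs.setIntegral_frontier_power hP hsol ht] at hdiv
  refine (((((hel.const_mul (1 / 2 : ℝ)).sub hfd).sub hqd).add (hki.const_mul (P.ρ / 2))).add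
    (hcr.const_mul (1 / 2 : ℝ))).congr_deriv ?_
  rw [integral_const_mul, integral_const_mul, integral_const_mul, integral_sub hAi hBi,
    integral_add (hCi.const_mul _) hGi, integral_const_mul, Data.injectionRate]
  linear_combination hdiv + hmom' + hdam' + P.ε * hV

end Balance

end DynamicFracture

theorem theorem1 {d : ℕ} (hd : d = 2 ∨ d = 3) (P : DynamicFracture.Data d) (hP : P.Admissible)
    (u : ℝ → DynamicFracture.Pt d → DynamicFracture.Pt d) (z : ℝ → DynamicFracture.Pt d → ℝ)
    (hsmooth : P.Smooth u z) (hsol : P.IsSolution u z) :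
    ∀ᵐ t ∂volume.restrict (Ioo 0 P.T),
      HasDerivAt (fun s => P.energy s (u s) (DynamicFracture.dt u s) (z s))
        (-P.α * (∫ x in P.Ω, |DynamicFracture.dt z t x| ^ 2) + P.injectionRate t (u t) (z t)) t := by
  rcases hd with rfl | rfl
  · exact DynamicFracture.ae_hasDerivAt_energy hP hsmooth hsol
  · exact DynamicFracture.ae_hasDerivAt_energy hP hsmooth hsol
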